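/- An embedded multigraph (loops and multi-edges allowed) is a finite multigraph together with, for each vertex, a counter-clockwise circular order of the edge ends at it; it is a connected plane graph if it is connected and the embedding has genus $0$ (Euler's formula). A corner is a pair of consecutive edge ends at a vertex. An ortho-radial representation $\mathcal R$ assigns to every corner an angle in $\{90^\circ,180^\circ,270^\circ\}$ ($360^\circ$ at a vertex with only one edge end) and designates a central face and an outer face (possibly equal). Condition (R1): the angles around each vertex sum to $360^\circ$. Condition (R2): the angles around a face with $k$ corners sum to $(k-2)\cdot180^\circ$ for a face that is neither central nor outer, to $k\cdot180^\circ$ if it is exactly one of the two, and to $(k+2)\cdot180^\circ$ if it is both. $\mathcal R$ is drawable if it is realized by a plane drawing in which no vertex or edge meets the origin, each edge is a single radial segment or a single circular arc (possibly a full circle for a loop) centred at the origin, the circular orders and corner angles are as prescribed, the central face contains the origin, and the outer face is unbounded. Thickening. Given $(G,\mathcal R)$, replace each vertex $v$ by the $3\times3$ grid graph on $v_{i,j}$, $i,j\in\{-1,0,1\}$. Its four sides, the boundary paths $P^v_{1,0}=(v_{1,1},v_{1,0},v_{1,-1})$, $P^v_{0,-1}=(v_{1,-1},v_{0,-1},v_{-1,-1})$,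 $P^v_{-1,0}=(v_{-1,-1},v_{-1,0},v_{-1,1})$, $P^v_{0,1}=(v_{-1,1},v_{0,1},v_{1,1})$, are assigned injectively to the edge ends at $v$, consistently with their circular order and the angles at $v$. Replace each edge $\{u,v\}$, assigned to $P^u_{i,j}=(x_1,x_2,x_3)$ and to the reversal $(y_1,y_2,y_3)$ of $P^v_{k,l}$, by the three edges $\{x_1,y_1\},\{x_2,y_2\},\{x_3,y_3\}$. The embedding of $G'$ is the one given by these grids and parallel edges. In $\mathcal R'$ all angles inside the grid squares and inside the two $4$-cycles between the three copies of an edge are $90^\circ$; the remaining angles make the sum at every vertex $360^\circ$. The central (outer) face of $\mathcal R'$ is the face corresponding to the central (outer) face of $\mathcal R$. Theorem. Let $G$ be a connected plane graph with $n$ vertices, possibly with loops and multi-edges, and let $\mathcal R$ be an ortho-radial representation of $G$ satisfying (R1) and (R2). Every thickening $(G',\mathcal R')$ of $(G,\mathcal R)$ is a biconnected simple plane graph with an ortho-radial representation that satisfies (R1) and (R2), and $\mathcal R$ is drawable if and only if $\mathcal R'$ is drawable. Moreover, there are two programs for a random access machine (unit cost, addition and subtraction of natural numbers, indirect addressing;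 real numbers can only be copied) such that, for every such $(G,\mathcal R)$, the first one computes a thickening $(G',\mathcal R')$ of $(G,\mathcal R)$ in $O(n)$ steps, and the second one, given $(G,\mathcal R)$ and any ortho-radial drawing realizing $\mathcal R'$ without bends, computes in $O(n)$ steps an ortho-radial drawing realizing $\mathcal R$ without bends. Here a drawing is given by the polar coordinates of its vertices and the direction (outward, counter-clockwise, inward, clockwise) in which each edge leaves each of its ends. -/

import Mathlib

/-! ### Embedded multigraphs -/

/-- A multigraph (loops and parallel edges allowed) with `n` vertices and `m` edges, together with a
combinatorial embedding.  Every undirected edge consists of two darts (directed copies) exchanged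
by `rev`; a dart is attached to its tail, so the darts with tail `v` are the edge ends at `v` (a
loop contributes two of them).  `next d` is the dart that follows `d` in the counter-clockwise
circular order of the darts around the tail of `d`. -/
structure EmbeddedGraph (n m : ℕ) where
  tail : Fin (2 * m) → Fin n
  rev : Fin (2 * m) → Fin (2 * m)
  rev_rev : ∀ d, rev (rev d) = d
  rev_ne : ∀ d, rev d ≠ d
  next : Equiv.Perm (Fin (2 * m))
  tail_eq_iff : ∀ d e, tail d = tail e ↔ next.SameCycle d e

namespace EmbeddedGraph

variable {n m : ℕ} (G : EmbeddedGraph n m)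

/-- The end vertex of a dart. -/
def head (d : Fin (2 * m)) : Fin n := G.tail (G.rev d)

/-- The reversal of darts, as a permutation. -/
def revPerm : Equiv.Perm (Fin (2 * m)) := ⟨G.rev, G.rev, G.rev_rev, G.rev_rev⟩

/-- The face traversal that keeps the face on the left-hand side: after `d` comes the dart at the
head of `d` that immediately precedes `rev d` in the counter-clockwise order. -/
def facePerm : Equiv.Perm (Fin (2 * m)) := G.revPerm.trans G.next.symm

/-- The faces are the orbits of the face traversal. -/
abbrev Face : Type := Quotient (Equiv.Perm.SameCycle.setoid G.facePerm)

/-- The face on the left of the dart `d`.  The corner `(d, next d)` belongs to this face, and every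
corner is of this form for exactly one `d`. -/
def face (d : Fin (2 * m)) : G.Face := Quotient.mk (Equiv.Perm.SameCycle.setoid G.facePerm) d

/-- The simple graph of adjacency between distinct vertices. -/
def adjacency : SimpleGraph (Fin n) :=
  SimpleGraph.fromRel fun u v => ∃ d, G.tail d = u ∧ G.head d = v

/-- A connected plane graph: the graph is connected and the embedding has genus zero, expressed by
the formula of Euler. -/
def IsPlane : Prop := G.adjacency.Connected ∧ n + Nat.card G.Face = m + 2

/-- No loops and no parallel edges. -/
def IsSimple : Prop :=
  (∀ d, G.tail d ≠ G.head d) ∧ ∀ d e, G.tail d = G.tail e → G.head d = G.head e → d = e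

/-- At least three vertices, connected, and without a cut vertex. -/
def IsBiconnected : Prop :=
  2 < n ∧ G.adjacency.Connected ∧ ∀ v : Fin n, (G.adjacency.induce {v}ᶜ).Connected

end EmbeddedGraph

/-! ### Ortho-radial representations -/

/-- An ortho-radial representation.  `turn d` is the angle of the corner `(d, next d)` in multiples
of `90°`: one of `90°`, `180°`, `270°`, and `360°` if `d` is the only dart at its tail. -/
structure OrthoRep {n m : ℕ} (G : EmbeddedGraph n m) where
  turn : Fin (2 * m) → ℕ
  turn_of_ne : ∀ d, G.next d ≠ d → turn d ∈ Finset.Icc 1 3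
  turn_of_eq : ∀ d, G.next d = d → turn d = 4
  central : G.Face
  outer : G.Face

namespace OrthoRep

variable {n m : ℕ} {G : EmbeddedGraph n m} (R : OrthoRep G)

open Classical in
/-- The sum of the angles around each vertex is `360°`. -/
def VertexCondition : Prop :=
  ∀ v : Fin n, ∑ d with G.tail d = v, R.turn d = 4

open Classical in
/-- The number of corners of a face. -/
noncomputable def faceLength (_ : OrthoRep G) (F : G.Face) : ℕ :=
  (Finset.univ.filter fun d => G.face d = F).card

open Classical in
/-- The sum of the angles of the corners of a face, in multiples of `90°`. -/
noncomputable def faceSum (F : G.Face) : ℕ := ∑ d with G.face d = F, R.turn d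

/-- The sum of the angles around a face with `k` corners is `(k - 2) * 180°` for a regular face,
`k * 180°` if the face is either the central or the outer face but not both, and `(k + 2) * 180°`
if it is both. -/
def FaceCondition : Prop :=
  ∀ F : G.Face,
    (F ≠ R.central → F ≠ R.outer → (R.faceSum F : ℤ) = 2 * ((R.faceLength F : ℤ) - 2)) ∧
    (F = R.central → F ≠ R.outer → (R.faceSum F : ℤ) = 2 * (R.faceLength F : ℤ)) ∧
    (F ≠ R.central → F = R.outer → (R.faceSum F : ℤ) = 2 * (R.faceLength F : ℤ)) ∧
    (F = R.central → F = R.outer → (R.faceSum F : ℤ) = 2 * ((R.faceLength F : ℤ) + 2))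

/-- `dir` assigns to each dart one of four directions at its tail, numbered counter-clockwise with
`90°` between consecutive ones.  It matches the representation if for every dart `d` the dart
`next d` lies `turn d` quarter turns counter-clockwise from `d`, with no dart at the same vertex
strictly in between. -/
def Matches (dir : Fin (2 * m) → ZMod 4) : Prop :=
  ∀ d, dir (G.next d) = dir d + (R.turn d : ZMod 4) ∧
    ∀ j : ℕ, 0 < j → j < R.turn d → ∀ e, G.tail e = G.tail d → dir e ≠ dir d + (j : ZMod 4)

end OrthoRep

/-! ### Ortho-radial drawings without bends -/

/-- The data of an ortho-radial drawing with zero bends: polar coordinates of every vertex, and the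
direction in which every dart leaves its tail, where `0` is radially outward, `1` is
counter-clockwise, `2` is radially inward and `3` is clockwise.  The curve of a dart is then
determined, see `Drawing.curve`. -/
structure Drawing (n m : ℕ) where
  radius : Fin n → ℝ
  angle : Fin n → ℝ
  dir : Fin (2 * m) → ZMod 4

namespace Drawing

variable {n m : ℕ} (D : Drawing n m)

/-- The point with polar coordinates `(r, t)`. -/
noncomputable def polar (r t : ℝ) : ℂ := (r : ℂ) * Complex.exp ((t : ℂ) * Complex.I)

/-- The position of a vertex. -/
noncomputable def pos (v : Fin n) : ℂ := polar (D.radius v) (D.angle v)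

/-- The angle in `(0, 2π]` by which one has to turn counter-clockwise from angle `a` until angle `b`
is first reached. -/
noncomputable def sweep (a b : ℝ) : ℝ := toIocMod Real.two_pi_pos 0 (b - a)

/-- The curve of the dart `d`, parametrized by `[0, 1]`: a radial segment, or the circular arc that
starts at the tail, runs in the direction of `d` and stops when the angle of the head is first
reached (a full circle for a loop). -/
noncomputable def curve (G : EmbeddedGraph n m) (d : Fin (2 * m)) (t : ℝ) : ℂ :=
  let u := G.tail d
  let v := G.head d
  if D.dir d = 1 then
    polar (D.radius u) (D.angle u + t * sweep (D.angle u) (D.angle v))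
  else if D.dir d = 3 then
    polar (D.radius u) (D.angle u - t * sweep (D.angle v) (D.angle u))
  else
    polar ((1 - t) * D.radius u + t * D.radius v) (D.angle u)

/-- The set of points covered by the drawing. -/
def image (G : EmbeddedGraph n m) : Set ℂ :=
  Set.range D.pos ∪ ⋃ d, D.curve G d '' Set.Icc 0 1

/-- The point at distance `ε` to the left of the midpoint of the dart `d`: at a point `p`, direction
number `k` is the unit vector `(p / ‖p‖) * I ^ k`. -/
noncomputable def leftPoint (G : EmbeddedGraph n m) (d : Fin (2 * m)) (ε : ℝ) : ℂ :=
  D.curve G d (1 / 2) + (ε : ℂ) * ((D.curve G d (1 / 2) / ‖D.curve G d (1 / 2)‖) *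
    Complex.I ^ ((D.dir d).val + 1))

/-- The region (connected component of the complement of the drawing) of a point. -/
def region (G : EmbeddedGraph n m) (p : ℂ) : Set ℂ := connectedComponentIn (D.image G)ᶜ p

/-- `D` is a plane ortho-radial drawing with zero bends of the embedded graph `G` that realizes the
representation `R`. -/
structure Realizes {G : EmbeddedGraph n m} (D : Drawing n m) (R : OrthoRep G) : Prop where
  /-- no vertex at the origin -/
  radius_pos : ∀ v, 0 < D.radius v
  /-- every curve ends at the head of its dart -/
  curve_one : ∀ d, D.curve G d 1 = D.pos (G.head d)
  outward : ∀ d, D.dir d = 0 → D.radius (G.tail d) < D.radius (G.head d)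
  inward : ∀ d, D.dir d = 2 → D.radius (G.head d) < D.radius (G.tail d)
  /-- the two darts of an edge are drawn as one curve, traversed in opposite directions -/
  dir_rev : ∀ d, D.dir (G.rev d) = D.dir d + 2
  pos_injective : Function.Injective D.pos
  /-- edges do not pass through vertices -/
  curve_ne_pos : ∀ d, ∀ t ∈ Set.Ioo (0 : ℝ) 1, ∀ v, D.curve G d t ≠ D.pos v
  /-- edges cross neither each other nor themselves -/
  curve_disjoint : ∀ d e, ∀ t ∈ Set.Ioo (0 : ℝ) 1, ∀ s ∈ Set.Ioo (0 : ℝ) 1,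
    D.curve G d t = D.curve G e s → (e = d ∧ s = t) ∨ (e = G.rev d ∧ s = 1 - t)
  /-- the circular orders and the angles of the corners are as prescribed -/
  angles : R.Matches D.dir
  /-- the region bounded by the central face contains the origin -/
  central : ∀ d, G.face d = R.central →
    ∀ᶠ ε in nhdsWithin (0 : ℝ) (Set.Ioi 0), (0 : ℂ) ∈ D.region G (D.leftPoint G d ε)
  /-- the region bounded by the outer face is unbounded -/
  outer : ∀ d, G.face d = R.outer →
    ∀ᶠ ε in nhdsWithin (0 : ℝ) (Set.Ioi 0),
      ¬ Bornology.IsBounded (D.region G (D.leftPoint G d ε))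

end Drawing

/-- A representation is drawable if some ortho-radial drawing with zero bends realizes it. -/
def OrthoRep.Drawable {n m : ℕ} {G : EmbeddedGraph n m} (R : OrthoRep G) : Prop :=
  ∃ D : Drawing n m, D.Realizes R

/-! ### Thickening -/

/-- The positions `(i, j)` with `i, j ∈ {-1, 0, 1}` of the grid that replaces a vertex. -/
abbrev GridPos : Type := SignType × SignType

/-- Darts of the grid: ordered pairs of positions with `|i - i'| + |j - j'| = 1`. -/
abbrev GridDart : Type :=
  {x : GridPos × GridPos //
    |(x.1.1 : ℤ) - (x.2.1 : ℤ)| + |(x.1.2 : ℤ) - (x.2.2 : ℤ)| = 1}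

/-- The reversal of a dart of the grid. -/
def GridDart.swap (x : GridDart) : GridDart :=
  ⟨(x.1.2, x.1.1), by
    rw [abs_sub_comm (x.1.2.1 : ℤ), abs_sub_comm (x.1.2.2 : ℤ)]
    exact x.2⟩

/-- The direction of a dart of the grid: `0, 1, 2, 3` stand for the steps
`(1, 0), (0, 1), (-1, 0), (0, -1)`. -/
def GridDart.dir (x : GridDart) : ZMod 4 :=
  if x.1.1.1 < x.1.2.1 then 0
  else if x.1.1.2 < x.1.2.2 then 1
  else if x.1.2.1 < x.1.1.1 then 2
  else 3

/-- The boundary path on side `δ` of the grid; its three vertices in clockwise order are those with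
`s = 1, 0, -1`.  Side `0` is `(1,1), (1,0), (1,-1)`, side `1` is `(-1,1), (0,1), (1,1)`,
side `2` is `(-1,-1), (-1,0), (-1,1)`, and side `3` is `(1,-1), (0,-1), (-1,-1)`. -/
def gridSide (δ : ZMod 4) (s : SignType) : GridPos :=
  if δ = 0 then (1, s)
  else if δ = 1 then (-s, 1)
  else if δ = 2 then (-1, -s)
  else (s, -1)

/-- The representation `R'` of `G'` arises from the representation `R` of `G` by thickening. -/
structure Thickening {n m n' m' : ℕ} {G : EmbeddedGraph n m} {G' : EmbeddedGraph n' m'}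
    (R : OrthoRep G) (R' : OrthoRep G') where
  /-- every dart at `v` is associated with one of the four sides of the grid of `v` ... -/
  side : Fin (2 * m) → ZMod 4
  /-- ... consistently with the circular order and the angles at `v` -/
  side_matches : R.Matches side
  /-- the vertices of `G'` are the vertices `v_{i,j}` of the grids -/
  vtx : Fin n × GridPos ≃ Fin n'
  /-- the darts of `G'` are those of the grids and three parallel copies of each dart of `G` -/
  dart : (Fin n × GridDart) ⊕ (Fin (2 * m) × SignType) ≃ Fin (2 * m')
  tail_grid : ∀ v x, G'.tail (dart (.inl (v, x))) = vtx (v, x.1.1)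
  rev_grid : ∀ v x, G'.rev (dart (.inl (v, x))) = dart (.inl (v, x.swap))
  /-- the three copies of an edge join the two boundary paths associated with the edge, the path
  at one end being traversed clockwise and the other one counter-clockwise -/
  tail_copy : ∀ d s, G'.tail (dart (.inr (d, s))) = vtx (G.tail d, gridSide (side d) s)
  rev_copy : ∀ d s, G'.rev (dart (.inr (d, s))) = dart (.inr (G.rev d, -s))
  /-- The circular orders and angles of `G'` are those of the grids drawn as grids, the three copies
  of an edge leaving the grid perpendicularly to its side.  Thus the angles inside the four squares
  of a grid and inside the two rectangles between the copies of an edge are `90°`, and the one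
  remaining angle at a vertex, if any, completes the sum to `360°`. -/
  matches' : R'.Matches fun e =>
    Sum.elim (fun x : Fin n × GridDart => x.2.dir)
      (fun y : Fin (2 * m) × SignType => side y.1) (dart.symm e)
  /-- the face on the left of `d` becomes the face on the left of the leftmost copy of `d` -/
  central : ∀ d, G.face d = R.central → G'.face (dart (.inr (d, 1))) = R'.central
  outer : ∀ d, G.face d = R.outer → G'.face (dart (.inr (d, 1))) = R'.outer

/-! ### A random access machine -/

/-- A state of the machine: registers and a memory holding natural numbers, and a memory holding
real numbers. -/
structure RamState where
  reg : ℕ → ℕ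
  mem : ℕ → ℕ
  real : ℕ → ℝ

/-- Arithmetic expressions; `sub` is truncated subtraction. -/
inductive RamExpr where
  | const (k : ℕ)
  | reg (x : ℕ)
  | load (a : RamExpr)
  | add (a b : RamExpr)
  | sub (a b : RamExpr)

/-- The value of an expression. -/
def RamExpr.eval (s : RamState) : RamExpr → ℕ
  | .const k => k
  | .reg x => s.reg x
  | .load a => s.mem (a.eval s)
  | .add a b => a.eval s + b.eval s
  | .sub a b => a.eval s - b.eval s

/-- The number of elementary steps needed to evaluate an expression. -/
def RamExpr.cost : RamExpr → ℕ
  | .const _ => 1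
  | .reg _ => 1
  | .load a => a.cost + 1
  | .add a b => a.cost + b.cost + 1
  | .sub a b => a.cost + b.cost + 1

/-- Programs: `assign x e` writes a register, `store a e` writes the memory cell with address `a`,
`move a b` copies the real number in cell `b` of the real memory to cell `a` (the only operation on
real numbers), `ite` and `loop` test whether an expression is nonzero. -/
inductive RamProg where
  | assign (x : ℕ) (e : RamExpr)
  | store (a e : RamExpr)
  | move (a b : RamExpr)
  | seq (p q : RamProg)
  | ite (e : RamExpr) (p q : RamProg)
  | loop (e : RamExpr) (p : RamProg)

/-- `Runs p s t s'`: started in state `s`, program `p` halts after `t` steps in state `s'`. -/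
inductive Runs : RamProg → RamState → ℕ → RamState → Prop
  | assign (s : RamState) (x : ℕ) (e : RamExpr) :
      Runs (.assign x e) s (e.cost + 1) { s with reg := Function.update s.reg x (e.eval s) }
  | store (s : RamState) (a e : RamExpr) :
      Runs (.store a e) s (a.cost + e.cost + 1)
        { s with mem := Function.update s.mem (a.eval s) (e.eval s) }
  | move (s : RamState) (a b : RamExpr) :
      Runs (.move a b) s (a.cost + b.cost + 1)
        { s with real := Function.update s.real (a.eval s) (s.real (b.eval s)) }
  | seq {p q : RamProg} {s s₁ s₂ : RamState} {t₁ t₂ : ℕ} :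
      Runs p s t₁ s₁ → Runs q s₁ t₂ s₂ → Runs (.seq p q) s (t₁ + t₂) s₂
  | ite_true {e : RamExpr} {p q : RamProg} {s s₁ : RamState} {t : ℕ} :
      e.eval s ≠ 0 → Runs p s t s₁ → Runs (.ite e p q) s (e.cost + 1 + t) s₁
  | ite_false {e : RamExpr} {p q : RamProg} {s s₁ : RamState} {t : ℕ} :
      e.eval s = 0 → Runs q s t s₁ → Runs (.ite e p q) s (e.cost + 1 + t) s₁
  | loop_stop {e : RamExpr} {p : RamProg} {s : RamState} :
      e.eval s = 0 → Runs (.loop e p) s (e.cost + 1) s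
  | loop_step {e : RamExpr} {p : RamProg} {s s₁ s₂ : RamState} {t₁ t₂ : ℕ} :
      e.eval s ≠ 0 → Runs p s t₁ s₁ → Runs (.loop e p) s₁ t₂ s₂ →
      Runs (.loop e p) s (e.cost + 1 + t₁ + t₂) s₂

namespace RamState

/-- From address `b` on, the memory holds the embedded graph `G` and its representation `R`: the
numbers of vertices and edges, a dart of the central face, a dart of the outer face, and for
each dart its tail, its reversal, its successor and the angle of its corner.  This block occupies
`4 + 8 * m` cells. -/
def HoldsRep {n m : ℕ} {G : EmbeddedGraph n m} (s : RamState) (b : ℕ) (R : OrthoRep G) : Prop :=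
  s.mem b = n ∧ s.mem (b + 1) = m ∧
  (∃ d : Fin (2 * m), G.face d = R.central ∧ s.mem (b + 2) = d) ∧
  (∃ d : Fin (2 * m), G.face d = R.outer ∧ s.mem (b + 3) = d) ∧
  ∀ d : Fin (2 * m),
    s.mem (b + 4 + 4 * d) = G.tail d ∧ s.mem (b + 4 + 4 * d + 1) = G.rev d ∧
    s.mem (b + 4 + 4 * d + 2) = G.next d ∧ s.mem (b + 4 + 4 * d + 3) = R.turn d

/-- The directions of the darts are stored in the memory from address `b` on, and the polar
coordinates of the vertices in the real memory from address `c` on. -/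
def HoldsDrawing {n m : ℕ} (s : RamState) (b c : ℕ) (D : Drawing n m) : Prop :=
  (∀ d : Fin (2 * m), s.mem (b + d) = (D.dir d).val) ∧
  ∀ v : Fin n, s.real (c + 2 * v) = D.radius v ∧ s.real (c + 2 * v + 1) = D.angle v

/-- An initial state whose input occupies the first `k` memory cells and the first `l` cells of the
real memory: everything else is zero. -/
def IsInitial (s : RamState) (k l : ℕ) : Prop :=
  (∀ x, s.reg x = 0) ∧ (∀ i, k ≤ i → s.mem i = 0) ∧ ∀ i, l ≤ i → s.real i = 0

end RamState

/-!
The proof rests on the directions of darts. By the vertex condition the angles between a chosen dart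
at a vertex and the other darts there, summed up in quarter turns, give every dart a direction in
`ZMod 4` such that distinct darts at a vertex have distinct directions
(`OrthoRep.VertexCondition.dir_injective`); two such assignments differ by one rotation per vertex
(`OrthoRep.Matches.sub_eq`). Conversely directions determine the circular orders and the angles
(`OrthoRep.Matches.next_eq`, `exists_circularOrder`). Hence a thickening exists for every choice of
sides (`exists_thickening`), and the successor and the angle of each dart of `G'` can be read off
from its direction in a grid in standard position.

Combinatorics. Tracing the faces of `G'` shows that they are the faces of `G`, the four squares of
each grid, and two rectangles for each edge (`PreThickening.faceEquiv`). Counting them gives Euler's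
formula for `G'`. The squares and the rectangles have four right angles, and a thickened face has
the same excess of the angle sum over `180°` per corner as the original face
(`PreThickening.excess_face`), which is the face condition. By the face condition for `G`, no face
is bounded by one edge with an angle of `90°`, or by two edges with two such angles; these are the
only ways in which a thickening could have loops or multi-edges. It is biconnected, since a grid
minus a vertex is connected and the removal of a vertex leaves a copy of each edge of `G` between
distinct vertices.

Drawings. In the plane of radius and angle, where angles matter modulo `2π`, every edge is a
straight segment, and the region on the left of a dart does not change along a face
(`Drawing.Draws.region_face`). From a drawing of `G'`, the centres of the grids and the paths
through the middle copies of the edges form a drawing of `G`, as the three edges of such a path are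
collinear; a path along a circle is not longer than `2π`, because it would overlap itself
(`PreThickening.draws_restrict`). The region to the left of a thickened face only grows when the
other edges are removed (`PreThickening.region_restrict`). From a drawing of `G`, replacing each
vertex by a small grid of mesh size `δ`, rotated suitably, and each edge by three parallel copies at
distance `δ` gives a drawing of `G'`, as distinct vertices and edges of `G` are separated by a gap
(`PreThickening.draws_blowUp`); a path or a far point inside a region of the drawing of `G` survives
if `δ` is small (`PreThickening.region_blowUp`).

Programs. The first program computes the directions by at most three steps around each vertex,
stores the darts of `G'` in a table indexed by tail and direction, and looks up the successor and
the angle of each dart in this table. The second one copies the positions of the centres and the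
directions of the middle copies. Their loops are not nested and make at most `36 * n` iterations, as
the vertex condition bounds the number of edges by `2 * n`, so that a constant that depends on the
text of the program only bounds the running time (`RamProg.timeConst`, `RamProg.LoopFree.forLoop`).
-/

/-! ### Directions around a vertex -/

namespace EmbeddedGraph

variable {n m : ℕ} (G : EmbeddedGraph n m)

theorem tail_next (d : Fin (2 * m)) : G.tail (G.next d) = G.tail d :=
  (G.tail_eq_iff _ _).2 (Equiv.Perm.SameCycle.refl _ _).apply_left

theorem tail_rev (d : Fin (2 * m)) : G.tail (G.rev d) = G.head d := rfl

theorem head_rev (d : Fin (2 * m)) : G.head (G.rev d) = G.tail d := by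
  rw [head, G.rev_rev]

theorem rev_injective : Function.Injective G.rev := G.revPerm.injective

theorem face_eq_iff (d e : Fin (2 * m)) : G.face d = G.face e ↔ G.facePerm.SameCycle d e :=
  Quotient.eq (r := Equiv.Perm.SameCycle.setoid G.facePerm)

theorem facePerm_eq_iff (d f : Fin (2 * m)) : G.facePerm d = f ↔ G.next f = G.rev d := by
  change G.next.symm (G.rev d) = f ↔ _
  rw [Equiv.symm_apply_eq, eq_comm]

theorem next_facePerm (d : Fin (2 * m)) : G.next (G.facePerm d) = G.rev d :=
  (G.facePerm_eq_iff d _).1 rfl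

theorem face_facePerm (d : Fin (2 * m)) : G.face (G.facePerm d) = G.face d :=
  (G.face_eq_iff _ _).2 (Equiv.Perm.SameCycle.refl _ _).apply_left

theorem tail_facePerm (d : Fin (2 * m)) : G.tail (G.facePerm d) = G.head d := by
  rw [← G.tail_next, next_facePerm, tail_rev]

/-- A property of darts that is invariant under the face traversal holds on whole faces. -/
theorem face_induction {p : Fin (2 * m) → Prop} (h : ∀ d, p d ↔ p (G.facePerm d))
    {d e : Fin (2 * m)} (hde : G.face d = G.face e) : p d ↔ p e := by
  obtain ⟨i, rfl⟩ := (G.face_eq_iff d e).1 hde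
  induction i using Int.induction_on with
  | zero => simp
  | succ i ih =>
    rw [ih ((G.face_eq_iff _ _).2 ⟨i, rfl⟩), h, add_comm, zpow_add, zpow_one, Equiv.Perm.mul_apply]
  | pred i ih =>
    rw [ih ((G.face_eq_iff _ _).2 ⟨_, rfl⟩), h ((G.facePerm ^ (-(i : ℤ) - 1)) d),
      ← Equiv.Perm.mul_apply, ← zpow_one_add, add_sub_cancel]

end EmbeddedGraph

namespace OrthoRep

variable {n m : ℕ} {G : EmbeddedGraph n m} {R : OrthoRep G}

theorem turn_pos (R : OrthoRep G) (d : Fin (2 * m)) : 0 < R.turn d := by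
  by_cases h : G.next d = d
  · rw [R.turn_of_eq d h]; norm_num
  · exact (Finset.mem_Icc.1 (R.turn_of_ne d h)).1

theorem VertexCondition.exists_dart (hV : R.VertexCondition) (v : Fin n) : ∃ d, G.tail d = v := by
  by_contra! h
  have := hV v
  rw [Finset.sum_eq_zero (fun d hd => absurd (Finset.mem_filter.1 hd).2 (h d))] at this
  omega

/-- Every angle is at least `90°`, so the degrees are at most four. -/
theorem VertexCondition.edges_le (hV : R.VertexCondition) : m ≤ 2 * n := by
  classical
  have h1 : ∑ d, R.turn d = 4 * n := by
    rw [← Finset.sum_fiberwise Finset.univ G.tail]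
    rw [Finset.sum_congr rfl (fun v _ => (by convert hV v : _ = 4))]
    simp [mul_comm]
  have h2 : ∑ d : Fin (2 * m), 1 ≤ ∑ d, R.turn d := Finset.sum_le_sum fun d _ => R.turn_pos d
  simp at h2
  omega

/-- Directions accumulate the angles along the circular order. -/
theorem Matches.dir_pow {dir : Fin (2 * m) → ZMod 4} (hM : R.Matches dir) (d : Fin (2 * m))
    (k : ℕ) : dir ((G.next ^ k) d) =
      dir d + ((∑ i ∈ Finset.range k, R.turn ((G.next ^ i) d) : ℕ) : ZMod 4) := by
  induction k with
  | zero => simp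
  | succ k ih =>
    rw [pow_succ', Equiv.Perm.mul_apply, (hM _).1, ih, Finset.sum_range_succ]
    push_cast
    ring

/-- Rotating counter-clockwise from a dart, every other dart at the same vertex is met before a
full turn is completed. -/
theorem VertexCondition.exists_pow (hV : R.VertexCondition) {d e : Fin (2 * m)}
    (h : G.tail e = G.tail d) :
    ∃ k : ℕ, k ≤ 3 ∧ (G.next ^ k) d = e ∧
      (∑ i ∈ Finset.range k, R.turn ((G.next ^ i) d)) + R.turn e ≤ 4 ∧
      ∀ i < k, (G.next ^ i) d ≠ e := by
  classical
  have hex : ∃ k : ℕ, (G.next ^ k) d = e := by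
    obtain ⟨k, -, hk⟩ := ((G.tail_eq_iff d e).1 h.symm).exists_pow_eq'
    exact ⟨k, hk⟩
  have hk := Nat.find_spec hex
  -- The least number of steps from `d` to `e`, so that no dart is met twice on the way.
  set k := Nat.find hex with hkdef
  have hmin : ∀ i < k, (G.next ^ i) d ≠ e := fun i hi => Nat.find_min hex hi
  have hinj : Set.InjOn (fun i => (G.next ^ i) d) (Finset.range k) := by
    have key : ∀ i j, i < j → j < k → (G.next ^ i) d ≠ (G.next ^ j) d := by
      intro i j hij hj heq
      apply hmin (k - j + i) (by omega)
      rw [pow_add, Equiv.Perm.mul_apply, heq, ← Equiv.Perm.mul_apply, ← pow_add,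
        Nat.sub_add_cancel hj.le, hk]
    intro i hi j hj heq
    simp only [Finset.coe_range, Set.mem_Iio] at hi hj
    rcases lt_trichotomy i j with h | h | h
    · exact absurd heq (key i j h hj)
    · exact h
    · exact absurd heq.symm (key j i h hi)
  have htail : ∀ i, G.tail ((G.next ^ i) d) = G.tail d := by
    intro i
    exact (G.tail_eq_iff _ _).2 (Equiv.Perm.SameCycle.refl _ _).pow_left
  have hsum : (∑ i ∈ Finset.range k, R.turn ((G.next ^ i) d)) + R.turn e ≤ 4 := by
    have h4 := hV (G.tail d)
    rw [← Finset.sum_image (g := fun i => (G.next ^ i) d) (f := R.turn) hinj, add_comm,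
      ← Finset.sum_insert, ← h4]
    · apply Finset.sum_le_sum_of_subset
      intro x hx
      rw [Finset.mem_insert, Finset.mem_image] at hx
      rw [Finset.mem_filter]
      refine ⟨Finset.mem_univ _, ?_⟩
      rcases hx with rfl | ⟨i, -, rfl⟩
      · exact h
      · exact htail i
    · rw [Finset.mem_image]
      rintro ⟨i, hi, hie⟩
      exact hmin i (Finset.mem_range.1 hi) hie
  have hle : k ≤ ∑ i ∈ Finset.range k, R.turn ((G.next ^ i) d) := by
    calc k = ∑ i ∈ Finset.range k, 1 := by simp
      _ ≤ _ := Finset.sum_le_sum fun i _ => R.turn_pos _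
  have := R.turn_pos e
  exact ⟨k, by omega, hk, hsum, hmin⟩

/-- If the angles at a vertex sum up to a single full turn, then distinct darts at it have distinct
directions. -/
theorem VertexCondition.dir_injective (hV : R.VertexCondition) {dir : Fin (2 * m) → ZMod 4}
    (hM : R.Matches dir) {d e : Fin (2 * m)} (h : G.tail d = G.tail e) (hd : dir d = dir e) :
    d = e := by
  obtain ⟨k, hk3, hk, hs, -⟩ := hV.exists_pow h.symm
  have hpos := R.turn_pos e
  have h1 := hM.dir_pow d k
  rw [hk, ← hd, left_eq_add, ZMod.natCast_eq_zero_iff] at h1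
  have h2 : ∑ i ∈ Finset.range k, R.turn ((G.next ^ i) d) = 0 := by omega
  have hle : k ≤ ∑ i ∈ Finset.range k, R.turn ((G.next ^ i) d) := by
    calc k = ∑ i ∈ Finset.range k, 1 := by simp
      _ ≤ _ := Finset.sum_le_sum fun i _ => R.turn_pos _
  have : k = 0 := by omega
  rw [this] at hk
  simpa using hk

/-- Two direction assignments that match the same representation differ by a rotation at each
vertex. -/
theorem Matches.sub_eq {dir₁ dir₂ : Fin (2 * m) → ZMod 4} (h₁ : R.Matches dir₁)
    (h₂ : R.Matches dir₂) {d e : Fin (2 * m)} (h : G.tail d = G.tail e) :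
    dir₁ d - dir₂ d = dir₁ e - dir₂ e := by
  obtain ⟨k, -, hk⟩ := ((G.tail_eq_iff d e).1 h).exists_pow_eq'
  rw [← hk, h₁.dir_pow, h₂.dir_pow]
  ring

theorem Matches.add_rotation {dir : Fin (2 * m) → ZMod 4} (h : R.Matches dir)
    (c : Fin n → ZMod 4) : R.Matches fun d => dir d + c (G.tail d) := by
  intro d
  refine ⟨?_, fun j hj hjt e he => ?_⟩
  · beta_reduce
    rw [(h d).1, G.tail_next]; ring
  · beta_reduce
    rw [he]
    intro heq
    exact (h d).2 j hj hjt e he (by linear_combination heq)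

/-- A dart owns the directions from its own up to, but not including, that of its successor. Every
direction at a vertex has an owner, which by `Matches.owner_unique` is unique. -/
theorem Matches.exists_owner {dir : Fin (2 * m) → ZMod 4} (h : R.Matches dir)
    {v : Fin n} (hv : ∃ d, G.tail d = v) (σ : ZMod 4) :
    ∃ d, G.tail d = v ∧ ∃ j, j < R.turn d ∧ dir d + (j : ZMod 4) = σ := by
  classical
  let S : Finset (Fin (2 * m)) := Finset.univ.filter fun d => G.tail d = v
  have hS : S.Nonempty := by
    obtain ⟨d, hd⟩ := hv
    exact ⟨d, by simp [S, hd]⟩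
  -- The owner of `σ` is the last dart before `σ` in counter-clockwise order.
  obtain ⟨d, hd, hmin⟩ := S.exists_min_image (fun d => (σ - dir d).val) hS
  have hd' : G.tail d = v := by simpa [S] using hd
  refine ⟨d, hd', (σ - dir d).val, ?_, ?_⟩
  · by_contra! hlt
    have h1 := hmin (G.next d) (by simp [S, G.tail_next, hd'])
    have h2 : (σ - dir (G.next d)) = ((((σ - dir d).val - R.turn d : ℕ)) : ZMod 4) := by
      rw [(h d).1, Nat.cast_sub hlt, ZMod.natCast_zmod_val]; ring
    have h3 := ZMod.val_lt (σ - dir d)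
    have h4 := R.turn_pos d
    rw [h2, ZMod.val_natCast, Nat.mod_eq_of_lt (by omega)] at h1
    omega
  · rw [ZMod.natCast_zmod_val]; ring

theorem Matches.owner_unique {dir : Fin (2 * m) → ZMod 4} (h : R.Matches dir)
    (hinj : ∀ d e, G.tail d = G.tail e → dir d = dir e → d = e)
    {d e : Fin (2 * m)} (hde : G.tail d = G.tail e) {i j : ℕ} (hi : i < R.turn d)
    (hj : j < R.turn e) (heq : dir d + (i : ZMod 4) = dir e + (j : ZMod 4)) : d = e ∧ i = j := by
  wlog hij : i ≤ j generalizing d e i j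
  · obtain ⟨h1, h2⟩ := this hde.symm hj hi heq.symm (by omega)
    exact ⟨h1.symm, h2.symm⟩
  have h1 : dir d = dir e + ((j - i : ℕ) : ZMod 4) := by
    rw [Nat.cast_sub hij]; linear_combination heq
  rcases Nat.eq_or_lt_of_le hij with h0 | h0
  · subst h0
    exact ⟨hinj d e hde (by simpa using h1), rfl⟩
  · exact absurd h1 ((h e).2 (j - i) (by omega) (by omega) d hde)

/-- If distinct darts at a vertex have distinct directions, then the angles at it sum up to a full
turn. -/
theorem Matches.vertexCondition {dir : Fin (2 * m) → ZMod 4} (h : R.Matches dir)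
    (hinj : ∀ d e, G.tail d = G.tail e → dir d = dir e → d = e)
    (hne : ∀ v, ∃ d, G.tail d = v) : R.VertexCondition := by
  classical
  intro v
  have h1 : ∑ d with G.tail d = v, R.turn d =
      ((Finset.univ.filter fun d => G.tail d = v).sigma fun d => Finset.range (R.turn d)).card := by
    rw [Finset.card_sigma]
    simp
  rw [h1, show 4 = (Finset.univ : Finset (ZMod 4)).card from rfl]
  -- The pairs of a dart and a number below its angle correspond to the four directions.
  apply Finset.card_bij (fun x _ => dir x.1 + (x.2 : ZMod 4))
  · simp
  · rintro ⟨d, i⟩ hd ⟨e, j⟩ he heq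
    simp only [Finset.mem_sigma, Finset.mem_filter, Finset.mem_univ, true_and,
      Finset.mem_range] at hd he
    obtain ⟨rfl, rfl⟩ := h.owner_unique hinj (hd.1.trans he.1.symm) hd.2 he.2 heq
    rfl
  · intro σ _
    obtain ⟨d, hd, j, hj, hσ⟩ := h.exists_owner (hne v) σ
    exact ⟨⟨d, j⟩, by simp [hd, hj], hσ⟩

/-- The successor of a dart is the first dart in the counter-clockwise direction. -/
theorem Matches.next_eq {dir : Fin (2 * m) → ZMod 4} (h : R.Matches dir)
    (hinj : ∀ d e, G.tail d = G.tail e → dir d = dir e → d = e)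
    {e f : Fin (2 * m)} {j : ℕ} (hj0 : 0 < j) (hj : j < 4) (ht : G.tail f = G.tail e)
    (hd : dir f = dir e + (j : ZMod 4))
    (hb : ∀ i, 0 < i → i < j → ∀ g, G.tail g = G.tail e → dir g ≠ dir e + (i : ZMod 4)) :
    G.next e = f ∧ R.turn e = j := by
  have hfe : f ≠ e := by
    rintro rfl
    rw [left_eq_add, ZMod.natCast_eq_zero_iff] at hd
    omega
  have hne : G.next e ≠ e := by
    intro hn
    obtain ⟨k, -, hk⟩ := ((G.tail_eq_iff e f).1 ht.symm).exists_pow_eq'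
    apply hfe
    rw [← hk, Equiv.Perm.pow_apply_eq_self_of_apply_eq_self hn]
  have ht' := Finset.mem_Icc.1 (R.turn_of_ne e hne)
  have hj' : R.turn e = j := by
    rcases lt_trichotomy (R.turn e) j with h0 | h0 | h0
    · exact absurd (h e).1 (hb _ ht'.1 h0 _ (G.tail_next e))
    · exact h0
    · exact absurd hd ((h e).2 j hj0 h0 f ht)
  refine ⟨hinj _ _ ((G.tail_next e).trans ht.symm) ?_, hj'⟩
  rw [(h e).1, hd, hj']

end OrthoRep

/-! ### The darts of the grid -/

namespace GridDart

/-- From the centre to the middle of side `σ`. -/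
def out (σ : ZMod 4) : GridDart := ⟨((0, 0), gridSide σ 0), by revert σ; decide⟩
/-- From the middle of side `σ` to the centre. -/
def inn (σ : ZMod 4) : GridDart := ⟨(gridSide σ 0, (0, 0)), by revert σ; decide⟩
/-- The first half of side `σ` in clockwise direction. -/
def cwA (σ : ZMod 4) : GridDart := ⟨(gridSide σ 1, gridSide σ 0), by revert σ; decide⟩
/-- The second half of side `σ` in clockwise direction. -/
def cwB (σ : ZMod 4) : GridDart := ⟨(gridSide σ 0, gridSide σ (-1)), by revert σ; decide⟩
/-- The reversal of `cwA σ`. -/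
def ccwA (σ : ZMod 4) : GridDart := ⟨(gridSide σ 0, gridSide σ 1), by revert σ; decide⟩
/-- The reversal of `cwB σ`. -/
def ccwB (σ : ZMod 4) : GridDart := ⟨(gridSide σ (-1), gridSide σ 0), by revert σ; decide⟩

/-- The six orbits of grid darts under rotation. -/
inductive Kind
  | out | inn | cwA | cwB | ccwA | ccwB
  deriving DecidableEq

instance : Fintype Kind :=
  ⟨{.out, .inn, .ccwA, .ccwB, .cwA, .cwB}, by intro x; cases x <;> decide⟩

/-- The grid dart of a given kind at side `σ`. -/
def ofKind : ZMod 4 × Kind → GridDart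
  | (σ, .out) => out σ
  | (σ, .inn) => inn σ
  | (σ, .cwA) => cwA σ
  | (σ, .cwB) => cwB σ
  | (σ, .ccwA) => ccwA σ
  | (σ, .ccwB) => ccwB σ

theorem cases (x : GridDart) : ∃ σ, x = out σ ∨ x = inn σ ∨ x = cwA σ ∨ x = cwB σ ∨ x = ccwA σ ∨
    x = ccwB σ := by
  revert x; decide

theorem ofKind_bijective : Function.Bijective ofKind := by
  constructor
  · rintro ⟨σ, a⟩ ⟨τ, b⟩
    cases a <;> cases b <;> simp only [ofKind, Prod.mk.injEq, and_true, and_false, reduceCtorEq] <;>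
      revert σ τ <;> decide
  · intro x
    obtain ⟨σ, h | h | h | h | h | h⟩ := x.cases
    · exact ⟨(σ, .out), h.symm⟩
    · exact ⟨(σ, .inn), h.symm⟩
    · exact ⟨(σ, .cwA), h.symm⟩
    · exact ⟨(σ, .cwB), h.symm⟩
    · exact ⟨(σ, .ccwA), h.symm⟩
    · exact ⟨(σ, .ccwB), h.symm⟩

/-- Grid darts, sorted by side and kind. -/
noncomputable def kindEquiv : ZMod 4 × Kind ≃ GridDart := Equiv.ofBijective ofKind ofKind_bijective

theorem swap_out (σ) : (out σ).swap = inn σ := rfl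
theorem swap_inn (σ) : (inn σ).swap = out σ := rfl
theorem swap_cwA (σ) : (cwA σ).swap = ccwA σ := rfl
theorem swap_cwB (σ) : (cwB σ).swap = ccwB σ := rfl
theorem swap_ccwA (σ) : (ccwA σ).swap = cwA σ := rfl
theorem swap_ccwB (σ) : (ccwB σ).swap = cwB σ := rfl

theorem dir_out (σ) : (out σ).dir = σ := by revert σ; decide
theorem dir_inn (σ) : (inn σ).dir = σ + 2 := by revert σ; decide
theorem dir_cwA (σ) : (cwA σ).dir = σ + 3 := by revert σ; decide
theorem dir_cwB (σ) : (cwB σ).dir = σ + 3 := by revert σ; decide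
theorem dir_ccwA (σ) : (ccwA σ).dir = σ + 1 := by revert σ; decide
theorem dir_ccwB (σ) : (ccwB σ).dir = σ + 1 := by revert σ; decide

theorem dir_swap (x : GridDart) : x.swap.dir = x.dir + 2 := by revert x; decide

theorem eq_of_dir_eq : ∀ x y : GridDart, x.1.1 = y.1.1 → x.dir = y.dir → x = y := by decide

/-- No grid dart leaves the grid through a side. -/
theorem dir_ne_of_gridSide : ∀ (x : GridDart) (σ : ZMod 4) (s : SignType),
    x.1.1 = gridSide σ s → x.dir ≠ σ := by decide

end GridDart

theorem gridSide_injective (σ : ZMod 4) : Function.Injective (gridSide σ) := by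
  revert σ; unfold Function.Injective; decide

theorem gridSide_one (σ : ZMod 4) : gridSide σ 1 = gridSide (σ + 1) (-1) := by
  revert σ; decide

theorem gridSide_zero_eq_iff (σ τ : ZMod 4) (s : SignType) :
    gridSide σ s = gridSide τ 0 ↔ σ = τ ∧ s = 0 := by
  revert σ τ s; decide

theorem gridSide_ne_zero (σ : ZMod 4) (s : SignType) : gridSide σ s ≠ (0, 0) := by
  revert σ s; decide

/-! ### The circular orders of a thickening -/

/-- The data of a thickening without the correspondence of the central and outer faces; they suffice
to determine all faces of `G'`. -/
structure PreThickening {n m n' m' : ℕ} {G : EmbeddedGraph n m} {G' : EmbeddedGraph n' m'}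
    (R : OrthoRep G) (R' : OrthoRep G') where
  side : Fin (2 * m) → ZMod 4
  side_matches : R.Matches side
  vtx : Fin n × GridPos ≃ Fin n'
  dart : (Fin n × GridDart) ⊕ (Fin (2 * m) × SignType) ≃ Fin (2 * m')
  tail_grid : ∀ v x, G'.tail (dart (.inl (v, x))) = vtx (v, x.1.1)
  rev_grid : ∀ v x, G'.rev (dart (.inl (v, x))) = dart (.inl (v, x.swap))
  tail_copy : ∀ d s, G'.tail (dart (.inr (d, s))) = vtx (G.tail d, gridSide (side d) s)
  rev_copy : ∀ d s, G'.rev (dart (.inr (d, s))) = dart (.inr (G.rev d, -s))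
  matches' : R'.Matches fun e =>
    Sum.elim (fun x : Fin n × GridDart => x.2.dir)
      (fun y : Fin (2 * m) × SignType => side y.1) (dart.symm e)

/-- Forgetting about the central and outer faces. -/
def Thickening.pre {n m n' m' : ℕ} {G : EmbeddedGraph n m} {G' : EmbeddedGraph n' m'}
    {R : OrthoRep G} {R' : OrthoRep G'} (T : Thickening R R') : PreThickening R R' :=
  ⟨T.side, T.side_matches, T.vtx, T.dart, T.tail_grid, T.rev_grid, T.tail_copy, T.rev_copy,
    T.matches'⟩

namespace PreThickening

open GridDart

variable {n m n' m' : ℕ} {G : EmbeddedGraph n m} {G' : EmbeddedGraph n' m'}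
  {R : OrthoRep G} {R' : OrthoRep G'} (T : PreThickening R R')

/-- A dart of the grid of `v`. -/
def g (v : Fin n) (x : GridDart) : Fin (2 * m') := T.dart (.inl (v, x))

/-- A copy of the dart `d`. -/
def c (d : Fin (2 * m)) (s : SignType) : Fin (2 * m') := T.dart (.inr (d, s))

/-- The directions of the darts in a drawing of each grid in standard position. -/
def bdir (e : Fin (2 * m')) : ZMod 4 :=
  Sum.elim (fun x : Fin n × GridDart => x.2.dir)
    (fun y : Fin (2 * m) × SignType => T.side y.1) (T.dart.symm e)

theorem bdir_g (v x) : T.bdir (T.g v x) = x.dir := by simp [bdir, g]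
theorem bdir_c (d s) : T.bdir (T.c d s) = T.side d := by simp [bdir, c]
theorem tail_g (v x) : G'.tail (T.g v x) = T.vtx (v, x.1.1) := T.tail_grid v x
theorem tail_c (d s) : G'.tail (T.c d s) = T.vtx (G.tail d, gridSide (T.side d) s) :=
  T.tail_copy d s
theorem rev_g (v x) : G'.rev (T.g v x) = T.g v x.swap := T.rev_grid v x
theorem rev_c (d s) : G'.rev (T.c d s) = T.c (G.rev d) (-s) := T.rev_copy d s

theorem dart_cases (e : Fin (2 * m')) : (∃ v x, e = T.g v x) ∨ ∃ d s, e = T.c d s := by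
  obtain ⟨y, rfl⟩ := T.dart.surjective e
  rcases y with ⟨v, x⟩ | ⟨d, s⟩
  · exact .inl ⟨v, x, rfl⟩
  · exact .inr ⟨d, s, rfl⟩

theorem g_inj {v w x y} : T.g v x = T.g w y ↔ v = w ∧ x = y := by simp [g]
theorem c_inj {d e s t} : T.c d s = T.c e t ↔ d = e ∧ s = t := by simp [c]
theorem g_ne_c (v x d s) : T.g v x ≠ T.c d s := by simp [g, c]

theorem matches_bdir : R'.Matches T.bdir := T.matches'

variable (hV : R.VertexCondition)
include hV

theorem side_inj {d e : Fin (2 * m)} (h : G.tail d = G.tail e) (hs : T.side d = T.side e) : d = e :=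
  hV.dir_injective T.side_matches h hs

theorem bdir_injective (d e : Fin (2 * m')) (h : G'.tail d = G'.tail e)
    (hd : T.bdir d = T.bdir e) : d = e := by
  rcases T.dart_cases d with ⟨v, x, rfl⟩ | ⟨d, s, rfl⟩ <;>
  rcases T.dart_cases e with ⟨w, y, rfl⟩ | ⟨e, t, rfl⟩ <;>
  simp only [tail_g, tail_c, bdir_g, bdir_c, T.vtx.injective.eq_iff, Prod.mk.injEq] at h hd
  · rw [g_inj]
    exact ⟨h.1, GridDart.eq_of_dir_eq x y h.2 hd⟩
  · exact absurd hd (GridDart.dir_ne_of_gridSide x _ _ h.2)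
  · exact absurd hd.symm (GridDart.dir_ne_of_gridSide y _ _ h.2.symm)
  · obtain rfl := T.side_inj hV h.1 hd
    rw [c_inj]
    exact ⟨rfl, gridSide_injective _ h.2⟩

omit hV in
/-- A side of a grid with which no dart is associated. -/
def Free (v : Fin n) (σ : ZMod 4) : Prop := ∀ d, G.tail d = v → T.side d ≠ σ

omit hV in
theorem bdir_ne_of_free {v : Fin n} {p : GridPos} {σ : ZMod 4} (hp : ∃ s, p = gridSide σ s)
    (hf : T.Free v σ) (e : Fin (2 * m')) (he : G'.tail e = T.vtx (v, p)) : T.bdir e ≠ σ := by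
  obtain ⟨s, rfl⟩ := hp
  rcases T.dart_cases e with ⟨w, y, rfl⟩ | ⟨d, t, rfl⟩ <;>
  simp only [tail_g, tail_c, bdir_g, bdir_c, T.vtx.injective.eq_iff, Prod.mk.injEq] at he ⊢
  · exact GridDart.dir_ne_of_gridSide y _ _ he.2
  · exact hf d he.1

/-- The successor of a dart of `G'`, if the next direction is occupied. Together with `next_of_two`
and `next_of_three`, for free sides of the grid, this determines all circular orders and angles of
`G'`. -/
theorem next_of_one {e f : Fin (2 * m')} (ht : G'.tail f = G'.tail e)
    (hd : T.bdir f = T.bdir e + 1) : G'.next e = f ∧ R'.turn e = 1 :=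
  T.matches_bdir.next_eq (T.bdir_injective hV) (by norm_num) (by norm_num) ht (by simpa using hd)
    (fun i h0 h1 => by omega)

theorem next_of_two {e f : Fin (2 * m')} {v : Fin n} {p : GridPos}
    (he : G'.tail e = T.vtx (v, p)) (ht : G'.tail f = T.vtx (v, p))
    (hd : T.bdir f = T.bdir e + 2)
    (h1 : (∃ s, p = gridSide (T.bdir e + 1) s) ∧ T.Free v (T.bdir e + 1)) :
    G'.next e = f ∧ R'.turn e = 2 := by
  refine T.matches_bdir.next_eq (T.bdir_injective hV) (by norm_num) (by norm_num) (ht.trans he.symm)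
    (by simpa using hd) (fun i h0 hi g' hg => ?_)
  obtain rfl : i = 1 := by omega
  simpa using T.bdir_ne_of_free h1.1 h1.2 g' (hg.trans he)

theorem next_of_three {e f : Fin (2 * m')} {v : Fin n} {p : GridPos}
    (he : G'.tail e = T.vtx (v, p)) (ht : G'.tail f = T.vtx (v, p))
    (hd : T.bdir f = T.bdir e + 3)
    (h1 : (∃ s, p = gridSide (T.bdir e + 1) s) ∧ T.Free v (T.bdir e + 1))
    (h2 : (∃ s, p = gridSide (T.bdir e + 2) s) ∧ T.Free v (T.bdir e + 2)) :
    G'.next e = f ∧ R'.turn e = 3 := by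
  refine T.matches_bdir.next_eq (T.bdir_injective hV) (by norm_num) (by norm_num) (ht.trans he.symm)
    (by simpa using hd) (fun i h0 hi g' hg => ?_)
  obtain rfl | rfl : i = 1 ∨ i = 2 := by omega
  · simpa using T.bdir_ne_of_free h1.1 h1.2 g' (hg.trans he)
  · simpa using T.bdir_ne_of_free h2.1 h2.2 g' (hg.trans he)

theorem next_out (v σ) : G'.next (T.g v (out σ)) = T.g v (out (σ + 1)) ∧
    R'.turn (T.g v (out σ)) = 1 :=
  T.next_of_one hV (by rw [tail_g, tail_g]; rfl) (by simp only [bdir_g, dir_out])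

theorem next_inn (v σ) : G'.next (T.g v (inn σ)) = T.g v (cwB σ) ∧
    R'.turn (T.g v (inn σ)) = 1 :=
  T.next_of_one hV (by rw [tail_g, tail_g]; rfl) (by simp only [bdir_g, dir_inn, dir_cwB]; ring)

theorem next_ccwA (v σ) : G'.next (T.g v (ccwA σ)) = T.g v (inn σ) ∧
    R'.turn (T.g v (ccwA σ)) = 1 :=
  T.next_of_one hV (by rw [tail_g, tail_g]; rfl) (by simp only [bdir_g, dir_inn, dir_ccwA]; ring)

theorem next_ccwB (v σ) : G'.next (T.g v (ccwB (σ + 1))) = T.g v (cwA σ) ∧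
    R'.turn (T.g v (ccwB (σ + 1))) = 1 :=
  T.next_of_one hV (by rw [tail_g, tail_g]; simp only [cwA, ccwB, gridSide_one])
    (by simp only [bdir_g, dir_cwA, dir_ccwB]; ring)

theorem next_c_zero (d) : G'.next (T.c d 0) = T.g (G.tail d) (ccwA (T.side d)) ∧
    R'.turn (T.c d 0) = 1 :=
  T.next_of_one hV (by rw [tail_g, tail_c]; rfl) (by simp only [bdir_g, bdir_c, dir_ccwA])

theorem next_c_neg (d) : G'.next (T.c d (-1)) = T.g (G.tail d) (ccwB (T.side d)) ∧
    R'.turn (T.c d (-1)) = 1 :=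
  T.next_of_one hV (by rw [tail_g, tail_c]; rfl) (by simp only [bdir_g, bdir_c, dir_ccwB])

omit hV in
theorem four_eq_zero : (4 : ZMod 4) = 0 := by decide

theorem next_cwB (d) : G'.next (T.g (G.tail d) (cwB (T.side d))) = T.c d 0 ∧
    R'.turn (T.g (G.tail d) (cwB (T.side d))) = 1 :=
  T.next_of_one hV (by rw [tail_g, tail_c]; rfl)
    (by simp only [bdir_g, bdir_c, dir_cwB]; linear_combination -four_eq_zero)

theorem next_cwA (d) : G'.next (T.g (G.tail d) (cwA (T.side d))) = T.c d 1 ∧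
    R'.turn (T.g (G.tail d) (cwA (T.side d))) = 1 :=
  T.next_of_one hV (by rw [tail_g, tail_c]; rfl)
    (by simp only [bdir_g, bdir_c, dir_cwA]; linear_combination -four_eq_zero)

theorem next_c_one {d e} (ht : G.tail e = G.tail d) (hs : T.side e = T.side d + 1) :
    G'.next (T.c d 1) = T.c e (-1) ∧ R'.turn (T.c d 1) = 1 :=
  T.next_of_one hV (by rw [tail_c, tail_c, ht, hs, gridSide_one]) (by simp only [bdir_c, hs])

theorem next_c_one_of_free {d} (hf : T.Free (G.tail d) (T.side d + 1)) :
    G'.next (T.c d 1) = T.g (G.tail d) (ccwB (T.side d + 1)) ∧ R'.turn (T.c d 1) = 2 := by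
  refine T.next_of_two hV (T.tail_c d 1) (by rw [tail_g, gridSide_one]; rfl)
    (by simp only [bdir_c, bdir_g, dir_ccwB]; ring) ⟨⟨-1, ?_⟩, ?_⟩
  · rw [bdir_c, gridSide_one]
  · rwa [bdir_c]

theorem next_cwB_of_free {v σ} (hf : T.Free v σ) :
    G'.next (T.g v (cwB σ)) = T.g v (ccwA σ) ∧ R'.turn (T.g v (cwB σ)) = 2 := by
  have h : σ + 3 + 1 = σ := by linear_combination four_eq_zero
  refine T.next_of_two hV (T.tail_g _ _) (T.tail_g _ _)
    (by simp only [bdir_g, dir_cwB, dir_ccwA]; linear_combination -four_eq_zero) ⟨⟨0, ?_⟩, ?_⟩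
  · rw [bdir_g, dir_cwB, h]; rfl
  · rwa [bdir_g, dir_cwB, h]

theorem next_cwA_of_free {v σ e} (hf : T.Free v σ) (ht : G.tail e = v) (hs : T.side e = σ + 1) :
    G'.next (T.g v (cwA σ)) = T.c e (-1) ∧ R'.turn (T.g v (cwA σ)) = 2 := by
  have h : σ + 3 + 1 = σ := by linear_combination four_eq_zero
  refine T.next_of_two hV (T.tail_g _ _) (by rw [tail_c, ht, hs, ← gridSide_one]; rfl)
    (by simp only [bdir_g, bdir_c, dir_cwA, hs]; linear_combination -four_eq_zero) ⟨⟨1, ?_⟩, ?_⟩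
  · rw [bdir_g, dir_cwA, h]; rfl
  · rwa [bdir_g, dir_cwA, h]

theorem next_cwA_of_free_of_free {v σ} (hf : T.Free v σ) (hf' : T.Free v (σ + 1)) :
    G'.next (T.g v (cwA σ)) = T.g v (ccwB (σ + 1)) ∧ R'.turn (T.g v (cwA σ)) = 3 := by
  have h : σ + 3 + 1 = σ := by linear_combination four_eq_zero
  have h' : σ + 3 + 2 = σ + 1 := by linear_combination four_eq_zero
  refine T.next_of_three hV (T.tail_g _ _) (by rw [tail_g]; simp only [cwA, ccwB, gridSide_one])
    (by simp only [bdir_g, dir_cwA, dir_ccwB]; linear_combination -four_eq_zero)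
    ⟨⟨1, ?_⟩, ?_⟩ ⟨⟨-1, ?_⟩, ?_⟩
  · rw [bdir_g, dir_cwA, h]; rfl
  · rwa [bdir_g, dir_cwA, h]
  · rw [bdir_g, dir_cwA, h', ← gridSide_one]; rfl
  · rwa [bdir_g, dir_cwA, h']

end PreThickening

/-! ### The faces of a thickening -/

namespace PreThickening

open GridDart

variable {n m n' m' : ℕ} {G : EmbeddedGraph n m} {G' : EmbeddedGraph n' m'}
  {R : OrthoRep G} {R' : OrthoRep G'} (T : PreThickening R R') (hV : R.VertexCondition)

include hV in
theorem exists_owner (v : Fin n) (σ : ZMod 4) :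
    ∃ d, G.tail d = v ∧ ∃ j, j < R.turn d ∧ T.side d + (j : ZMod 4) = σ :=
  T.side_matches.exists_owner (hV.exists_dart v) σ

/-- The dart whose corner contains side `σ` of the grid of `v`: the last dart that is not after
`σ` in the counter-clockwise order. -/
noncomputable def owner (v : Fin n) (σ : ZMod 4) : Fin (2 * m) := (T.exists_owner hV v σ).choose

theorem owner_eq {d : Fin (2 * m)} {j : ℕ} (hj : j < R.turn d) :
    T.owner hV (G.tail d) (T.side d + j) = d := by
  obtain ⟨h1, i, hi, h2⟩ := (T.exists_owner hV (G.tail d) (T.side d + j)).choose_spec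
  exact (T.side_matches.owner_unique (fun _ _ => hV.dir_injective T.side_matches) h1 hi hj h2).1

theorem owner_side (d : Fin (2 * m)) : T.owner hV (G.tail d) (T.side d) = d := by
  simpa using T.owner_eq hV (R.turn_pos d)

theorem free_of_lt {d : Fin (2 * m)} {j : ℕ} (h0 : 0 < j) (hj : j < R.turn d) :
    T.Free (G.tail d) (T.side d + j) := fun e he => (T.side_matches d).2 j h0 hj e he

/-- Every side is occupied by a dart or lies strictly inside the corner of a dart. -/
theorem slot_cases (hV : R.VertexCondition) (v : Fin n) (σ : ZMod 4) :
    ∃ d j, G.tail d = v ∧ j < R.turn d ∧ T.side d + (j : ZMod 4) = σ := by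
  obtain ⟨d, h1, j, h2, h3⟩ := T.exists_owner hV v σ
  exact ⟨d, j, h1, h2, h3⟩

/-- Sides of grids correspond to pairs of a dart `d` and a number `j < turn d`. -/
theorem sum_slots {M : Type*} [AddCommMonoid M] (hV : R.VertexCondition)
    (f : Fin n × ZMod 4 → M) :
    ∑ x, f x = ∑ d, ∑ j ∈ Finset.range (R.turn d), f (G.tail d, T.side d + j) := by
  rw [Finset.sum_sigma']
  symm
  apply Finset.sum_bij (fun x _ => (G.tail x.1, T.side x.1 + (x.2 : ZMod 4)))
  · simp
  · rintro ⟨d, i⟩ hd ⟨e, j⟩ he heq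
    simp only [Finset.mem_sigma, Finset.mem_univ, true_and, Finset.mem_range, Prod.mk.injEq]
      at hd he heq
    obtain ⟨rfl, rfl⟩ := T.side_matches.owner_unique
      (fun _ _ => hV.dir_injective T.side_matches) heq.1 hd he heq.2
    rfl
  · rintro ⟨v, σ⟩ -
    obtain ⟨d, j, h1, h2, h3⟩ := T.slot_cases hV v σ
    exact ⟨⟨d, j⟩, by simp [h2], by rw [← h1, ← h3]⟩
  · simp

/-- The face of `G'` on the left of a dart, described by `G`: it is a thickened face of `G`, one
of the four squares of a grid, or the rectangle between the left and the middle copy of a dart. -/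
noncomputable def cls (e : Fin (2 * m')) : G.Face ⊕ (Fin n × ZMod 4) ⊕ Fin (2 * m) :=
  match T.dart.symm e with
  | .inl (v, x) =>
    match kindEquiv.symm x with
    | (σ, .out) => .inr (.inl (v, σ))
    | (σ, .ccwA) => .inr (.inl (v, σ))
    | (σ, .ccwB) => .inr (.inl (v, σ - 1))
    | (σ, .inn) => .inr (.inl (v, σ - 1))
    | (σ, .cwA) => if T.side (T.owner hV v σ) = σ then .inr (.inr (T.owner hV v σ))
        else .inl (G.face (T.owner hV v σ))
    | (σ, .cwB) => if T.side (T.owner hV v σ) = σ then .inr (.inr (G.rev (T.owner hV v σ)))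
        else .inl (G.face (T.owner hV v σ))
  | .inr (d, s) => if s = 1 then .inl (G.face d) else if s = 0 then .inr (.inr d)
      else .inr (.inr (G.rev d))

theorem cls_kind (v : Fin n) (y : ZMod 4 × Kind) : T.cls hV (T.g v (ofKind y)) =
    match y with
    | (σ, .out) => .inr (.inl (v, σ))
    | (σ, .ccwA) => .inr (.inl (v, σ))
    | (σ, .ccwB) => .inr (.inl (v, σ - 1))
    | (σ, .inn) => .inr (.inl (v, σ - 1))
    | (σ, .cwA) => if T.side (T.owner hV v σ) = σ then .inr (.inr (T.owner hV v σ))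
        else .inl (G.face (T.owner hV v σ))
    | (σ, .cwB) => if T.side (T.owner hV v σ) = σ then .inr (.inr (G.rev (T.owner hV v σ)))
        else .inl (G.face (T.owner hV v σ)) := by
  have h : kindEquiv.symm (ofKind y) = y := kindEquiv.symm_apply_apply y
  simp only [cls, g, Equiv.symm_apply_apply, h]

theorem cls_out (v σ) : T.cls hV (T.g v (out σ)) = .inr (.inl (v, σ)) :=
  T.cls_kind hV v (σ, .out)
theorem cls_inn (v σ) : T.cls hV (T.g v (inn σ)) = .inr (.inl (v, σ - 1)) :=
  T.cls_kind hV v (σ, .inn)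
theorem cls_ccwA (v σ) : T.cls hV (T.g v (ccwA σ)) = .inr (.inl (v, σ)) :=
  T.cls_kind hV v (σ, .ccwA)
theorem cls_ccwB (v σ) : T.cls hV (T.g v (ccwB σ)) = .inr (.inl (v, σ - 1)) :=
  T.cls_kind hV v (σ, .ccwB)

theorem cls_cwA (d) : T.cls hV (T.g (G.tail d) (cwA (T.side d))) = .inr (.inr d) := by
  rw [show cwA (T.side d) = ofKind (T.side d, .cwA) from rfl, cls_kind]
  simp [owner_side]

theorem cls_cwB (d) : T.cls hV (T.g (G.tail d) (cwB (T.side d))) = .inr (.inr (G.rev d)) := by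
  rw [show cwB (T.side d) = ofKind (T.side d, .cwB) from rfl, cls_kind]
  simp [owner_side]

theorem side_ne_of_lt {d : Fin (2 * m)} {j : ℕ} (h0 : 0 < j) (hj : j < R.turn d) :
    T.side d ≠ T.side d + j := T.free_of_lt h0 hj d rfl

theorem cls_cwA_of_lt {d : Fin (2 * m)} {j : ℕ} (h0 : 0 < j) (hj : j < R.turn d) :
    T.cls hV (T.g (G.tail d) (cwA (T.side d + j))) = .inl (G.face d) := by
  rw [show cwA (T.side d + j) = ofKind (T.side d + j, .cwA) from rfl, cls_kind]
  simp only [owner_eq T hV hj]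
  rw [if_neg (T.side_ne_of_lt h0 hj)]

theorem cls_cwB_of_lt {d : Fin (2 * m)} {j : ℕ} (h0 : 0 < j) (hj : j < R.turn d) :
    T.cls hV (T.g (G.tail d) (cwB (T.side d + j))) = .inl (G.face d) := by
  rw [show cwB (T.side d + j) = ofKind (T.side d + j, .cwB) from rfl, cls_kind]
  simp only [owner_eq T hV hj]
  rw [if_neg (T.side_ne_of_lt h0 hj)]

theorem cls_c_one (d) : T.cls hV (T.c d 1) = .inl (G.face d) := by simp [cls, c]
theorem cls_c_zero (d) : T.cls hV (T.c d 0) = .inr (.inr d) := by simp [cls, c]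
theorem cls_c_neg (d) : T.cls hV (T.c d (-1)) = .inr (.inr (G.rev d)) := by
  simp only [cls, c, Equiv.symm_apply_apply]
  rw [if_neg (by decide), if_neg (by decide)]

section FacePerm
include hV

theorem facePerm_out (v σ) : G'.facePerm (T.g v (out σ)) = T.g v (ccwA σ) := by
  rw [G'.facePerm_eq_iff, rev_g, swap_out, (T.next_ccwA hV v σ).1]

theorem facePerm_ccwA (v σ) : G'.facePerm (T.g v (ccwA σ)) = T.g v (ccwB (σ + 1)) := by
  rw [G'.facePerm_eq_iff, rev_g, swap_ccwA, (T.next_ccwB hV v σ).1]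

theorem facePerm_ccwB (v σ) : G'.facePerm (T.g v (ccwB σ)) = T.g v (inn σ) := by
  rw [G'.facePerm_eq_iff, rev_g, swap_ccwB, (T.next_inn hV v σ).1]

theorem facePerm_inn (v σ) : G'.facePerm (T.g v (inn (σ + 1))) = T.g v (out σ) := by
  rw [G'.facePerm_eq_iff, rev_g, swap_inn, (T.next_out hV v σ).1]

theorem facePerm_c_zero (d) : G'.facePerm (T.c d 0) =
    T.g (G.tail (G.rev d)) (cwB (T.side (G.rev d))) := by
  rw [G'.facePerm_eq_iff, rev_c, (T.next_cwB hV _).1, neg_zero]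

theorem facePerm_cwB (d) : G'.facePerm (T.g (G.tail d) (cwB (T.side d))) = T.c d (-1) := by
  rw [G'.facePerm_eq_iff, rev_g, swap_cwB, (T.next_c_neg hV _).1]

theorem facePerm_c_neg (d) : G'.facePerm (T.c d (-1)) =
    T.g (G.tail (G.rev d)) (cwA (T.side (G.rev d))) := by
  rw [G'.facePerm_eq_iff, rev_c, (T.next_cwA hV _).1, neg_neg]

theorem facePerm_cwA (d) : G'.facePerm (T.g (G.tail d) (cwA (T.side d))) = T.c d 0 := by
  rw [G'.facePerm_eq_iff, rev_g, swap_cwA, (T.next_c_zero hV _).1]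

theorem facePerm_cwA_of_free {v σ} (hf : T.Free v σ) :
    G'.facePerm (T.g v (cwA σ)) = T.g v (cwB σ) := by
  rw [G'.facePerm_eq_iff, rev_g, swap_cwA, (T.next_cwB_of_free hV hf).1]

theorem facePerm_cwB_of_free {d} (hf : T.Free (G.tail d) (T.side d + 1)) :
    G'.facePerm (T.g (G.tail d) (cwB (T.side d + 1))) = T.c d 1 := by
  rw [G'.facePerm_eq_iff, rev_g, swap_cwB, (T.next_c_one_of_free hV hf).1]

theorem facePerm_cwB_of_free_of_free {v σ} (hf : T.Free v σ) (hf' : T.Free v (σ + 1)) :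
    G'.facePerm (T.g v (cwB (σ + 1))) = T.g v (cwA σ) := by
  rw [G'.facePerm_eq_iff, rev_g, swap_cwB, (T.next_cwA_of_free_of_free hV hf hf').1]

theorem facePerm_c_one (d) (h : R.turn (G.facePerm d) = 1) :
    G'.facePerm (T.c d 1) = T.c (G.facePerm d) 1 := by
  have h1 := (T.side_matches (G.facePerm d)).1
  rw [h, G.next_facePerm] at h1
  rw [G'.facePerm_eq_iff, rev_c, (T.next_c_one hV _ (by simpa using h1)).1]
  rw [← G.tail_next (G.facePerm d), G.next_facePerm]

theorem facePerm_c_one_of_lt (d) (j : ℕ) (h : R.turn (G.facePerm d) = j + 1) (hj : 0 < j) :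
    G'.facePerm (T.c d 1) =
      T.g (G.tail (G.facePerm d)) (cwA (T.side (G.facePerm d) + j)) := by
  have h1 := (T.side_matches (G.facePerm d)).1
  rw [h, G.next_facePerm] at h1
  rw [G'.facePerm_eq_iff, rev_c, (T.next_cwA_of_free hV (T.free_of_lt hj (by omega)) _ _).1]
  · rw [← G.tail_next (G.facePerm d), G.next_facePerm]
  · rw [h1]; push_cast; ring

/-- The outside of the free sides in the corner of `d` belongs to the thickened face on the left of
`d`. -/
theorem face_cw_of_lt (d) (j : ℕ) (h0 : 0 < j) (hj : j < R.turn d) :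
    G'.face (T.g (G.tail d) (cwA (T.side d + j))) = G'.face (T.c d 1) ∧
    G'.face (T.g (G.tail d) (cwB (T.side d + j))) = G'.face (T.c d 1) := by
  suffices h : G'.face (T.g (G.tail d) (cwB (T.side d + j))) = G'.face (T.c d 1) by
    refine ⟨?_, h⟩
    rw [← h, ← T.facePerm_cwA_of_free hV (T.free_of_lt h0 hj), G'.face_facePerm]
  induction j with
  | zero => omega
  | succ j ih =>
    rcases Nat.eq_zero_or_pos j with rfl | hj0
    · rw [← G'.face_facePerm, Nat.cast_add, Nat.cast_zero, zero_add, Nat.cast_one,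
        T.facePerm_cwB_of_free hV (by simpa using T.free_of_lt h0 hj)]
    · have h1 : T.side d + ((j + 1 : ℕ) : ZMod 4) = T.side d + j + 1 := by push_cast; ring
      have hf := T.free_of_lt hj0 (show j < R.turn d by omega)
      rw [← G'.face_facePerm, h1, T.facePerm_cwB_of_free_of_free hV hf
        (h1 ▸ T.free_of_lt h0 hj), ← G'.face_facePerm, T.facePerm_cwA_of_free hV hf]
      exact ih hj0 (by omega)

/-- The left copies of the darts of a face of `G` bound one face of `G'`. -/
theorem face_c_facePerm (d) : G'.face (T.c (G.facePerm d) 1) = G'.face (T.c d 1) := by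
  obtain ⟨j, hj⟩ : ∃ j, R.turn (G.facePerm d) = j + 1 :=
    ⟨R.turn (G.facePerm d) - 1, by have := R.turn_pos (G.facePerm d); omega⟩
  rw [← G'.face_facePerm (T.c d 1)]
  rcases Nat.eq_zero_or_pos j with rfl | hj0
  · rw [T.facePerm_c_one hV d hj]
  · rw [T.facePerm_c_one_of_lt hV d j hj hj0, (T.face_cw_of_lt hV _ j hj0 (by omega)).1]

theorem face_c_one {d e} (h : G.face d = G.face e) : G'.face (T.c d 1) = G'.face (T.c e 1) := by
  have := G.face_induction (p := fun x => G'.face (T.c d 1) = G'.face (T.c x 1))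
    (fun x => by rw [T.face_c_facePerm hV]) h
  exact this.1 rfl

end FacePerm

/-- The list of all darts of `G'`, with the boundary darts of the grids sorted by the darts of `G`
whose corners contain them. -/
theorem dart_cases' (hV : R.VertexCondition) {p : Fin (2 * m') → Prop}
    (h_out : ∀ v σ, p (T.g v (out σ))) (h_ccwA : ∀ v σ, p (T.g v (ccwA σ)))
    (h_ccwB : ∀ v σ, p (T.g v (ccwB σ))) (h_inn : ∀ v σ, p (T.g v (inn (σ + 1))))
    (h_cwA : ∀ d, p (T.g (G.tail d) (cwA (T.side d))))
    (h_cwB : ∀ d, p (T.g (G.tail d) (cwB (T.side d))))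
    (h_cwA' : ∀ d (j : ℕ), 0 < j → j < R.turn d → p (T.g (G.tail d) (cwA (T.side d + j))))
    (h_cwB' : ∀ d (j : ℕ), 0 < j → j < R.turn d → p (T.g (G.tail d) (cwB (T.side d + j))))
    (h_one : ∀ d, p (T.c d 1)) (h_zero : ∀ d, p (T.c d 0)) (h_neg : ∀ d, p (T.c d (-1)))
    (e : Fin (2 * m')) : p e := by
  rcases T.dart_cases e with ⟨v, x, rfl⟩ | ⟨d, s, rfl⟩
  · obtain ⟨σ, h⟩ := x.cases
    obtain ⟨d, j, rfl, hj, hσ⟩ := T.slot_cases hV v σ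
    rcases h with rfl | rfl | rfl | rfl | rfl | rfl
    · exact h_out _ _
    · simpa using h_inn (G.tail d) (σ - 1)
    · rcases Nat.eq_zero_or_pos j with rfl | h0
      · simpa [← hσ] using h_cwA d
      · exact hσ ▸ h_cwA' d j h0 hj
    · rcases Nat.eq_zero_or_pos j with rfl | h0
      · simpa [← hσ] using h_cwB d
      · exact hσ ▸ h_cwB' d j h0 hj
    · exact h_ccwA _ _
    · exact h_ccwB _ _
  · rcases s with _ | _ | _
    · exact h_zero d
    · exact h_neg d
    · exact h_one d

/-- The face traversal of `G'` respects the description of the faces. -/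
theorem cls_facePerm (e : Fin (2 * m')) : T.cls hV (G'.facePerm e) = T.cls hV e := by
  apply T.dart_cases' hV (p := fun e => T.cls hV (G'.facePerm e) = T.cls hV e)
  · intro v σ; rw [facePerm_out T hV, cls_out, cls_ccwA]
  · intro v σ; rw [facePerm_ccwA T hV, cls_ccwA, cls_ccwB, add_sub_cancel_right]
  · intro v σ; rw [facePerm_ccwB T hV, cls_inn, cls_ccwB]
  · intro v σ; rw [facePerm_inn T hV, cls_inn, cls_out, add_sub_cancel_right]
  · intro d; rw [facePerm_cwA T hV, cls_cwA, cls_c_zero]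
  · intro d; rw [facePerm_cwB T hV, cls_cwB, cls_c_neg]
  · intro d j h0 hj
    rw [facePerm_cwA_of_free T hV (T.free_of_lt h0 hj), cls_cwB_of_lt T hV h0 hj,
      cls_cwA_of_lt T hV h0 hj]
  · intro d j h0 hj
    rw [cls_cwB_of_lt T hV h0 hj]
    obtain ⟨i, rfl⟩ : ∃ i, j = i + 1 := ⟨j - 1, by omega⟩
    rcases Nat.eq_zero_or_pos i with rfl | hi
    · rw [Nat.cast_add, Nat.cast_zero, zero_add, Nat.cast_one,
        T.facePerm_cwB_of_free hV (by simpa using T.free_of_lt h0 hj), cls_c_one]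
    · have h1 : T.side d + ((i + 1 : ℕ) : ZMod 4) = T.side d + i + 1 := by push_cast; ring
      have hi' : i < R.turn d := by omega
      rw [h1, T.facePerm_cwB_of_free_of_free hV (T.free_of_lt hi hi')
        (h1 ▸ T.free_of_lt h0 hj), cls_cwA_of_lt T hV hi hi']
  · intro d
    rw [cls_c_one]
    obtain ⟨j, hj⟩ : ∃ j, R.turn (G.facePerm d) = j + 1 :=
      ⟨R.turn (G.facePerm d) - 1, by have := R.turn_pos (G.facePerm d); omega⟩
    rcases Nat.eq_zero_or_pos j with rfl | hj0
    · rw [T.facePerm_c_one hV d hj, cls_c_one, G.face_facePerm]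
    · rw [T.facePerm_c_one_of_lt hV d j hj hj0, cls_cwA_of_lt T hV hj0 (by omega),
        G.face_facePerm]
  · intro d; rw [facePerm_c_zero T hV, cls_c_zero, cls_cwB, G.rev_rev]
  · intro d; rw [facePerm_c_neg T hV, cls_c_neg, cls_cwA]

/-- The face of `G'` with a given description. -/
def repFace (hV : R.VertexCondition) : G.Face ⊕ (Fin n × ZMod 4) ⊕ Fin (2 * m) → G'.Face
  | .inl F => Quotient.lift (fun d => G'.face (T.c d 1))
      (fun _ _ h => T.face_c_one hV (Quotient.sound h)) F
  | .inr (.inl (v, σ)) => G'.face (T.g v (out σ))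
  | .inr (.inr d) => G'.face (T.c d 0)

theorem face_eq_repFace (e : Fin (2 * m')) : G'.face e = T.repFace hV (T.cls hV e) := by
  have hA : ∀ v σ, G'.face (T.g v (ccwA σ)) = G'.face (T.g v (out σ)) := fun v σ => by
    rw [← T.facePerm_out hV, G'.face_facePerm]
  have hI : ∀ v σ, G'.face (T.g v (inn (σ + 1))) = G'.face (T.g v (out σ)) := fun v σ => by
    rw [← T.facePerm_inn hV, G'.face_facePerm]
  have hz : ∀ d, G'.face (T.g (G.tail d) (cwA (T.side d))) = G'.face (T.c d 0) := fun d => by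
    rw [← T.facePerm_cwA hV, G'.face_facePerm]
  have hn : ∀ d, G'.face (T.c d (-1)) = G'.face (T.c (G.rev d) 0) := fun d => by
    rw [← hz, ← T.facePerm_c_neg hV, G'.face_facePerm]
  apply T.dart_cases' hV (p := fun e => G'.face e = T.repFace hV (T.cls hV e))
  · intro v σ; rw [cls_out]; rfl
  · intro v σ; rw [cls_ccwA, hA]; rfl
  · intro v σ
    rw [cls_ccwB, ← G'.face_facePerm, T.facePerm_ccwB hV]
    have h := hI v (σ - 1)
    rw [sub_add_cancel] at h
    exact h
  · intro v σ; rw [cls_inn, hI, add_sub_cancel_right]; rfl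
  · intro d; rw [cls_cwA, hz]; rfl
  · intro d; rw [cls_cwB, ← G'.face_facePerm, T.facePerm_cwB hV, hn]; rfl
  · intro d j h0 hj; rw [cls_cwA_of_lt T hV h0 hj, (T.face_cw_of_lt hV d j h0 hj).1]; rfl
  · intro d j h0 hj; rw [cls_cwB_of_lt T hV h0 hj, (T.face_cw_of_lt hV d j h0 hj).2]; rfl
  · intro d; rw [cls_c_one]; rfl
  · intro d; rw [cls_c_zero]; rfl
  · intro d; rw [cls_c_neg, hn]; rfl

theorem cls_eq_of_face_eq {d e : Fin (2 * m')} (h : G'.face d = G'.face e) :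
    T.cls hV d = T.cls hV e :=
  (G'.face_induction (p := fun x => T.cls hV d = T.cls hV x)
    (fun x => by rw [T.cls_facePerm hV]) h).1 rfl

/-- The faces of `G'` are the faces of `G`, the squares of the grids and the rectangles between
parallel copies. -/
noncomputable def faceEquiv : G'.Face ≃ G.Face ⊕ (Fin n × ZMod 4) ⊕ Fin (2 * m) where
  toFun := Quotient.lift (T.cls hV) fun _ _ h => T.cls_eq_of_face_eq hV (Quotient.sound h)
  invFun := T.repFace hV
  left_inv := by
    intro F
    induction F using Quotient.inductionOn with
    | h e => exact (T.face_eq_repFace hV e).symm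
  right_inv := by
    rintro (F | ⟨v, σ⟩ | d)
    · induction F using Quotient.inductionOn with
      | h d => exact T.cls_c_one hV d
    · exact T.cls_out hV v σ
    · exact T.cls_c_zero hV d

theorem faceEquiv_face (e) : T.faceEquiv hV (G'.face e) = T.cls hV e := rfl

include T in
theorem card_vertices : n' = 9 * n := by
  have h := Fintype.card_congr T.vtx
  simp only [Fintype.card_prod, Fintype.card_fin] at h
  rw [← h, show Fintype.card SignType = 3 from rfl]
  ring

include T in
theorem card_edges : m' = 12 * n + 3 * m := by
  have h := Fintype.card_congr T.dart
  simp only [Fintype.card_prod, Fintype.card_fin, Fintype.card_sum] at h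
  rw [show Fintype.card SignType = 3 from rfl, show Fintype.card GridDart = 24 by decide] at h
  omega

include T hV in
theorem card_faces : Nat.card G'.Face = Nat.card G.Face + 4 * n + 2 * m := by
  classical
  rw [Nat.card_congr (T.faceEquiv hV), Nat.card_sum, Nat.card_sum, Nat.card_prod]
  simp only [Nat.card_eq_fintype_card (α := Fin _), Fintype.card_fin, Nat.card_zmod]
  ring

/-! ### The angle conditions of a thickening -/

include T hV in
/-- In standard position the darts at a vertex of `G'` have distinct directions. -/
theorem vertexCondition : R'.VertexCondition := by
  refine T.matches_bdir.vertexCondition (T.bdir_injective hV) fun v => ?_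
  obtain ⟨⟨w, p⟩, rfl⟩ := T.vtx.surjective v
  have : ∃ x : GridDart, x.1.1 = p := by revert p; decide
  obtain ⟨x, rfl⟩ := this
  exact ⟨T.g w x, T.tail_g w x⟩

/-- A sum over all darts of `G'`, in which the two halves of each clockwise side of a grid are
assigned to the dart of `G` that owns this side. -/
theorem sum_darts {M : Type*} [AddCommMonoid M] (hV : R.VertexCondition)
    (f : Fin (2 * m') → M) :
    ∑ e, f e = ∑ x : Fin n × ZMod 4, (f (T.g x.1 (out x.2)) + f (T.g x.1 (inn x.2)) +
        f (T.g x.1 (ccwA x.2)) + f (T.g x.1 (ccwB x.2))) +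
      ∑ d, (∑ j ∈ Finset.range (R.turn d), (f (T.g (G.tail d) (cwA (T.side d + j))) +
        f (T.g (G.tail d) (cwB (T.side d + j)))) + (f (T.c d 1) + f (T.c d 0) + f (T.c d (-1)))) := by
  rw [← T.dart.sum_comp, Fintype.sum_sum_type, Finset.sum_add_distrib (s := Finset.univ (α := Fin (2 * m))),
    ← T.sum_slots hV fun x => f (T.g x.1 (cwA x.2)) + f (T.g x.1 (cwB x.2)), ← add_assoc,
    ← Finset.sum_add_distrib, Fintype.sum_prod_type, Fintype.sum_prod_type, Fintype.sum_prod_type]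
  congr 1
  · refine Finset.sum_congr rfl fun v _ => ?_
    rw [← kindEquiv.sum_comp, Fintype.sum_prod_type]
    refine Finset.sum_congr rfl fun σ _ => ?_
    have hk : (Finset.univ : Finset Kind) = {.out, .inn, .ccwA, .ccwB, .cwA, .cwB} := rfl
    rw [hk]
    simp only [kindEquiv, Equiv.ofBijective_apply, ofKind, g]
    rw [Finset.sum_insert (by decide), Finset.sum_insert (by decide), Finset.sum_insert (by decide),
      Finset.sum_insert (by decide), Finset.sum_insert (by decide), Finset.sum_singleton]
    simp only [add_assoc]
  · refine Finset.sum_congr rfl fun d _ => ?_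
    have hk : (Finset.univ : Finset SignType) = {1, 0, -1} := by decide
    rw [hk, Finset.sum_insert (by decide), Finset.sum_insert (by decide), Finset.sum_singleton,
      ← add_assoc]
    rfl

end PreThickening

theorem OrthoRep.faceSum_sub {n m : ℕ} {G : EmbeddedGraph n m} (R : OrthoRep G) (F : G.Face)
    [DecidableEq G.Face] :
    (R.faceSum F : ℤ) - 2 * R.faceLength F =
      ∑ d, if G.face d = F then (R.turn d : ℤ) - 2 else 0 := by
  classical
  rw [← Finset.sum_filter, Finset.sum_sub_distrib, Finset.sum_const, faceSum, faceLength]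
  push_cast
  rw [nsmul_eq_mul, mul_comm (2 : ℤ)]
  congr!

theorem OrthoRep.turn_le {n m : ℕ} {G : EmbeddedGraph n m} (R : OrthoRep G) (d : Fin (2 * m)) :
    R.turn d ≤ 4 := by
  by_cases h : G.next d = d
  · exact (R.turn_of_eq d h).le
  · exact (Finset.mem_Icc.1 (R.turn_of_ne d h)).2.trans (by norm_num)

namespace PreThickening

open GridDart

variable {n m n' m' : ℕ} {G : EmbeddedGraph n m} {G' : EmbeddedGraph n' m'}
  {R : OrthoRep G} {R' : OrthoRep G'} (T : PreThickening R R') (hV : R.VertexCondition)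

include hV in
/-- The corner of the grid at the end of a free side has `270°` outside of the grid if the following
side is free as well, and `180°` if the following side is associated with the next dart. -/
theorem turn_cwA_of_lt {d : Fin (2 * m)} {j : ℕ} (h0 : 0 < j) (hj : j < R.turn d) :
    R'.turn (T.g (G.tail d) (cwA (T.side d + j))) = if j + 1 < R.turn d then 3 else 2 := by
  have hf := T.free_of_lt h0 hj
  split_ifs with h
  · have h2 := T.free_of_lt (Nat.succ_pos j) h
    rw [Nat.cast_succ, ← add_assoc] at h2
    exact (T.next_cwA_of_free_of_free hV hf h2).2
  · have h1 := (T.side_matches d).1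
    rw [show R.turn d = j + 1 by omega] at h1
    exact (T.next_cwA_of_free hV hf (G.tail_next d) (by rw [h1]; push_cast; ring)).2

include hV in
/-- If the angle after `d` is `90°`, then the left copy of `d` and the right copy of the next dart
leave the grid at the same corner; otherwise the left copy of `d` is followed by a free side. -/
theorem turn_c_one (d : Fin (2 * m)) :
    R'.turn (T.c d 1) = if R.turn d = 1 then 1 else 2 := by
  split_ifs with h
  · have h1 := (T.side_matches d).1
    rw [h, Nat.cast_one] at h1
    exact (T.next_c_one hV (G.tail_next d) h1).2
  · have := R.turn_pos d
    have h1 := T.free_of_lt one_pos (show 1 < R.turn d by omega)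
    rw [Nat.cast_one] at h1
    exact (T.next_c_one_of_free hV h1).2

open Classical in
/-- Thickening preserves the excess of the angle sum of a face over `180°` per corner. -/
theorem excess_face (F : G.Face) :
    ∑ e, (if T.cls hV e = .inl F then (R'.turn e : ℤ) - 2 else 0) =
      ∑ d, if G.face d = F then (R.turn d : ℤ) - 2 else 0 := by
  rw [T.sum_darts hV]
  simp only [cls_out, cls_inn, cls_ccwA, cls_ccwB, cls_c_zero, cls_c_neg, reduceCtorEq, if_false,
    add_zero, Finset.sum_const_zero, zero_add]
  refine Finset.sum_congr rfl fun d _ => ?_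
  simp only [cls_c_one, turn_c_one T hV, Sum.inl.injEq]
  -- Each corner of the grid between two free sides contributes one unit of excess.
  have h1 : ∀ j ∈ Finset.range (R.turn d),
      ((if T.cls hV (T.g (G.tail d) (cwA (T.side d + j))) = .inl F
          then (R'.turn (T.g (G.tail d) (cwA (T.side d + j))) : ℤ) - 2 else 0) +
        if T.cls hV (T.g (G.tail d) (cwB (T.side d + j))) = .inl F
          then (R'.turn (T.g (G.tail d) (cwB (T.side d + j))) : ℤ) - 2 else 0) =
      if G.face d = F then (if 0 < j ∧ j + 1 < R.turn d then 1 else 0) else 0 := by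
    intro j hj
    rcases Nat.eq_zero_or_pos j with rfl | h0
    · simp [cls_cwA, cls_cwB]
    · rw [Finset.mem_range] at hj
      simp only [cls_cwA_of_lt T hV h0 hj, cls_cwB_of_lt T hV h0 hj, turn_cwA_of_lt T hV h0 hj,
        (T.next_cwB_of_free hV (T.free_of_lt h0 hj)).2, Sum.inl.injEq]
      split_ifs <;> first | rfl | omega
  rw [Finset.sum_congr rfl h1]
  split_ifs with hF h
  · rw [h]; decide
  -- With `turn d = τ ≥ 2` there are `τ - 2` such corners.
  · have h2 := R.turn_pos d
    have h3 := R.turn_le d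
    generalize R.turn d = τ at *
    interval_cases τ <;> first | omega | decide
  · simp

open Classical in
/-- The four corners inside a square of a grid have `90°` each. -/
theorem excess_square (x : Fin n × ZMod 4) :
    ∑ e, (if T.cls hV e = .inr (.inl x) then (R'.turn e : ℤ) - 2 else 0) = -4 := by
  rw [T.sum_darts hV]
  have hE : ∀ v σ, R'.turn (T.g v (ccwB σ)) = 1 := fun v σ => by
    have := (T.next_ccwB hV v (σ - 1)).2
    rwa [sub_add_cancel] at this
  have h2 : ∀ d, (∑ j ∈ Finset.range (R.turn d),
      ((if T.cls hV (T.g (G.tail d) (cwA (T.side d + j))) = .inr (.inl x)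
          then (R'.turn (T.g (G.tail d) (cwA (T.side d + j))) : ℤ) - 2 else 0) +
        if T.cls hV (T.g (G.tail d) (cwB (T.side d + j))) = .inr (.inl x)
          then (R'.turn (T.g (G.tail d) (cwB (T.side d + j))) : ℤ) - 2 else 0)) = 0 := by
    intro d
    refine Finset.sum_eq_zero fun j hj => ?_
    rw [Finset.mem_range] at hj
    rcases Nat.eq_zero_or_pos j with rfl | h0
    · simp [cls_cwA, cls_cwB]
    · simp [cls_cwA_of_lt T hV h0 hj, cls_cwB_of_lt T hV h0 hj]
  simp only [h2, cls_out, cls_inn, cls_ccwA, cls_ccwB, cls_c_zero, cls_c_neg, cls_c_one, hE,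
    (T.next_out hV _ _).2, (T.next_inn hV _ _).2, (T.next_ccwA hV _ _).2,
    reduceCtorEq, if_false, Sum.inr.injEq, Sum.inl.injEq,
    add_zero, Finset.sum_const_zero, Finset.sum_add_distrib]
  obtain ⟨v, σ⟩ := x
  have h3 : ∀ y : Fin n × ZMod 4, ((y.1, y.2 - 1) = (v, σ)) ↔ y = (v, σ + 1) := by
    rintro ⟨w, τ⟩
    simp only [Prod.mk.injEq, sub_eq_iff_eq_add]
  simp [h3]

open Classical in
/-- The four corners between two neighbouring copies of an edge have `90°` each. -/
theorem excess_rectangle (d₀ : Fin (2 * m)) :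
    ∑ e, (if T.cls hV e = .inr (.inr d₀) then (R'.turn e : ℤ) - 2 else 0) = -4 := by
  rw [T.sum_darts hV]
  have h3 : ∀ d, G.rev d = d₀ ↔ d = G.rev d₀ := fun d => by
    rw [← G.rev_injective.eq_iff, G.rev_rev]
  have h2 : ∀ d, (∑ j ∈ Finset.range (R.turn d),
      ((if T.cls hV (T.g (G.tail d) (cwA (T.side d + j))) = .inr (.inr d₀)
          then (R'.turn (T.g (G.tail d) (cwA (T.side d + j))) : ℤ) - 2 else 0) +
        if T.cls hV (T.g (G.tail d) (cwB (T.side d + j))) = .inr (.inr d₀)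
          then (R'.turn (T.g (G.tail d) (cwB (T.side d + j))) : ℤ) - 2 else 0)) =
      (if d = d₀ then -1 else 0) + if d = G.rev d₀ then -1 else 0 := by
    intro d
    rw [Finset.sum_eq_single_of_mem 0 (Finset.mem_range.2 (R.turn_pos d))]
    · simp only [Nat.cast_zero, add_zero, cls_cwA, cls_cwB, (T.next_cwA hV d).2,
        (T.next_cwB hV d).2, Sum.inr.injEq, h3]
      norm_num
    · intro j hj h0
      rw [Finset.mem_range] at hj
      have h0 : 0 < j := by omega
      simp [cls_cwA_of_lt T hV h0 hj, cls_cwB_of_lt T hV h0 hj]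
  simp only [h2, cls_out, cls_inn, cls_ccwA, cls_ccwB, cls_c_zero, cls_c_neg, cls_c_one,
    (T.next_c_zero hV _).2, (T.next_c_neg hV _).2,
    reduceCtorEq, if_false, Sum.inr.injEq,
    add_zero, Finset.sum_const_zero, Finset.sum_add_distrib]
  simp [h3]

end PreThickening

/-- The thickened faces keep their excess, and all other faces of `G'` are quadrilaterals with four
right angles; since the central and the outer face of `G'` are thickened faces, the angle sums of
`R'` are correct. -/
theorem Thickening.faceCondition {n m n' m' : ℕ} {G : EmbeddedGraph n m}
    {G' : EmbeddedGraph n' m'} {R : OrthoRep G} {R' : OrthoRep G'} (T' : Thickening R R')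
    (hV : R.VertexCondition) (hF : R.FaceCondition) : R'.FaceCondition := by
  classical
  let T := T'.pre
  obtain ⟨c, hc⟩ := Quotient.exists_rep R.central
  obtain ⟨o, ho⟩ := Quotient.exists_rep R.outer
  have hc' : R'.central = (T.faceEquiv hV).symm (.inl R.central) := by
    rw [← hc, ← T'.central c hc]; rfl
  have ho' : R'.outer = (T.faceEquiv hV).symm (.inl R.outer) := by
    rw [← ho, ← T'.outer o ho]; rfl
  have hs : ∀ X, (R'.faceSum ((T.faceEquiv hV).symm X) : ℤ) -
      2 * R'.faceLength ((T.faceEquiv hV).symm X) =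
      ∑ e, (if T.cls hV e = X then (R'.turn e : ℤ) - 2 else 0) := by
    intro X
    rw [R'.faceSum_sub]
    simp only [Equiv.eq_symm_apply, PreThickening.faceEquiv_face]
  intro F'
  obtain ⟨X, rfl⟩ := (T.faceEquiv hV).symm.surjective F'
  have h := hs X
  rw [hc', ho']
  simp only [ne_eq, EmbeddingLike.apply_eq_iff_eq]
  rcases X with F | x | d
  · rw [T.excess_face hV, ← R.faceSum_sub] at h
    obtain ⟨h1, h2, h3, h4⟩ := hF F
    simp only [Sum.inl.injEq]
    refine ⟨fun ha hb => ?_, fun ha hb => ?_, fun ha hb => ?_, fun ha hb => ?_⟩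
    · have := h1 ha hb; omega
    · have := h2 ha hb; omega
    · have := h3 ha hb; omega
    · have := h4 ha hb; omega
  · rw [T.excess_square hV] at h
    simp only [reduceCtorEq, not_false_eq_true, forall_const, IsEmpty.forall_iff, and_true]
    omega
  · rw [T.excess_rectangle hV] at h
    simp only [reduceCtorEq, not_false_eq_true, forall_const, IsEmpty.forall_iff, and_true]
    omega

/-! ### A thickening is simple -/

namespace OrthoRep

variable {n m : ℕ} {G : EmbeddedGraph n m} {R : OrthoRep G}

/-- In a representation with the correct angle sums the excess of a face is a multiple of `360°`. -/
theorem FaceCondition.excess (hF : R.FaceCondition) (F : G.Face) :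
    (R.faceSum F : ℤ) - 2 * R.faceLength F = -4 ∨ (R.faceSum F : ℤ) - 2 * R.faceLength F = 0 ∨
      (R.faceSum F : ℤ) - 2 * R.faceLength F = 4 := by
  obtain ⟨h1, h2, h3, h4⟩ := hF F
  by_cases hc : F = R.central <;> by_cases ho : F = R.outer
  · have := h4 hc ho; omega
  · have := h2 hc ho; omega
  · have := h3 hc ho; omega
  · have := h1 hc ho; omega

/-- No face is bounded by a single loop with an angle of `90°`. -/
theorem FaceCondition.not_monogon (hF : R.FaceCondition) {d : Fin (2 * m)}
    (hd : G.facePerm d = d) : R.turn d ≠ 1 := by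
  classical
  intro ht
  have h := hF.excess (G.face d)
  have hf : ∀ e, G.face e = G.face d ↔ e = d := by
    refine fun e => ⟨fun he => ?_, fun he => he ▸ rfl⟩
    refine (G.face_induction (p := fun x => x = d) (fun x => ?_) he).2 rfl
    rw [← G.facePerm.injective.eq_iff, hd]
  simp only [R.faceSum_sub, hf] at h
  rw [Finset.sum_ite_eq' Finset.univ d] at h
  simp [ht] at h

/-- No face is bounded by two edges with two angles of `90°`. -/
theorem FaceCondition.not_bigon (hF : R.FaceCondition) {d e : Fin (2 * m)}
    (hd : G.facePerm d = e) (he : G.facePerm e = d) : ¬ (R.turn d = 1 ∧ R.turn e = 1) := by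
  classical
  rintro ⟨ht, ht'⟩
  by_cases hde : d = e
  · exact hF.not_monogon (hd.trans hde.symm) ht
  have h := hF.excess (G.face d)
  have hf : ∀ x, G.face x = G.face d ↔ x = d ∨ x = e := by
    refine fun x => ⟨fun hx => ?_, fun hx => ?_⟩
    · refine (G.face_induction (p := fun x => x = d ∨ x = e) (fun x => ?_) hx).2 (.inl rfl)
      constructor
      · rintro (rfl | rfl)
        · exact .inr hd
        · exact .inl he
      · rintro (h | h)
        · exact .inr (G.facePerm.injective (h.trans he.symm))
        · exact .inl (G.facePerm.injective (h.trans hd.symm))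
    · rcases hx with rfl | rfl
      · rfl
      · rw [← hd, G.face_facePerm]
  simp only [R.faceSum_sub, hf] at h
  rw [← Finset.sum_filter, show (Finset.univ.filter fun x => x = d ∨ x = e) = {d, e} by
    ext; simp, Finset.sum_pair hde] at h
  simp [ht, ht'] at h

end OrthoRep

theorem gridSide_eq_gridSide : ∀ (σ τ : ZMod 4) (s t : SignType), gridSide σ s = gridSide τ t →
    (σ = τ ∧ s = t) ∨ (τ = σ + 1 ∧ s = 1 ∧ t = -1) ∨ (σ = τ + 1 ∧ s = -1 ∧ t = 1) := by decide

/-- Adjacent grid vertices lie on the same side or on two consecutive sides. -/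
theorem gridSide_adjacent : ∀ (x : GridDart) (σ τ : ZMod 4) (s : SignType), x.1.1 = gridSide σ s →
    x.1.2 = gridSide τ (-s) → τ = σ ∨ τ = σ + 1 ∨ σ = τ + 1 := by
  set_option maxRecDepth 10000 in decide

namespace PreThickening

open GridDart

variable {n m n' m' : ℕ} {G : EmbeddedGraph n m} {G' : EmbeddedGraph n' m'}
  {R : OrthoRep G} {R' : OrthoRep G'} (T : PreThickening R R') (hV : R.VertexCondition)

theorem head_g (v x) : G'.head (T.g v x) = T.vtx (v, x.1.2) := by
  rw [← G'.tail_rev, rev_g, tail_g]; rfl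

theorem head_c (d s) : G'.head (T.c d s) =
    T.vtx (G.head d, gridSide (T.side (G.rev d)) (-s)) := by
  rw [← G'.tail_rev, rev_c, tail_c]; rfl

section
include T hV

theorem next_of_side {d e : Fin (2 * m)} (ht : G.tail e = G.tail d)
    (hs : T.side e = T.side d + 1) : G.next d = e ∧ R.turn d = 1 :=
  T.side_matches.next_eq (fun _ _ => hV.dir_injective T.side_matches) one_pos (by norm_num) ht
    (by simpa using hs) (fun i h0 h1 => by omega)

theorem side_rev_ne (hF : R.FaceCondition) {d : Fin (2 * m)} (ht : G.head d = G.tail d) :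
    T.side (G.rev d) ≠ T.side d + 1 := by
  intro hs
  obtain ⟨h1, h2⟩ := T.next_of_side hV ht hs
  exact hF.not_monogon ((G.facePerm_eq_iff d d).2 h1) h2

/-- The two ends of a loop lie on opposite sides of its grid, since adjacent sides would make the
loop bound a face on its own. -/
theorem loop_sides (hF : R.FaceCondition) {d : Fin (2 * m)} (ht : G.head d = G.tail d) :
    ¬ (T.side (G.rev d) = T.side d ∨ T.side (G.rev d) = T.side d + 1 ∨
      T.side d = T.side (G.rev d) + 1) := by
  rintro (h | h | h)
  · exact G.rev_ne d (T.side_inj hV ht h)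
  · exact T.side_rev_ne hV hF ht h
  · refine T.side_rev_ne hV hF (d := G.rev d) ?_ ?_
    · rw [G.head_rev, G.tail_rev, ht]
    · rw [G.rev_rev, h]

/-- Copies of two edges with the same ends share both ends only if the edges leave both grids
through consecutive sides; the two edges would then bound a face with two angles of `90°`. -/
theorem no_parallel (hF : R.FaceCondition) {d e : Fin (2 * m)} (ht : G.tail e = G.tail d)
    (hs : T.side e = T.side d + 1) (ht' : G.head e = G.head d)
    (hs' : T.side (G.rev d) = T.side (G.rev e) + 1) : False := by
  obtain ⟨h1, h2⟩ := T.next_of_side hV ht hs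
  obtain ⟨h3, h4⟩ := T.next_of_side hV (d := G.rev e) (e := G.rev d) ht'.symm hs'
  refine hF.not_bigon (d := d) (e := G.rev e) ?_ ?_ ⟨h2, h4⟩
  · rw [G.facePerm_eq_iff, h3]
  · rw [G.facePerm_eq_iff, h1, G.rev_rev]

theorem tail_ne_head (hF : R.FaceCondition) (e : Fin (2 * m')) : G'.tail e ≠ G'.head e := by
  rcases T.dart_cases e with ⟨v, x, rfl⟩ | ⟨d, s, rfl⟩
  · rw [tail_g, head_g, ne_eq, T.vtx.injective.eq_iff, Prod.mk.injEq]
    rintro ⟨-, h⟩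
    revert h; revert x; decide
  · rw [tail_c, head_c, ne_eq, T.vtx.injective.eq_iff, Prod.mk.injEq]
    rintro ⟨h1, h2⟩
    apply T.loop_sides hV hF h1.symm
    rcases gridSide_eq_gridSide _ _ _ _ h2 with h | h | h
    · exact .inl h.1.symm
    · exact .inr (.inl h.1)
    · exact .inr (.inr h.1)

theorem isSimple (hF : R.FaceCondition) : G'.IsSimple := by
  refine ⟨T.tail_ne_head hV hF, fun d' e' h1 h2 => ?_⟩
  have key : ∀ v x d s, G'.tail (T.g v x) = G'.tail (T.c d s) →
      G'.head (T.g v x) = G'.head (T.c d s) → False := by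
    intro v x d s h1 h2
    simp only [tail_g, tail_c, head_g, head_c, T.vtx.injective.eq_iff, Prod.mk.injEq] at h1 h2
    exact T.loop_sides hV hF (h2.1.symm.trans h1.1) (gridSide_adjacent x _ _ s h1.2 h2.2)
  rcases T.dart_cases d' with ⟨v, x, rfl⟩ | ⟨d, s, rfl⟩ <;>
  rcases T.dart_cases e' with ⟨w, y, rfl⟩ | ⟨e, t, rfl⟩
  · simp only [tail_g, head_g, T.vtx.injective.eq_iff, Prod.mk.injEq] at h1 h2
    rw [g_inj]
    exact ⟨h1.1, Subtype.ext (Prod.ext h1.2 h2.2)⟩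
  · exact (key v x e t h1 h2).elim
  · exact (key w y d s h1.symm h2.symm).elim
  · simp only [tail_c, head_c, T.vtx.injective.eq_iff, Prod.mk.injEq] at h1 h2
    rw [c_inj]
    have hr : T.side (G.rev d) = T.side (G.rev e) → d = e := fun h =>
      G.rev_injective (T.side_inj hV h2.1 h)
    rcases gridSide_eq_gridSide _ _ _ _ h1.2 with h | ⟨h, rfl, rfl⟩ | ⟨h, rfl, rfl⟩
    · exact ⟨T.side_inj hV h1.1 h.1, h.2⟩
    · exfalso
      have hne : d ≠ e := by
        rintro rfl
        exact absurd (left_eq_add.1 h) (by decide)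
      rcases gridSide_eq_gridSide _ _ _ _ h2.2 with h' | ⟨-, h', -⟩ | ⟨h', -⟩
      · exact hne (hr h'.1)
      · exact absurd h' (by decide)
      · exact T.no_parallel hV hF h1.1.symm h h2.1.symm h'
    · exfalso
      have hne : d ≠ e := by
        rintro rfl
        exact absurd (left_eq_add.1 h) (by decide)
      rcases gridSide_eq_gridSide _ _ _ _ h2.2 with h' | ⟨h', -⟩ | ⟨-, h', -⟩
      · exact hne (hr h'.1)
      · exact T.no_parallel hV hF h1.1 h h2.1 h'
      · exact absurd h' (by decide)

end

/-! ### A thickening is biconnected -/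

/-- Adjacency in the grid. -/
def GridAdj (p q : GridPos) : Prop := |(p.1 : ℤ) - (q.1 : ℤ)| + |(p.2 : ℤ) - (q.2 : ℤ)| = 1

instance : DecidableRel GridAdj := fun _ _ => inferInstanceAs (Decidable (_ = _))

theorem gridAdj_near : ∀ q h : GridPos, q ≠ 0 ∧ h = 0 → ∀ p, p ≠ q → p = h ∨ GridAdj p h ∨
    ∃ p₁, p₁ ≠ q ∧ GridAdj p p₁ ∧ GridAdj p₁ h := by
  decide

theorem gridAdj_ring : ∀ p : GridPos, p ≠ 0 → ∃ h, (h = (1, 1) ∨ h = (-1, -1)) ∧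
    (p = h ∨ GridAdj p h ∨ ∃ p₁, p₁ ≠ 0 ∧ GridAdj p p₁ ∧ GridAdj p₁ h) := by
  decide

/-- The grid stays connected when a vertex is removed. -/
theorem grid_connected (q : GridPos) : ∃ h : GridPos, ∀ p, p ≠ q →
    Relation.ReflTransGen (fun a b => a ≠ q ∧ b ≠ q ∧ GridAdj a b) p h := by
  by_cases hq : q = 0
  · subst hq
    have h1 : ∀ h : GridPos, h = (1, 1) ∨ h = (-1, -1) →
        Relation.ReflTransGen (fun a b => a ≠ 0 ∧ b ≠ 0 ∧ GridAdj a b) h ((1, 1) : GridPos) := by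
      rintro h (rfl | rfl)
      · exact .refl
      · exact .head (b := (-1, 0)) (by decide) (.head (b := (-1, 1)) (by decide)
          (.head (b := (0, 1)) (by decide) (.single (by decide))))
    refine ⟨(1, 1), fun p hp => ?_⟩
    obtain ⟨h, hh, h2⟩ := gridAdj_ring p hp
    have hh0 : h ≠ 0 := by rcases hh with rfl | rfl <;> decide
    refine .trans ?_ (h1 h hh)
    rcases h2 with rfl | h2 | ⟨p₁, h2, h3, h4⟩
    · exact .refl
    · exact .single ⟨hp, hh0, h2⟩
    · exact .head ⟨hp, h2, h3⟩ (.single ⟨h2, hh0, h4⟩)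
  · refine ⟨0, fun p hp => ?_⟩
    rcases gridAdj_near q 0 ⟨hq, rfl⟩ p hp with rfl | h2 | ⟨p₁, h2, h3, h4⟩
    · exact .refl
    · exact .single ⟨hp, Ne.symm hq, h2⟩
    · exact .head ⟨hp, h2, h3⟩ (.single ⟨h2, Ne.symm hq, h4⟩)

theorem exists_other (p₁ p₂ : GridPos) : ∃ q, p₁ ≠ q ∧ p₂ ≠ q := by
  revert p₁ p₂; decide

/-- Adjacency of `G'` after the removal of a vertex. -/
def AdjAvoiding (G' : EmbeddedGraph n' m') (w x y : Fin n') : Prop :=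
  x ≠ w ∧ y ≠ w ∧ G'.adjacency.Adj x y

theorem AdjAvoiding.symm (G' : EmbeddedGraph n' m') (w : Fin n') :
    Std.Symm (AdjAvoiding G' w) := ⟨fun _ _ h => ⟨h.2.1, h.1, h.2.2.symm⟩⟩

theorem adj_of_dart (hne : ∀ e, G'.tail e ≠ G'.head e) (e : Fin (2 * m')) :
    G'.adjacency.Adj (G'.tail e) (G'.head e) :=
  (SimpleGraph.fromRel_adj _ _ _).2 ⟨hne e, .inl ⟨e, rfl, rfl⟩⟩

theorem adj_grid (hne : ∀ e, G'.tail e ≠ G'.head e) (v : Fin n) {p q : GridPos}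
    (h : GridAdj p q) : G'.adjacency.Adj (T.vtx (v, p)) (T.vtx (v, q)) := by
  have := adj_of_dart hne (T.g v ⟨(p, q), h⟩)
  rwa [tail_g, head_g] at this

theorem connected_grid (hne : ∀ e, G'.tail e ≠ G'.head e) (w : Fin n') (v : Fin n)
    {p₁ p₂ : GridPos} (h₁ : T.vtx (v, p₁) ≠ w) (h₂ : T.vtx (v, p₂) ≠ w) :
    Relation.ReflTransGen (AdjAvoiding G' w) (T.vtx (v, p₁)) (T.vtx (v, p₂)) := by
  obtain ⟨q, hq, hq₁, hq₂⟩ : ∃ q, (∀ p, p ≠ q → T.vtx (v, p) ≠ w) ∧ p₁ ≠ q ∧ p₂ ≠ q := by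
    obtain ⟨⟨v', q⟩, rfl⟩ := T.vtx.surjective w
    by_cases hv : v = v'
    · subst hv
      refine ⟨q, fun p hp => ?_, ?_, ?_⟩
      · simpa using hp
      · rintro rfl; exact h₁ rfl
      · rintro rfl; exact h₂ rfl
    · obtain ⟨q', h1, h2⟩ := exists_other p₁ p₂
      exact ⟨q', fun p _ => by simp [hv], h1, h2⟩
  obtain ⟨h, hh⟩ := grid_connected q
  have key : ∀ p, p ≠ q →
      Relation.ReflTransGen (AdjAvoiding G' w) (T.vtx (v, p)) (T.vtx (v, h)) := fun p hp =>
    (hh p hp).lift (fun p => T.vtx (v, p)) fun a b hab =>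
      ⟨hq a hab.1, hq b hab.2.1, T.adj_grid hne v hab.2.2⟩
  have := AdjAvoiding.symm G' w
  exact (key p₁ hq₁).trans (symm (key p₂ hq₂))

/-- Of the three copies of an edge at most one is destroyed by the removal of a vertex. -/
theorem exists_copy (w : Fin n') (d : Fin (2 * m)) (hd : G.tail d ≠ G.head d) :
    ∃ s, G'.tail (T.c d s) ≠ w ∧ G'.head (T.c d s) ≠ w := by
  obtain ⟨⟨v, q⟩, rfl⟩ := T.vtx.surjective w
  have h1 : ∃ s : SignType, gridSide (T.side d) s ≠ q := by
    generalize T.side d = σ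
    revert σ q; decide
  have h2 : ∃ s : SignType, gridSide (T.side (G.rev d)) (-s) ≠ q := by
    generalize T.side (G.rev d) = σ
    clear h1
    revert σ q; decide
  simp only [tail_c, head_c, ne_eq, T.vtx.injective.eq_iff, Prod.mk.injEq, not_and]
  by_cases hv : G.tail d = v
  · obtain ⟨s, hs⟩ := h1
    exact ⟨s, fun _ => hs, fun h => absurd (hv.trans h.symm) hd⟩
  · obtain ⟨s, hs⟩ := h2
    exact ⟨s, fun h => absurd h hv, fun _ => hs⟩

include T in
/-- After the removal of a vertex of `G'`, a walk in `G` can be followed: inside the grids by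
`connected_grid` and between them by `exists_copy`. -/
theorem connected_avoiding (hc : G.adjacency.Connected) (hne : ∀ e, G'.tail e ≠ G'.head e)
    (w x y : Fin n') (hx : x ≠ w) (hy : y ≠ w) : Relation.ReflTransGen (AdjAvoiding G' w) x y := by
  obtain ⟨⟨v, p⟩, rfl⟩ := T.vtx.surjective x
  obtain ⟨⟨u, q⟩, rfl⟩ := T.vtx.surjective y
  have hreach := hc.preconnected v u
  rw [SimpleGraph.reachable_iff_reflTransGen] at hreach
  induction hreach generalizing q with
  | refl => exact T.connected_grid hne w v hx hy
  | @tail a b _ hab ih =>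
    obtain ⟨hab, hd⟩ := (SimpleGraph.fromRel_adj _ _ _).1 hab
    obtain ⟨d, rfl, rfl⟩ : ∃ d, G.tail d = a ∧ G.head d = b := by
      rcases hd with h | ⟨d, h1, h2⟩
      · exact h
      · exact ⟨G.rev d, h2, by rw [G.head_rev, h1]⟩
    obtain ⟨s, h1, h2⟩ := T.exists_copy w d hab
    have h3 := adj_of_dart hne (T.c d s)
    rw [tail_c] at h1 h3
    rw [head_c] at h2 h3
    exact ((ih _ h1).tail ⟨h1, h2, h3⟩).trans (T.connected_grid hne w _ h2 hy)

include T in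
theorem isBiconnected (hc : G.adjacency.Connected) (hne : ∀ e, G'.tail e ≠ G'.head e) :
    G'.IsBiconnected := by
  have hcard := T.card_vertices
  have hn : 0 < n := by
    obtain ⟨v⟩ := hc.nonempty
    exact v.pos
  have h2 : 2 < n' := by omega
  have hex : ∀ x y : Fin n', ∃ w, x ≠ w ∧ y ≠ w := by
    intro x y
    have : ∃ w : Fin n', w ∉ ({x, y} : Finset (Fin n')) := by
      by_contra! h
      have h3 := Finset.card_le_card (fun w _ => h w : Finset.univ ⊆ ({x, y} : Finset (Fin n')))
      have h4 := Finset.card_le_two (a := x) (b := y)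
      rw [Finset.card_univ, Fintype.card_fin] at h3
      omega
    obtain ⟨w, hw⟩ := this
    simp only [Finset.mem_insert, Finset.mem_singleton, not_or] at hw
    exact ⟨w, Ne.symm hw.1, Ne.symm hw.2⟩
  have : Nonempty (Fin n') := ⟨⟨0, by omega⟩⟩
  refine ⟨h2, ⟨fun x y => ?_⟩, fun w => ?_⟩
  · obtain ⟨w, hx, hy⟩ := hex x y
    rw [SimpleGraph.reachable_iff_reflTransGen]
    exact (T.connected_avoiding hc hne w x y hx hy).lift id fun _ _ h => h.2.2
  · have hne' : Nonempty ↥({w}ᶜ : Set (Fin n')) := by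
      obtain ⟨x, hx, -⟩ := hex w w
      exact ⟨⟨x, Ne.symm hx⟩⟩
    refine { preconnected := ?_, nonempty := hne' }
    rintro ⟨x, hx⟩ ⟨y, hy⟩
    have h := T.connected_avoiding hc hne w x y hx hy
    have key : ∀ y, Relation.ReflTransGen (AdjAvoiding G' w) x y → ∀ hy : y ∈ ({w}ᶜ : Set (Fin n')),
        (G'.adjacency.induce {w}ᶜ).Reachable ⟨x, hx⟩ ⟨y, hy⟩ := by
      intro y h
      induction h with
      | refl => exact fun _ => .refl _
      | tail _ hab ih =>
        intro hy
        exact (ih hab.1).trans (SimpleGraph.Adj.reachable (by simpa using hab.2.2))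
    exact key y h hy

include T in
/-- Euler's formula: thickening adds `8n` vertices, `12n + 2m` edges and `4n + 2m` faces. -/
theorem isPlane (hV : R.VertexCondition) (hF : R.FaceCondition) (hP : G.IsPlane) :
    G'.IsPlane := by
  refine ⟨(T.isBiconnected hP.1 (T.tail_ne_head hV hF)).2.1, ?_⟩
  have h1 := T.card_faces hV
  have h2 := T.card_edges
  have h3 := T.card_vertices
  have h4 := hP.2
  omega

end PreThickening

/-! ### Polar coordinates -/

namespace Drawing

open Filter Topology

/-- The unit vector of a direction in the plane of radius and angle. -/
noncomputable def U (k : ZMod 4) : ℝ × ℝ :=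
  if k = 0 then (1, 0) else if k = 1 then (0, 1) else if k = 2 then (-1, 0) else (0, -1)

/-- The point with given polar coordinates. -/
noncomputable def P (y : ℝ × ℝ) : ℂ := polar y.1 y.2

theorem U_zero : U 0 = (1, 0) := rfl
theorem U_one : U 1 = (0, 1) := rfl
theorem U_two : U 2 = (-1, 0) := rfl
theorem U_three : U 3 = (0, -1) := rfl

theorem dir_cases (k : ZMod 4) : k = 0 ∨ k = 1 ∨ k = 2 ∨ k = 3 := by revert k; decide

theorem U_add_two (k : ZMod 4) : U (k + 2) = -U k := by
  rcases dir_cases k with rfl | rfl | rfl | rfl <;>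
  [rw [show (0 + 2 : ZMod 4) = 2 from rfl, U_two, U_zero];
   rw [show (1 + 2 : ZMod 4) = 3 from rfl, U_three, U_one];
   rw [show (2 + 2 : ZMod 4) = 0 from rfl, U_zero, U_two];
   rw [show (3 + 2 : ZMod 4) = 1 from rfl, U_one, U_three]] <;> simp

theorem U_add_three (k : ZMod 4) : U (k + 3) = -U (k + 1) := by
  rw [← U_add_two]; congr 1; ring

theorem norm_U (k : ZMod 4) : ‖U k‖ = 1 := by
  rcases dir_cases k with rfl | rfl | rfl | rfl <;> simp [U_zero, U_one, U_two, U_three, Prod.norm_def]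

theorem U_add_two_smul (a b : ℝ) (k : ZMod 4) :
    a • U (k + 1) + b • U (k + 1 + 1) = (-b) • U k + a • U (k + 1) := by
  rw [show k + 1 + 1 = k + 2 by ring, U_add_two]; module

theorem continuous_P : Continuous P := by
  unfold P polar; fun_prop

theorem norm_P (y : ℝ × ℝ) (hy : 0 < y.1) : ‖P y‖ = y.1 := by
  rw [P, polar, norm_mul, Complex.norm_exp_ofReal_mul_I, mul_one, Complex.norm_real,
    Real.norm_of_nonneg hy.le]

theorem P_add_period (y : ℝ × ℝ) (j : ℤ) : P (y + (0, 2 * Real.pi * j)) = P y := by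
  simp only [P, polar, Prod.fst_add, Prod.snd_add, add_zero]
  congr 1
  rw [Complex.exp_eq_exp_iff_exists_int]
  exact ⟨j, by push_cast; ring⟩

theorem P_eq_iff {y z : ℝ × ℝ} (hy : 0 < y.1) (hz : 0 < z.1) :
    P y = P z ↔ ∃ j : ℤ, y = z + (0, 2 * Real.pi * j) := by
  constructor
  · intro h
    have h1 : y.1 = z.1 := by rw [← norm_P y hy, ← norm_P z hz, h]
    have h2 : Complex.exp (y.2 * Complex.I) = Complex.exp (z.2 * Complex.I) := by
      have h0 : (z.1 : ℂ) ≠ 0 := by exact_mod_cast hz.ne'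
      simp only [P, polar, h1] at h
      exact mul_left_cancel₀ h0 h
    obtain ⟨j, hj⟩ := Complex.exp_eq_exp_iff_exists_int.1 h2
    refine ⟨j, Prod.ext (by simpa using h1) ?_⟩
    have h3 : (y.2 : ℂ) = z.2 + 2 * Real.pi * j := by
      apply mul_right_cancel₀ Complex.I_ne_zero
      linear_combination hj
    have h4 : y.2 = z.2 + 2 * Real.pi * j := by exact_mod_cast h3
    simpa using h4
  · rintro ⟨j, rfl⟩
    exact P_add_period z j

/-- Directions `k` and `k + 1` are independent, even modulo the period of the angle. -/
theorem coeff_eq_zero {a b : ℝ} {k : ZMod 4} {j : ℤ}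
    (h : a • U k + b • U (k + 1) = (0, 2 * Real.pi * j)) (hb : |b| < 1) : b = 0 := by
  have hpi := Real.pi_gt_three
  have key : b = 2 * Real.pi * j ∨ -b = 2 * Real.pi * j → b = 0 := by
    intro hj
    have h0 : j = 0 := by
      by_contra hne
      have h1 : (1 : ℝ) ≤ |(j : ℝ)| := by exact_mod_cast Int.one_le_abs hne
      have h2 : |b| = 2 * Real.pi * |(j : ℝ)| := by
        rcases hj with hj | hj
        · rw [hj, abs_mul, abs_of_pos Real.two_pi_pos]
        · rw [← abs_neg, hj, abs_mul, abs_of_pos Real.two_pi_pos]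
      nlinarith
    rcases hj with hj | hj <;> simp [h0] at hj <;> exact hj
  rcases dir_cases k with rfl | rfl | rfl | rfl
  · rw [show (0 + 1 : ZMod 4) = 1 from rfl, U_zero, U_one] at h
    simp at h
    exact key (.inl h.2)
  · rw [show (1 + 1 : ZMod 4) = 2 from rfl, U_one, U_two] at h
    simp at h
    exact h.1
  · rw [show (2 + 1 : ZMod 4) = 3 from rfl, U_two, U_three] at h
    simp at h
    exact key (.inr h.2)
  · rw [show (3 + 1 : ZMod 4) = 0 from rfl, U_three, U_zero] at h
    simp at h
    exact h.1

theorem U_indep {c e : ℝ} {k : ZMod 4} (hce : c • U k + e • U (k + 1) = 0) : c = 0 ∧ e = 0 := by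
  rcases dir_cases k with rfl | rfl | rfl | rfl
  · rw [show (0 + 1 : ZMod 4) = 1 from rfl, U_zero, U_one] at hce
    simpa using hce
  · rw [show (1 + 1 : ZMod 4) = 2 from rfl, U_one, U_two] at hce
    simpa [and_comm] using hce
  · rw [show (2 + 1 : ZMod 4) = 3 from rfl, U_two, U_three] at hce
    simpa using hce
  · rw [show (3 + 1 : ZMod 4) = 0 from rfl, U_three, U_zero] at hce
    simpa [and_comm] using hce

/-- A vector in the half plane around direction `k + 1` is a multiple of a direction only if this
direction is `k + 1`. -/
theorem dir_eq_of_smul {a b x : ℝ} {k κ : ZMod 4} (hb : 0 < b) (hx : 0 < x)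
    (h : a • U k + b • U (k + 1) = x • U κ) : κ = k + 1 ∧ a = 0 := by
  obtain ⟨i, rfl⟩ : ∃ i, κ = k + i := ⟨κ - k, by ring⟩
  have hU : ∀ c e : ℝ, c • U k + e • U (k + 1) = 0 → c = 0 ∧ e = 0 := fun c e => U_indep
  rcases dir_cases i with rfl | rfl | rfl | rfl
  · have := hU (a - x) b (by rw [add_zero] at h; rw [sub_smul, sub_add_eq_add_sub, h, sub_self])
    linarith [this.2]
  · have := hU a (b - x) (by rw [sub_smul, ← add_sub_assoc, h, sub_self])
    exact ⟨rfl, this.1⟩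
  · rw [U_add_two] at h
    have := hU (a + x) b (by rw [add_smul, add_right_comm, h]; module)
    linarith [this.2]
  · rw [U_add_three] at h
    have := hU a (b + x) (by rw [add_smul, ← add_assoc, h]; module)
    linarith [this.2]

variable {n m : ℕ} {G : EmbeddedGraph n m} (D : Drawing n m)

/-- Radius and angle of a vertex. -/
def X (v : Fin n) : ℝ × ℝ := (D.radius v, D.angle v)

theorem pos_eq (v : Fin n) : D.pos v = P (D.X v) := rfl

theorem sweep_pos (a b : ℝ) : 0 < sweep a b := (toIocMod_mem_Ioc Real.two_pi_pos 0 (b - a)).1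

theorem sweep_le (a b : ℝ) : sweep a b ≤ 2 * Real.pi := by
  have := (toIocMod_mem_Ioc Real.two_pi_pos 0 (b - a)).2
  rwa [zero_add] at this

theorem sweep_eq {a b l : ℝ} (h0 : 0 < l) (h1 : l ≤ 2 * Real.pi) (j : ℤ)
    (h : b = a + l + 2 * Real.pi * j) : sweep a b = l := by
  rw [sweep, toIocMod_eq_iff]
  refine ⟨⟨h0, by simpa using h1⟩, j, ?_⟩
  rw [h, zsmul_eq_mul]; ring

/-- The length of a dart: the difference of the radii or of the angles of its ends. -/
noncomputable def len (G : EmbeddedGraph n m) (d : Fin (2 * m)) : ℝ :=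
  if D.dir d = 1 then sweep (D.angle (G.tail d)) (D.angle (G.head d))
  else if D.dir d = 3 then sweep (D.angle (G.head d)) (D.angle (G.tail d))
  else |D.radius (G.head d) - D.radius (G.tail d)|

/-- The drawing `D` is plane and realizes the angles of `R`; nothing is said about the central and
the outer face. -/
structure Draws (D : Drawing n m) (R : OrthoRep G) : Prop where
  radius_pos : ∀ v, 0 < D.radius v
  curve_one : ∀ d, D.curve G d 1 = D.pos (G.head d)
  outward : ∀ d, D.dir d = 0 → D.radius (G.tail d) < D.radius (G.head d)
  inward : ∀ d, D.dir d = 2 → D.radius (G.head d) < D.radius (G.tail d)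
  dir_rev : ∀ d, D.dir (G.rev d) = D.dir d + 2
  pos_injective : Function.Injective D.pos
  curve_ne_pos : ∀ d, ∀ t ∈ Set.Ioo (0 : ℝ) 1, ∀ v, D.curve G d t ≠ D.pos v
  curve_disjoint : ∀ d e, ∀ t ∈ Set.Ioo (0 : ℝ) 1, ∀ s ∈ Set.Ioo (0 : ℝ) 1,
    D.curve G d t = D.curve G e s → (e = d ∧ s = t) ∨ (e = G.rev d ∧ s = 1 - t)
  angles : R.Matches D.dir

variable {D} {R : OrthoRep G}

theorem Realizes.draws (h : D.Realizes R) : D.Draws R :=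
  ⟨h.radius_pos, h.curve_one, h.outward, h.inward, h.dir_rev, h.pos_injective, h.curve_ne_pos,
    h.curve_disjoint, h.angles⟩

theorem Draws.realizes (h : D.Draws R)
    (hc : ∀ d, G.face d = R.central → ∀ᶠ ε in 𝓝[>] (0 : ℝ), (0 : ℂ) ∈ D.region G (D.leftPoint G d ε))
    (ho : ∀ d, G.face d = R.outer →
      ∀ᶠ ε in 𝓝[>] (0 : ℝ), ¬ Bornology.IsBounded (D.region G (D.leftPoint G d ε))) :
    D.Realizes R :=
  ⟨h.radius_pos, h.curve_one, h.outward, h.inward, h.dir_rev, h.pos_injective, h.curve_ne_pos,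
    h.curve_disjoint, h.angles, hc, ho⟩

namespace Draws

variable (h : D.Draws R)
include h

theorem len_pos (d : Fin (2 * m)) : 0 < D.len G d := by
  unfold len
  split_ifs with h1 h3
  · exact sweep_pos _ _
  · exact sweep_pos _ _
  · rcases dir_cases (D.dir d) with h0 | h0 | h0 | h0
    · exact abs_pos.2 (sub_pos.2 (h.outward d h0)).ne'
    · exact absurd h0 h1
    · exact abs_pos.2 (sub_neg.2 (h.inward d h0)).ne
    · exact absurd h0 h3

omit h in
theorem len_le_of_odd (D : Drawing n m) {d : Fin (2 * m)} (hd : D.dir d = 1 ∨ D.dir d = 3) :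
    D.len G d ≤ 2 * Real.pi := by
  unfold len
  split_ifs with h1 h3
  · exact sweep_le _ _
  · exact sweep_le _ _
  · tauto

theorem len_rev (d : Fin (2 * m)) : D.len G (G.rev d) = D.len G d := by
  unfold len
  rw [h.dir_rev, G.head_rev, G.tail_rev]
  rcases dir_cases (D.dir d) with h0 | h0 | h0 | h0 <;> rw [h0]
  · rw [if_neg (by decide), if_neg (by decide), if_neg (by decide), if_neg (by decide),
      abs_sub_comm]
  · rw [if_neg (by decide), if_pos (by decide), if_pos (by decide)]
  · rw [if_neg (by decide), if_neg (by decide), if_neg (by decide), if_neg (by decide),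
      abs_sub_comm]
  · rw [if_pos (by decide), if_neg (by decide), if_pos (by decide)]

/-- All curves are straight in the plane of radius and angle. -/
theorem curve_eq (d : Fin (2 * m)) (t : ℝ) :
    D.curve G d t = P (D.X (G.tail d) + (t * D.len G d) • U (D.dir d)) := by
  unfold curve len P X
  rcases dir_cases (D.dir d) with h0 | h0 | h0 | h0
  · have h1 := h.outward d h0
    rw [h0, if_neg (by decide), if_neg (by decide), if_neg (by decide), if_neg (by decide),
      U_zero, abs_of_pos (sub_pos.2 h1)]
    simp only [Prod.smul_mk, Prod.mk_add_mk, smul_eq_mul, mul_one, mul_zero, add_zero]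
    congr 1; ring
  · rw [if_pos h0, if_pos h0, h0, U_one]
    simp
  · have h1 := h.inward d h0
    rw [h0, if_neg (by decide), if_neg (by decide), if_neg (by decide), if_neg (by decide),
      U_two, abs_of_neg (sub_neg.2 h1)]
    simp only [Prod.smul_mk, Prod.mk_add_mk, smul_eq_mul, mul_zero, add_zero]
    congr 1; ring
  · rw [h0, if_neg (by decide), if_pos rfl, if_neg (by decide), if_pos rfl, U_three]
    simp only [Prod.smul_mk, Prod.mk_add_mk, smul_eq_mul, mul_zero, add_zero]
    congr 1; ring

theorem lt_curve_radius (d : Fin (2 * m)) {c x : ℝ} (hx : x ∈ Set.Icc 0 (D.len G d))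
    (h1 : c < D.radius (G.tail d)) (h2 : c < D.radius (G.head d)) :
    c < (D.X (G.tail d) + x • U (D.dir d)).1 := by
  rcases dir_cases (D.dir d) with h0 | h0 | h0 | h0
  · simp only [h0, U_zero, X, Prod.fst_add, Prod.smul_mk, smul_eq_mul]
    linarith [hx.1]
  · simp only [h0, U_one, X, Prod.fst_add, Prod.smul_mk, smul_eq_mul]
    linarith
  · have h3 := h.inward d h0
    have h4 : D.len G d = D.radius (G.tail d) - D.radius (G.head d) := by
      unfold len
      rw [h0, if_neg (by decide), if_neg (by decide), abs_of_neg (sub_neg.2 h3)]; ring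
    simp only [h0, U_two, X, Prod.fst_add, Prod.smul_mk, smul_eq_mul]
    linarith [hx.2]
  · simp only [h0, U_three, X, Prod.fst_add, Prod.smul_mk, smul_eq_mul]
    linarith

theorem curve_radius_pos (d : Fin (2 * m)) {x : ℝ} (hx : x ∈ Set.Icc 0 (D.len G d)) :
    0 < (D.X (G.tail d) + x • U (D.dir d)).1 :=
  h.lt_curve_radius d hx (h.radius_pos _) (h.radius_pos _)

theorem X_head (d : Fin (2 * m)) : ∃ j : ℤ,
    D.X (G.tail d) + D.len G d • U (D.dir d) = D.X (G.head d) + (0, 2 * Real.pi * j) := by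
  have h1 := h.curve_one d
  rw [h.curve_eq, one_mul, pos_eq] at h1
  exact (P_eq_iff (h.curve_radius_pos d ⟨(h.len_pos d).le, le_rfl⟩) (h.radius_pos _)).1 h1

theorem curve_zero (d : Fin (2 * m)) : D.curve G d 0 = D.pos (G.tail d) := by
  rw [h.curve_eq]; simp [pos_eq]

/-- A point near the head of a dart, in coordinates relative to the head. -/
theorem P_head (d : Fin (2 * m)) (y : ℝ × ℝ) :
    P (D.X (G.tail d) + D.len G d • U (D.dir d) + y) = P (D.X (G.head d) + y) := by
  obtain ⟨j, hj⟩ := h.X_head d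
  rw [hj, add_right_comm, P_add_period]

theorem curve_rev (d : Fin (2 * m)) (t : ℝ) : D.curve G (G.rev d) t = D.curve G d (1 - t) := by
  rw [h.curve_eq, h.curve_eq, h.len_rev, h.dir_rev, U_add_two, G.tail_rev, ← h.P_head]
  congr 1; module

theorem continuous_curve (d : Fin (2 * m)) : Continuous (D.curve G d) := by
  have : D.curve G d = fun t => P (D.X (G.tail d) + (t * D.len G d) • U (D.dir d)) :=
    funext fun t => h.curve_eq d t
  rw [this]
  exact continuous_P.comp (by fun_prop)

theorem isCompact_image : IsCompact (D.image G) :=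
  (Set.finite_range _).isCompact.union (isCompact_iUnion fun d =>
    isCompact_Icc.image (h.continuous_curve d))

/-- A point on a curve, given by its distance from the tail. -/
theorem P_eq_curve (d : Fin (2 * m)) (x : ℝ) :
    P (D.X (G.tail d) + x • U (D.dir d)) = D.curve G d (x / D.len G d) := by
  rw [h.curve_eq, div_mul_cancel₀ _ (h.len_pos d).ne']

theorem div_mem {d : Fin (2 * m)} {x : ℝ} (hx : x ∈ Set.Ioo 0 (D.len G d)) :
    x / D.len G d ∈ Set.Ioo (0 : ℝ) 1 :=
  ⟨div_pos hx.1 (h.len_pos d), (div_lt_one (h.len_pos d)).2 hx.2⟩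

/-! ### Regions beside an edge -/

omit h in
theorem region_eq {A : Set ℂ} (hA : IsPreconnected A) (hAc : A ⊆ (D.image G)ᶜ) {p q : ℂ}
    (hp : p ∈ A) (hq : q ∈ A) : D.region G p = D.region G q :=
  connectedComponentIn_eq (hA.subset_connectedComponentIn hp hAc hq)

/-- Directly to the left of the inner part of a dart there is nothing of the drawing. -/
theorem exists_tube (d : Fin (2 * m)) {x₀ x₁ : ℝ} (h0 : 0 < x₀) (h1 : x₁ < D.len G d) :
    ∃ η > (0 : ℝ), ∀ x ∈ Set.Icc x₀ x₁, ∀ β ∈ Set.Ioo 0 η,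
      P (D.X (G.tail d) + x • U (D.dir d) + β • U (D.dir d + 1)) ∉ D.image G := by
  -- `C` is the drawing without the edge of `d`; it has a positive distance to the compact set `K`.
  set C : Set ℂ := Set.range D.pos ∪ ⋃ e ∈ {e | e ≠ d ∧ e ≠ G.rev d}, D.curve G e '' Set.Icc 0 1
    with hC
  have hCc : IsClosed C := by
    refine ((Set.finite_range _).isClosed).union (Set.Finite.isClosed_biUnion (Set.toFinite _) ?_)
    exact fun e _ => (isCompact_Icc.image (h.continuous_curve e)).isClosed
  set K := (fun x : ℝ => D.X (G.tail d) + x • U (D.dir d)) '' Set.Icc x₀ x₁ with hK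
  have hKc : IsCompact K := isCompact_Icc.image (by fun_prop)
  have hopen : IsOpen (P ⁻¹' Cᶜ ∩ {y : ℝ × ℝ | 0 < y.1}) :=
    (hCc.isOpen_compl.preimage continuous_P).inter (isOpen_lt continuous_const continuous_fst)
  have hsub : K ⊆ P ⁻¹' Cᶜ ∩ {y : ℝ × ℝ | 0 < y.1} := by
    rintro y ⟨x, hx, rfl⟩
    have hx' : x ∈ Set.Ioo 0 (D.len G d) := ⟨h0.trans_le hx.1, hx.2.trans_lt h1⟩
    refine ⟨?_, h.curve_radius_pos d ⟨hx'.1.le, hx'.2.le⟩⟩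
    have ht := h.div_mem hx'
    simp only [Set.mem_preimage, Set.mem_compl_iff, h.P_eq_curve, hC, Set.mem_union, not_or]
    refine ⟨?_, ?_⟩
    · rintro ⟨v, hv⟩
      exact h.curve_ne_pos d _ ht v hv.symm
    · simp only [Set.mem_iUnion, not_exists]
      rintro e he ⟨s, hs, hes⟩
      rcases eq_or_lt_of_le hs.1 with rfl | hs0
      · rw [h.curve_zero] at hes
        exact h.curve_ne_pos d _ ht _ hes.symm
      rcases eq_or_lt_of_le hs.2 with rfl | hs1
      · rw [h.curve_one] at hes
        exact h.curve_ne_pos d _ ht _ hes.symm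
      rcases h.curve_disjoint d e _ ht s ⟨hs0, hs1⟩ hes.symm with h' | h'
      · exact he.1 h'.1
      · exact he.2 h'.1
  obtain ⟨δ, hδ, hδK⟩ := hKc.exists_thickening_subset_open hopen hsub
  refine ⟨min δ 1, lt_min hδ one_pos, fun x hx β hβ => ?_⟩
  have hy := hδK (Metric.mem_thickening_iff.2 ⟨D.X (G.tail d) + x • U (D.dir d), ⟨x, hx, rfl⟩, by
    rw [dist_eq_norm, add_sub_cancel_left, norm_smul, norm_U, mul_one, Real.norm_of_nonneg hβ.1.le]
    exact hβ.2.trans_le (min_le_left _ _)⟩ :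
      D.X (G.tail d) + x • U (D.dir d) + β • U (D.dir d + 1) ∈ Metric.thickening δ K)
  have hβ1 : β < 1 := hβ.2.trans_le (min_le_right _ _)
  -- The edge of `d` itself does not return to the tube, since its breadth is less than the period.
  have hown : ∀ t ∈ Set.Icc (0 : ℝ) 1, D.curve G d t ≠
      P (D.X (G.tail d) + x • U (D.dir d) + β • U (D.dir d + 1)) := by
    intro t ht heq
    rw [h.curve_eq, eq_comm, P_eq_iff hy.2 (h.curve_radius_pos d
      ⟨mul_nonneg ht.1 (h.len_pos d).le, mul_le_of_le_one_left (h.len_pos d).le ht.2⟩)] at heq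
    obtain ⟨j, hj⟩ := heq
    have h2 : (x - t * D.len G d) • U (D.dir d) + β • U (D.dir d + 1) = (0, 2 * Real.pi * j) := by
      have := congrArg (fun y => y - (D.X (G.tail d) + (t * D.len G d) • U (D.dir d))) hj
      simp only [add_sub_cancel_left] at this
      rw [← this]; module
    exact hβ.1.ne' (coeff_eq_zero h2 (by rwa [abs_of_pos hβ.1]))
  rintro (hv | hcurve)
  · exact hy.1 (.inl hv)
  · simp only [Set.mem_iUnion] at hcurve
    obtain ⟨e, t, ht, hte⟩ := hcurve
    by_cases he : e = d
    · subst he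
      exact hown t ht hte
    by_cases he' : e = G.rev d
    · subst he'
      rw [h.curve_rev] at hte
      exact hown _ ⟨by linarith [ht.2], by linarith [ht.1]⟩ hte
    · exact hy.1 (.inr (Set.mem_biUnion (x := e) ⟨he, he'⟩ ⟨t, ht, hte⟩))

omit h in
/-- Left points are close to the midpoint and to its left. -/
theorem leftPoint_near (D : Drawing n m) (d : Fin (2 * m)) {y : ℝ × ℝ} (hy0 : 0 < y.1)
    (hy : D.curve G d (1 / 2) = P y) {η : ℝ} (hη : 0 < η) : ∀ᶠ ε in 𝓝[>] (0 : ℝ),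
      ∃ α β, |α| < η ∧ β ∈ Set.Ioo 0 η ∧
        D.leftPoint G d ε = P (y + α • U (D.dir d) + β • U (D.dir d + 1)) := by
  -- A left point of a radial dart lies on the tangent of the circle, so that its radius changes a
  -- little, by `α`; for a dart along a circle it lies on the ray and `α = 0`.
  have hunit : P y / ‖P y‖ = Complex.exp (y.2 * Complex.I) := by
    rw [norm_P y hy0, P, polar, mul_div_cancel_left₀]
    exact_mod_cast hy0.ne'
  have hleft : ∀ ε : ℝ, D.leftPoint G d ε =
      Complex.exp (y.2 * Complex.I) * (y.1 + ε * Complex.I ^ ((D.dir d).val + 1)) := by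
    intro ε
    rw [leftPoint, hy, hunit, P, polar]; ring
  have hcont : ∀ σ : ℝ, Tendsto (fun ε : ℝ => (y.1 : ℂ) + ε * (σ * Complex.I)) (𝓝[>] 0) (𝓝 (y.1 : ℂ)) := by
    intro σ
    have : Continuous fun ε : ℝ => (y.1 : ℂ) + ε * (σ * Complex.I) := by fun_prop
    have h2 := this.tendsto 0
    simp only [Complex.ofReal_zero, zero_mul, add_zero] at h2
    exact h2.mono_left nhdsWithin_le_nhds
  have hslit : (y.1 : ℂ) ∈ Complex.slitPlane := by simp [hy0]
  have hnorm : ∀ σ : ℝ, ∀ᶠ ε : ℝ in 𝓝[>] (0 : ℝ), |‖(y.1 : ℂ) + ε * (σ * Complex.I)‖ - y.1| < η := by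
    intro σ
    have h1 := ((continuous_norm.tendsto _).comp (hcont σ))
    rw [Complex.norm_real, Real.norm_of_nonneg hy0.le] at h1
    have := h1 (Metric.ball_mem_nhds _ hη)
    filter_upwards [this] with ε hε
    simpa [Real.dist_eq] using hε
  have harg : ∀ σ : ℝ, ∀ᶠ ε : ℝ in 𝓝[>] (0 : ℝ), |((y.1 : ℂ) + ε * (σ * Complex.I)).arg| < η := by
    intro σ
    have h1 := (Complex.continuousAt_arg hslit).tendsto.comp (hcont σ)
    rw [Complex.arg_ofReal_of_nonneg hy0.le] at h1
    have := h1 (Metric.ball_mem_nhds _ hη)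
    filter_upwards [this] with ε hε
    simpa [Real.dist_eq] using hε
  have hpolar : ∀ z : ℂ, Complex.exp (y.2 * Complex.I) * z = P (‖z‖, y.2 + z.arg) := by
    intro z
    rw [P, polar]
    push_cast
    rw [add_mul, Complex.exp_add]
    conv_lhs => rw [← Complex.norm_mul_exp_arg_mul_I z]
    ring
  have hpos : ∀ᶠ ε in 𝓝[>] (0 : ℝ), 0 < ε := eventually_mem_nhdsWithin
  rcases dir_cases (D.dir d) with h0 | h0 | h0 | h0
  · filter_upwards [hnorm 1, harg 1, hpos] with ε h1 h2 h3
    refine ⟨_, _, h1, ⟨?_, (le_abs_self _).trans_lt h2⟩, ?_⟩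
    · refine lt_of_le_of_ne (Complex.arg_nonneg_iff.2 (by simpa using h3.le)) fun h4 => ?_
      have := (Complex.arg_eq_zero_iff.1 h4.symm).2
      simp at this
      exact h3.ne' this
    · rw [hleft, h0, show (0 + 1 : ZMod 4) = 1 from rfl, U_zero, U_one,
        show (0 : ZMod 4).val + 1 = 1 from rfl, pow_one, hpolar]
      congr 1
      ext <;> simp
  · filter_upwards [hpos, Ioo_mem_nhdsGT hη, Ioo_mem_nhdsGT hy0] with ε h3 h4 h5
    refine ⟨0, ε, by simpa using hη, ⟨h3, h4.2⟩, ?_⟩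
    rw [hleft, h0, show (1 + 1 : ZMod 4) = 2 from rfl, U_one, U_two,
        show (1 : ZMod 4).val + 1 = 2 from rfl, Complex.I_sq, P, polar]
    simp
    ring
  · filter_upwards [hnorm (-1), harg (-1), hpos] with ε h1 h2 h3
    refine ⟨-(‖(y.1 : ℂ) + ε * ((-1 : ℝ) * Complex.I)‖ - y.1), -_, by rwa [abs_neg],
      ⟨?_, (neg_le_abs _).trans_lt h2⟩, ?_⟩
    · exact neg_pos.2 (Complex.arg_neg_iff.2 (by simpa using h3))
    · rw [hleft, h0, show (2 + 1 : ZMod 4) = 3 from rfl, U_two, U_three,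
        show (2 : ZMod 4).val + 1 = 3 from rfl, Complex.I_pow_three,
        show -Complex.I = ((-1 : ℝ) : ℂ) * Complex.I by simp, hpolar]
      congr 1
      ext <;> simp
  · filter_upwards [hpos, Ioo_mem_nhdsGT hη] with ε h3 h4
    refine ⟨0, ε, by simpa using hη, ⟨h3, h4.2⟩, ?_⟩
    rw [hleft, h0, show (3 + 1 : ZMod 4) = 0 from rfl, U_three, U_zero,
        show (3 : ZMod 4).val + 1 = 4 from rfl, Complex.I_pow_four, P, polar]
    simp
    ring

theorem curve_half (d : Fin (2 * m)) : D.curve G d (1 / 2) =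
    P (D.X (G.tail d) + (D.len G d / 2) • U (D.dir d)) := by
  rw [h.curve_eq]; congr 3; ring

/-- All points directly to the left of a dart lie in the same region as its left points. -/
theorem region_leftPoint (d : Fin (2 * m)) {x : ℝ} (hx : x ∈ Set.Ioo 0 (D.len G d)) :
    ∃ η > (0 : ℝ), ∀ β ∈ Set.Ioo 0 η, ∀ᶠ ε in 𝓝[>] (0 : ℝ), D.region G (D.leftPoint G d ε) =
      D.region G (P (D.X (G.tail d) + x • U (D.dir d) + β • U (D.dir d + 1))) := by
  have hl := h.len_pos d
  set l := D.len G d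
  obtain ⟨η, hη, htube⟩ := h.exists_tube d (x₀ := min x (l / 4)) (x₁ := max x (3 * l / 4))
    (lt_min hx.1 (by linarith)) (max_lt hx.2 (by linarith))
  refine ⟨η, hη, fun β hβ => ?_⟩
  have hrad := h.curve_radius_pos d (x := l / 2) ⟨by linarith, by linarith⟩
  filter_upwards [leftPoint_near D d hrad (h.curve_half d) (lt_min hη (show 0 < l / 4 by linarith))]
    with ε ⟨α, β', hα, hβ', hε⟩
  rw [hε]
  set A := (fun z : ℝ × ℝ => P (D.X (G.tail d) + z.1 • U (D.dir d) + z.2 • U (D.dir d + 1))) ''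
    (Set.Icc (min x (l / 4)) (max x (3 * l / 4)) ×ˢ Set.Ioo 0 η) with hA
  have hAc : IsPreconnected A :=
    (isPreconnected_Icc.prod isPreconnected_Ioo).image _
      (continuous_P.comp (by fun_prop)).continuousOn
  refine region_eq hAc ?_ ⟨(l / 2 + α, β'), ⟨?_, hβ'.1, hβ'.2.trans_le (min_le_left _ _)⟩, ?_⟩
    ⟨(x, β), ⟨⟨min_le_left _ _, le_max_left _ _⟩, hβ⟩, rfl⟩
  · rintro _ ⟨z, hz, rfl⟩
    exact htube _ hz.1 _ hz.2
  · have h1 := abs_lt.1 (hα.trans_le (min_le_right _ _))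
    exact ⟨(min_le_right _ _).trans (by linarith [h1.1]),
      (show l / 2 + α ≤ 3 * l / 4 by linarith [h1.2]).trans (le_max_right _ _)⟩
  · beta_reduce
    rw [add_smul, ← add_assoc]

end Draws

end Drawing

/-! ### Regions around a vertex -/

namespace Drawing

open Filter Topology

namespace Draws

variable {n m : ℕ} {G : EmbeddedGraph n m} {D : Drawing n m} {R : OrthoRep G}
variable (h : D.Draws R)
include h

/-- Every point of a curve lies on the first half of one of the two darts of its edge. -/
theorem mem_image_iff (p : ℂ) : p ∈ D.image G ↔
    (∃ v, D.pos v = p) ∨ ∃ e, ∃ t ∈ Set.Icc (0 : ℝ) (1 / 2), D.curve G e t = p := by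
  constructor
  · rintro (hv | hc)
    · exact .inl hv
    · simp only [Set.mem_iUnion] at hc
      obtain ⟨e, t, ht, hte⟩ := hc
      right
      rcases le_total t (1 / 2) with h1 | h1
      · exact ⟨e, t, ⟨ht.1, h1⟩, hte⟩
      · refine ⟨G.rev e, 1 - t, ⟨by linarith [ht.2], by linarith⟩, ?_⟩
        rw [h.curve_rev, sub_sub_cancel, hte]
  · rintro (hv | ⟨e, t, ht, hte⟩)
    · exact .inl hv
    · exact .inr (Set.mem_iUnion.2 ⟨e, t, ⟨ht.1, ht.2.trans (by norm_num)⟩, hte⟩)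

/-- Near a vertex the drawing consists of the vertex and of rays in the directions of its darts. -/
theorem exists_star (w : Fin n) : ∃ η > (0 : ℝ), ∀ y : ℝ × ℝ, ‖y‖ < η →
    P (D.X w + y) ∈ D.image G →
      y = 0 ∨ ∃ e, G.tail e = w ∧ ∃ x > (0 : ℝ), y = x • U (D.dir e) := by
  -- `C` consists of the other vertices and of the half-edges that start at them; every other point
  -- of the drawing lies on a half-edge that starts at `w`.
  set C : Set ℂ := D.pos '' {v | v ≠ w} ∪
    ⋃ e ∈ {e | G.tail e ≠ w}, D.curve G e '' Set.Icc 0 (1 / 2) with hC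
  have hCc : IsClosed C := by
    refine ((Set.toFinite _).isClosed).union (Set.Finite.isClosed_biUnion (Set.toFinite _) ?_)
    exact fun e _ => (isCompact_Icc.image (h.continuous_curve e)).isClosed
  have hopen : IsOpen (P ⁻¹' Cᶜ ∩ {y : ℝ × ℝ | 0 < y.1}) :=
    (hCc.isOpen_compl.preimage continuous_P).inter (isOpen_lt continuous_const continuous_fst)
  have hw : D.X w ∈ P ⁻¹' Cᶜ ∩ {y : ℝ × ℝ | 0 < y.1} := by
    refine ⟨?_, h.radius_pos w⟩
    simp only [Set.mem_preimage, Set.mem_compl_iff, ← pos_eq, hC, Set.mem_union, not_or]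
    refine ⟨?_, ?_⟩
    · rintro ⟨v, hv, hvw⟩
      exact hv (h.pos_injective hvw)
    · simp only [Set.mem_iUnion, not_exists]
      rintro e he ⟨s, hs, hes⟩
      rcases eq_or_lt_of_le hs.1 with rfl | hs0
      · rw [h.curve_zero] at hes
        exact he (h.pos_injective hes)
      · exact h.curve_ne_pos e s ⟨hs0, hs.2.trans_lt (by norm_num)⟩ w hes
  obtain ⟨η, hη, hball⟩ := Metric.isOpen_iff.1 hopen _ hw
  refine ⟨min η 1, lt_min hη one_pos, fun y hy himg => ?_⟩
  have hpi := Real.pi_gt_three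
  have hmem := hball (by
    rw [Metric.mem_ball, dist_eq_norm, add_sub_cancel_left]
    exact hy.trans_le (min_le_left _ _) : D.X w + y ∈ Metric.ball (D.X w) η)
  have hy1 : ‖y‖ < 1 := hy.trans_le (min_le_right _ _)
  have hy2 : |y.2| < 1 := (norm_snd_le y).trans_lt hy1
  have hsmall : ∀ j : ℤ, |2 * Real.pi * j| < 2 * Real.pi → j = 0 := by
    intro j hj
    by_contra hne
    have h1 : (1 : ℝ) ≤ |(j : ℝ)| := by exact_mod_cast Int.one_le_abs hne
    rw [abs_mul, abs_of_pos Real.two_pi_pos] at hj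
    nlinarith
  rcases (h.mem_image_iff _).1 himg with ⟨v, hv⟩ | ⟨e, t, ht, hte⟩
  · have hvw : v = w := by
      by_contra hne
      exact hmem.1 (.inl ⟨v, hne, hv⟩)
    subst hvw
    rw [pos_eq, eq_comm, P_eq_iff hmem.2 (h.radius_pos v)] at hv
    obtain ⟨j, hj⟩ := hv
    have hj' := add_left_cancel hj
    have h0 : j = 0 := by
      apply hsmall
      rw [hj'] at hy2
      simp only at hy2
      linarith
    left
    rw [hj', h0]; simp
  · have hew : G.tail e = w := by
      by_contra hne
      exact hmem.1 (.inr (Set.mem_biUnion (x := e) hne ⟨t, ht, hte⟩))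
    have hl := h.len_pos e
    have htl : t * D.len G e ∈ Set.Icc 0 (D.len G e) :=
      ⟨mul_nonneg ht.1 hl.le, mul_le_of_le_one_left hl.le (ht.2.trans (by norm_num))⟩
    rw [h.curve_eq, eq_comm, P_eq_iff hmem.2 (h.curve_radius_pos e htl), hew] at hte
    obtain ⟨j, hj⟩ := hte
    rw [add_assoc] at hj
    have hj' := add_left_cancel hj
    have h0 : j = 0 := by
      apply hsmall
      have h2 := congrArg Prod.snd hj'
      rcases dir_cases (D.dir e) with h0 | h0 | h0 | h0
      · rw [h0, U_zero] at h2
        simp at h2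
        rw [← h2]; linarith
      · have h3 := len_le_of_odd (G := G) D (.inl h0)
        rw [h0, U_one] at h2
        simp at h2
        have h4 : t * D.len G e ≤ Real.pi := by nlinarith [ht.1, ht.2]
        rw [abs_lt] at hy2 ⊢
        constructor <;> linarith [htl.1]
      · rw [h0, U_two] at h2
        simp at h2
        rw [← h2]; linarith
      · have h3 := len_le_of_odd (G := G) D (.inr h0)
        rw [h0, U_three] at h2
        simp at h2
        have h4 : t * D.len G e ≤ Real.pi := by nlinarith [ht.1, ht.2]
        rw [abs_lt] at hy2 ⊢
        constructor <;> linarith [htl.1]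
    rw [h0, Int.cast_zero, mul_zero, show ((0 : ℝ), (0 : ℝ)) = 0 from rfl, add_zero] at hj'
    rcases eq_or_lt_of_le htl.1 with h3 | h3
    · left; rw [hj', ← h3, zero_smul]
    · exact .inr ⟨e, hew, _, h3, hj'⟩

omit h in
theorem norm_smul_U_add (a b : ℝ) (k : ZMod 4) :
    ‖a • U k + b • U (k + 1)‖ = max |a| |b| := by
  rcases dir_cases k with rfl | rfl | rfl | rfl
  · rw [show (0 + 1 : ZMod 4) = 1 from rfl, U_zero, U_one]
    simp [Prod.norm_def]
  · rw [show (1 + 1 : ZMod 4) = 2 from rfl, U_one, U_two]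
    simp [Prod.norm_def, max_comm]
  · rw [show (2 + 1 : ZMod 4) = 3 from rfl, U_two, U_three]
    simp [Prod.norm_def]
  · rw [show (3 + 1 : ZMod 4) = 0 from rfl, U_three, U_zero]
    simp [Prod.norm_def, max_comm]

/-- The points in a corner at the vertex `tail f` between `f` and `next f`, close to the vertex, lie
in one region. -/
theorem region_corner (f : Fin (2 * m)) : ∃ η > (0 : ℝ), ∃ S : Set ℂ, ∀ i < R.turn f,
    ∀ a ∈ Set.Ioo 0 η, ∀ b ∈ Set.Ioo 0 η, D.region G (P (D.X (G.tail f) +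
      (a • U (D.dir f + i) + b • U (D.dir f + i + 1)))) = S := by
  obtain ⟨η, hη, hstar⟩ := h.exists_star (G.tail f)
  have hη2 : η / 2 ∈ Set.Ioo 0 η := ⟨by linarith, by linarith⟩
  -- A half disc around a direction without darts, and any quadrant, avoids the drawing.
  have hbox : ∀ (I : Set ℝ) (k : ZMod 4), (∀ a ∈ I, |a| < η) → I.OrdConnected →
      ((∀ a ∈ I, a ≠ 0) ∨ ∀ e, G.tail e = G.tail f → D.dir e ≠ k + 1) →
      ∀ a ∈ I, ∀ b ∈ Set.Ioo 0 η, ∀ a' ∈ I, ∀ b' ∈ Set.Ioo 0 η,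
      D.region G (P (D.X (G.tail f) + (a • U k + b • U (k + 1)))) =
      D.region G (P (D.X (G.tail f) + (a' • U k + b' • U (k + 1)))) := by
    intro I k hI hIc hk a ha b hb a' ha' b' hb'
    refine region_eq (A := (fun z : ℝ × ℝ => P (D.X (G.tail f) + (z.1 • U k + z.2 • U (k + 1)))) ''
      (I ×ˢ Set.Ioo 0 η)) ?_ ?_ ⟨(a, b), ⟨ha, hb⟩, rfl⟩ ⟨(a', b'), ⟨ha', hb'⟩, rfl⟩
    · exact (hIc.isPreconnected.prod isPreconnected_Ioo).image _
        (continuous_P.comp (by fun_prop)).continuousOn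
    · rintro _ ⟨z, hz, rfl⟩ himg
      have hz2 : |z.2| < η := by rw [abs_of_pos hz.2.1]; exact hz.2.2
      rcases hstar _ ((norm_smul_U_add _ _ k).trans_lt (max_lt (hI _ hz.1) hz2)) himg with h0 | ⟨e, he, x, hx, hxe⟩
      · have := coeff_eq_zero (a := z.1 / (2 * η)) (b := z.2 / (2 * η)) (k := k) (j := 0) (by
          simp only [div_eq_inv_mul, mul_smul, ← smul_add]
          rw [h0, smul_zero, Int.cast_zero, mul_zero]; rfl) (by
          rw [abs_div, abs_of_pos (show 0 < 2 * η by linarith), div_lt_one (by linarith)]; linarith)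
        rcases div_eq_zero_iff.1 this with h1 | h1
        · exact hz.2.1.ne' h1
        · linarith
      · obtain ⟨h1, h2⟩ := dir_eq_of_smul hz.2.1 hx hxe
        rcases hk with hk | hk
        · exact hk _ hz.1 h2
        · exact hk e he h1
  refine ⟨η, hη, D.region G (P (D.X (G.tail f) +
      ((η / 2) • U (D.dir f) + (η / 2) • U (D.dir f + 1)))), fun i hi => ?_⟩
  have hIoo : ∀ a ∈ Set.Ioo 0 η, |a| < η := fun a ha => by rw [abs_of_pos ha.1]; exact ha.2
  induction i with
  | zero =>
    intro a ha b hb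
    rw [Nat.cast_zero, add_zero]
    exact hbox (Set.Ioo 0 η) _ hIoo Set.ordConnected_Ioo (.inl fun a ha => ha.1.ne') a ha b hb _
      hη2 _ hη2
  -- Two neighbouring quadrants of the corner are connected across the direction between them.
  | succ i ih =>
    intro a ha b hb
    rw [← ih (by omega) b hb a ha, show D.dir f + ((i + 1 : ℕ) : ZMod 4) = D.dir f + i + 1 by
      push_cast; ring, U_add_two_smul]
    refine hbox (Set.Ioo (-η) η) _ (fun a ha => abs_lt.2 ha) Set.ordConnected_Ioo (.inr ?_)
      _ ⟨by linarith [hb.2], by linarith [hb.1, hη]⟩ _ ha _ ⟨by linarith [hb.1], hb.2⟩ _ ha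
    intro e he
    have := (h.angles f).2 (i + 1) (Nat.succ_pos i) hi e he
    rwa [Nat.cast_succ, ← add_assoc] at this

/-- The face traversal does not change the region on the left. -/
theorem region_facePerm (e : Fin (2 * m)) : ∃ S : Set ℂ,
    (∀ᶠ ε in 𝓝[>] (0 : ℝ), D.region G (D.leftPoint G e ε) = S) ∧
    ∀ᶠ ε in 𝓝[>] (0 : ℝ), D.region G (D.leftPoint G (G.facePerm e) ε) = S := by
  set f := G.facePerm e with hf
  obtain ⟨η, hη, S, hS⟩ := h.region_corner f
  have hle := h.len_pos e
  have hlf := h.len_pos f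
  have hτ := R.turn_pos f
  have hμe := lt_min hη hle
  have hμf := lt_min hη hlf
  -- The left of `e` is followed until shortly before the head of `e`, that of `f` from shortly
  -- after its tail; both end in the corner between `f` and `next f = rev e`.
  set xe := min η (D.len G e) / 2 with hxe
  set xf := min η (D.len G f) / 2 with hxf
  have hxe' : xe ∈ Set.Ioo 0 η := ⟨by positivity, by
    have := min_le_left η (D.len G e); linarith⟩
  have hxf' : xf ∈ Set.Ioo 0 η := ⟨by positivity, by
    have := min_le_left η (D.len G f); linarith⟩
  have hxe2 : xe < D.len G e := by
    have := min_le_right η (D.len G e); linarith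
  have hxf2 : xf < D.len G f := by
    have := min_le_right η (D.len G f); linarith
  obtain ⟨ηe, hηe, hE⟩ := h.region_leftPoint e (x := D.len G e - xe)
    ⟨by linarith, by linarith [hxe'.1]⟩
  obtain ⟨ηf, hηf, hF⟩ := h.region_leftPoint f (x := xf) ⟨hxf'.1, hxf2⟩
  have hβe := lt_min hη hηe
  have hβf := lt_min hη hηf
  refine ⟨S, ?_, ?_⟩
  · have hβ : min η ηe / 2 ∈ Set.Ioo 0 η :=
      ⟨by positivity, by have := min_le_left η ηe; linarith⟩
    filter_upwards [hE (min η ηe / 2) ⟨by positivity, by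
      have := min_le_right η ηe; linarith⟩] with ε hε
    rw [hε, ← hS (R.turn f - 1) (by omega) _ hβ _ hxe']
    congr 1
    rw [show D.X (G.tail e) + (D.len G e - xe) • U (D.dir e) + (min η ηe / 2) • U (D.dir e + 1) =
      D.X (G.tail e) + D.len G e • U (D.dir e) + ((min η ηe / 2) • U (D.dir e + 1) +
        (-xe) • U (D.dir e)) by module, h.P_head, ← G.tail_facePerm, ← hf]
    have h1 := (h.angles f).1
    rw [hf, G.next_facePerm, h.dir_rev, ← hf] at h1
    have h2 : D.dir f + ((R.turn f - 1 : ℕ) : ZMod 4) = D.dir e + 1 := by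
      rw [Nat.cast_sub (by omega)]; push_cast; linear_combination -h1
    rw [h2, show D.dir e + 1 + 1 = D.dir e + 2 by ring, U_add_two, smul_neg, neg_smul]
  · have hβ : min η ηf / 2 ∈ Set.Ioo 0 η :=
      ⟨by positivity, by have := min_le_left η ηf; linarith⟩
    filter_upwards [hF (min η ηf / 2) ⟨by positivity, by
      have := min_le_right η ηf; linarith⟩] with ε hε
    rw [hε, ← hS 0 hτ _ hxf' _ hβ, Nat.cast_zero, add_zero, add_assoc]

/-- Darts of the same face have the same region on their left. -/
theorem region_face (Q : Set ℂ → Prop) {d e : Fin (2 * m)} (hde : G.face d = G.face e)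
    (hd : ∀ᶠ ε in 𝓝[>] (0 : ℝ), Q (D.region G (D.leftPoint G d ε))) :
    ∀ᶠ ε in 𝓝[>] (0 : ℝ), Q (D.region G (D.leftPoint G e ε)) := by
  refine (G.face_induction (p := fun e =>
    ∀ᶠ ε in 𝓝[>] (0 : ℝ), Q (D.region G (D.leftPoint G e ε))) (fun e => ?_) hde).1 hd
  obtain ⟨S, h1, h2⟩ := h.region_facePerm e
  have key : ∀ {g : ℝ → Set ℂ}, (∀ᶠ ε in 𝓝[>] (0 : ℝ), g ε = S) →
      ((∀ᶠ ε in 𝓝[>] (0 : ℝ), Q (g ε)) ↔ Q S) := by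
    intro g hg
    rw [eventually_congr (hg.mono fun ε hε => by rw [hε] : ∀ᶠ ε in 𝓝[>] (0 : ℝ), Q (g ε) ↔ Q S)]
    exact eventually_const
  rw [key h1, key h2]

end Draws

end Drawing

namespace Drawing

open Filter Topology

variable {n m : ℕ} {G : EmbeddedGraph n m} {R : OrthoRep G}

/-! ### A criterion for plane drawings -/

/-- The curve of a dart is determined by its length. -/
theorem curve_of_len (D : Drawing n m) (d : Fin (2 * m)) {L : ℝ} (hL : 0 < L)
    (hodd : D.dir d = 1 ∨ D.dir d = 3 → L ≤ 2 * Real.pi)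
    (hhead : ∃ j : ℤ, D.X (G.tail d) + L • U (D.dir d) = D.X (G.head d) + (0, 2 * Real.pi * j)) :
    D.len G d = L ∧ (∀ t, D.curve G d t = P (D.X (G.tail d) + (t * L) • U (D.dir d))) ∧
    (D.dir d = 0 → D.radius (G.tail d) < D.radius (G.head d)) ∧
    (D.dir d = 2 → D.radius (G.head d) < D.radius (G.tail d)) := by
  obtain ⟨j, hj⟩ := hhead
  have h1 := congrArg Prod.fst hj
  have h2 := congrArg Prod.snd hj
  unfold curve len P
  rcases dir_cases (D.dir d) with h0 | h0 | h0 | h0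
  · rw [h0, U_zero] at h1 h2
    simp only [X, Prod.fst_add, Prod.snd_add, Prod.smul_mk, smul_eq_mul, mul_one, mul_zero,
      add_zero] at h1 h2
    rw [h0, if_neg (by decide), if_neg (by decide), U_zero, ← h1]
    refine ⟨by rw [add_sub_cancel_left, abs_of_pos hL], fun t => ?_, fun _ => by linarith,
      fun h => absurd h (by decide)⟩
    rw [if_neg (by decide), if_neg (by decide)]
    simp only [X, Prod.smul_mk, Prod.mk_add_mk, smul_eq_mul, mul_one, mul_zero, add_zero]
    congr 1; linear_combination (-t) * h1
  · have hL' := hodd (.inl h0)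
    rw [h0, U_one] at h1 h2
    simp only [X, Prod.fst_add, Prod.snd_add, Prod.smul_mk, smul_eq_mul, mul_one, mul_zero,
      add_zero] at h1 h2
    have hs := sweep_eq (a := D.angle (G.tail d)) (b := D.angle (G.head d)) hL hL' (-j)
      (by push_cast; linarith)
    rw [h0, if_pos rfl, U_one, hs]
    refine ⟨rfl, fun t => ?_, fun h => absurd h (by decide), fun h => absurd h (by decide)⟩
    rw [if_pos rfl]
    simp [X, hs]
  · rw [h0, U_two] at h1 h2
    simp only [X, Prod.fst_add, Prod.snd_add, Prod.smul_mk, smul_eq_mul, mul_zero,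
      add_zero] at h1 h2
    rw [h0, if_neg (by decide), if_neg (by decide), U_two, ← h1]
    refine ⟨by rw [add_sub_cancel_left, mul_neg, mul_one, abs_neg, abs_of_pos hL], fun t => ?_,
      fun h => absurd h (by decide), fun _ => by linarith⟩
    rw [if_neg (by decide), if_neg (by decide)]
    simp only [X, Prod.smul_mk, Prod.mk_add_mk, smul_eq_mul, mul_zero, add_zero]
    congr 1; linear_combination (-t) * h1
  · have hL' := hodd (.inr h0)
    rw [h0, U_three] at h1 h2
    simp only [X, Prod.fst_add, Prod.snd_add, Prod.smul_mk, smul_eq_mul, mul_zero,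
      add_zero] at h1 h2
    have hs := sweep_eq (a := D.angle (G.head d)) (b := D.angle (G.tail d)) hL hL' j
      (by linarith)
    rw [h0, if_neg (by decide), if_pos rfl, U_three, hs]
    refine ⟨rfl, fun t => ?_, fun h => absurd h (by decide), fun h => absurd h (by decide)⟩
    rw [if_neg (by decide), if_pos rfl]
    simp only [X, Prod.smul_mk, Prod.mk_add_mk, smul_eq_mul, mul_zero, add_zero]
    rw [hs]; congr 1; ring

/-- A criterion for plane drawings in terms of straight segments in the plane of radius and
angle. -/
theorem Draws.of_segments (D : Drawing n m) (L : Fin (2 * m) → ℝ)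
    (hr : ∀ v, 0 < D.radius v) (hL : ∀ d, 0 < L d) (hLrev : ∀ d, L (G.rev d) = L d)
    (hodd : ∀ d, D.dir d = 1 ∨ D.dir d = 3 → L d ≤ 2 * Real.pi)
    (hhead : ∀ d, ∃ j : ℤ,
      D.X (G.tail d) + L d • U (D.dir d) = D.X (G.head d) + (0, 2 * Real.pi * j))
    (hrev : ∀ d, D.dir (G.rev d) = D.dir d + 2)
    (hinj : ∀ v w, P (D.X v) = P (D.X w) → v = w)
    (hne : ∀ d, ∀ x ∈ Set.Ioo 0 (L d), ∀ v, P (D.X (G.tail d) + x • U (D.dir d)) ≠ P (D.X v))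
    (hdisj : ∀ d e, ∀ x ∈ Set.Ioo 0 (L d), ∀ y ∈ Set.Ioo 0 (L e),
      P (D.X (G.tail d) + x • U (D.dir d)) = P (D.X (G.tail e) + y • U (D.dir e)) →
      (e = d ∧ y = x) ∨ (e = G.rev d ∧ y = L d - x))
    (hang : R.Matches D.dir) : D.Draws R ∧ ∀ d, D.len G d = L d := by
  have hc := fun d => D.curve_of_len d (hL d) (hodd d) (hhead d)
  have hmem : ∀ d, ∀ t ∈ Set.Ioo (0 : ℝ) 1, t * L d ∈ Set.Ioo 0 (L d) := fun d t ht =>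
    ⟨mul_pos ht.1 (hL d), mul_lt_of_lt_one_left (hL d) ht.2⟩
  refine ⟨⟨hr, fun d => ?_, fun d => (hc d).2.2.1, fun d => (hc d).2.2.2, hrev,
    fun v w hvw => hinj v w hvw, fun d t ht v => ?_, fun d e t ht s hs heq => ?_, hang⟩,
    fun d => (hc d).1⟩
  · obtain ⟨j, hj⟩ := hhead d
    rw [(hc d).2.1, one_mul, hj, P_add_period]; rfl
  · rw [(hc d).2.1]
    exact hne d _ (hmem d t ht) v
  · rw [(hc d).2.1, (hc e).2.1] at heq
    rcases hdisj d e _ (hmem d t ht) _ (hmem e s hs) heq with ⟨rfl, h⟩ | ⟨rfl, h⟩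
    · exact .inl ⟨rfl, mul_right_cancel₀ (hL _).ne' h⟩
    · refine .inr ⟨rfl, mul_right_cancel₀ (hL d).ne' ?_⟩
      rw [hLrev] at h
      linear_combination h

/-- Sufficiently close left points do not lie on the drawing. -/
theorem Draws.leftPoint_notMem {D : Drawing n m} (h : D.Draws R) (d : Fin (2 * m)) :
    ∀ᶠ ε in 𝓝[>] (0 : ℝ), D.leftPoint G d ε ∉ D.image G := by
  have hl := h.len_pos d
  obtain ⟨η, hη, htube⟩ := h.exists_tube d (x₀ := D.len G d / 4) (x₁ := 3 * D.len G d / 4)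
    (by linarith) (by linarith)
  filter_upwards [leftPoint_near D d (h.curve_radius_pos d (x := D.len G d / 2)
    ⟨by linarith, by linarith⟩) (h.curve_half d)
    (lt_min hη (show 0 < D.len G d / 4 by linarith))] with ε ⟨α, β, hα, hβ, hε⟩
  have h1 := abs_lt.1 (hα.trans_le (min_le_right _ _))
  rw [hε, add_assoc (D.X _), ← add_smul]
  exact htube _ ⟨by linarith [h1.1], by linarith [h1.2]⟩ _ ⟨hβ.1, hβ.2.trans_le (min_le_left _ _)⟩

end Drawing

/-! ### From a drawing of a thickening to a drawing of the graph -/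

namespace PreThickening

open GridDart Drawing Filter Topology

variable {n m n' m' : ℕ} {G : EmbeddedGraph n m} {G' : EmbeddedGraph n' m'}
  {R : OrthoRep G} {R' : OrthoRep G'} (T : PreThickening R R') (hV : R.VertexCondition)

/-- The three darts of `G'` between the centres of two grids that replace the dart `d`. -/
def pathDart (d : Fin (2 * m)) : Fin 3 → Fin (2 * m') :=
  ![T.g (G.tail d) (out (T.side d)), T.c d 0, T.g (G.head d) (inn (T.side (G.rev d)))]

/-- The vertex of `G'` in the middle of the side associated with `d`. -/
def mid (d : Fin (2 * m)) : Fin n' := T.vtx (G.tail d, gridSide (T.side d) 0)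

theorem mid_inj (hV : R.VertexCondition) {d e : Fin (2 * m)} (h : T.mid d = T.mid e) : d = e := by
  simp only [mid, T.vtx.injective.eq_iff, Prod.mk.injEq, gridSide_zero_eq_iff, and_true] at h
  exact T.side_inj hV h.1 h.2

theorem rev_pathDart (d : Fin (2 * m)) (i : Fin 3) :
    G'.rev (T.pathDart d i) = T.pathDart (G.rev d) (2 - i) := by
  fin_cases i
  · change G'.rev (T.g _ _) = T.g _ _
    rw [rev_g, swap_out, G.head_rev, G.rev_rev]
  · change G'.rev (T.c _ _) = T.c _ _
    rw [rev_c, neg_zero]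
  · change G'.rev (T.g _ _) = T.g _ _
    rw [rev_g, swap_inn, G.tail_rev]

theorem pathDart_inj (hV : R.VertexCondition) {d e : Fin (2 * m)} {i j : Fin 3}
    (h : T.pathDart d i = T.pathDart e j) : d = e ∧ i = j := by
  have ho : ∀ σ τ, out σ = out τ → σ = τ := by unfold GridDart; decide
  have hi : ∀ σ τ, inn σ = inn τ → σ = τ := by unfold GridDart; decide
  have hoi : ∀ σ τ, out σ ≠ inn τ := by decide
  fin_cases i <;> fin_cases j
  · obtain ⟨h1, h2⟩ := T.g_inj.1 h
    exact ⟨T.side_inj hV h1 (ho _ _ h2), rfl⟩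
  · exact absurd h (T.g_ne_c _ _ _ _)
  · exact absurd (T.g_inj.1 h).2 (hoi _ _)
  · exact absurd h.symm (T.g_ne_c _ _ _ _)
  · exact ⟨(T.c_inj.1 h).1, rfl⟩
  · exact absurd h.symm (T.g_ne_c _ _ _ _)
  · exact absurd (T.g_inj.1 h).2.symm (hoi _ _)
  · exact absurd h (T.g_ne_c _ _ _ _)
  · obtain ⟨h1, h2⟩ := T.g_inj.1 h
    exact ⟨G.rev_injective (T.side_inj hV h1 (hi _ _ h2)), rfl⟩

/-- The drawing of `G` contained in a drawing of a thickening: each vertex is placed at the centre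
of its grid, and each edge follows its middle copy. -/
def restrict (D' : Drawing n' m') : Drawing n m where
  radius v := D'.radius (T.vtx (v, (0, 0)))
  angle v := D'.angle (T.vtx (v, (0, 0)))
  dir d := D'.dir (T.c d 0)

variable {D' : Drawing n' m'} (h : D'.Draws R')

section Rotation
include h

/-- The grid of `v` is rotated as a whole. -/
theorem dir_sub_bdir_rev (v : Fin n) (x : GridDart) :
    D'.dir (T.g v x.swap) - T.bdir (T.g v x.swap) = D'.dir (T.g v x) - T.bdir (T.g v x) := by
  rw [← T.rev_g, h.dir_rev, T.rev_g, bdir_g, bdir_g, dir_swap]; ring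

theorem dir_out' (v : Fin n) (σ : ZMod 4) :
    D'.dir (T.g v (out σ)) = σ + D'.dir (T.g v (out 0)) := by
  have h1 := h.angles.sub_eq T.matches_bdir (d := T.g v (out σ)) (e := T.g v (out 0))
    (by rw [tail_g, tail_g]; rfl)
  rw [bdir_g, bdir_g, dir_out, dir_out] at h1
  linear_combination h1

theorem dir_inn' (v : Fin n) (σ : ZMod 4) :
    D'.dir (T.g v (inn σ)) = σ + 2 + D'.dir (T.g v (out 0)) := by
  have h1 := T.dir_sub_bdir_rev h v (out σ)
  rw [swap_out, bdir_g, bdir_g, dir_out, dir_inn, T.dir_out' h] at h1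
  linear_combination h1

theorem dir_c' (d : Fin (2 * m)) :
    D'.dir (T.c d 0) = T.side d + D'.dir (T.g (G.tail d) (out 0)) := by
  have h1 := h.angles.sub_eq T.matches_bdir (d := T.c d 0) (e := T.g (G.tail d) (inn (T.side d)))
    (by rw [tail_g, tail_c]; rfl)
  rw [bdir_g, bdir_c, dir_inn, T.dir_inn' h] at h1
  linear_combination h1

theorem dir_ccwA' (d : Fin (2 * m)) :
    D'.dir (T.g (G.tail d) (ccwA (T.side d))) = D'.dir (T.c d 0) + 1 := by
  have h1 := h.angles.sub_eq T.matches_bdir (d := T.c d 0) (e := T.g (G.tail d) (ccwA (T.side d)))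
    (by rw [tail_g, tail_c]; rfl)
  rw [bdir_g, bdir_c, dir_ccwA] at h1
  linear_combination -h1

theorem dir_c_rev (d : Fin (2 * m)) : D'.dir (T.c (G.rev d) 0) = D'.dir (T.c d 0) + 2 := by
  rw [← h.dir_rev, rev_c, neg_zero]

theorem dir_pathDart (d : Fin (2 * m)) (i : Fin 3) :
    D'.dir (T.pathDart d i) = D'.dir (T.c d 0) := by
  fin_cases i
  · change D'.dir (T.g _ _) = _
    rw [T.dir_out' h, T.dir_c' h]
  · rfl
  · change D'.dir (T.g _ _) = _
    have h1 := T.dir_c' h (G.rev d)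
    rw [T.dir_c_rev h, G.tail_rev] at h1
    rw [T.dir_inn' h]
    linear_combination -h1 + four_eq_zero

theorem matches_restrict : R.Matches (T.restrict D').dir := by
  have h1 : (T.restrict D').dir = fun d => T.side d + D'.dir (T.g (G.tail d) (out 0)) :=
    funext fun d => T.dir_c' h d
  rw [h1]
  exact T.side_matches.add_rotation fun v => D'.dir (T.g v (out 0))

end Rotation

/-- The length of a part of the path that replaces a dart. -/
noncomputable def partLen (D' : Drawing n' m') (d : Fin (2 * m)) (i : Fin 3) : ℝ :=
  D'.len G' (T.pathDart d i)

/-- The distance at which a part of the path that replaces a dart begins. -/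
noncomputable def offset (D' : Drawing n' m') (d : Fin (2 * m)) : Fin 3 → ℝ :=
  ![0, T.partLen D' d 0, T.partLen D' d 0 + T.partLen D' d 1]

/-- The length of the path that replaces a dart. -/
noncomputable def pathLen (D' : Drawing n' m') (d : Fin (2 * m)) : ℝ :=
  T.partLen D' d 0 + T.partLen D' d 1 + T.partLen D' d 2

/-- The point at distance `x` on the path that replaces a dart. -/
noncomputable def pathPoint (D' : Drawing n' m') (d : Fin (2 * m)) (x : ℝ) : ℂ :=
  P (D'.X (T.vtx (G.tail d, (0, 0))) + x • U (D'.dir (T.c d 0)))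

section Path
include h

theorem partLen_pos (d : Fin (2 * m)) (i : Fin 3) : 0 < T.partLen D' d i := h.len_pos _

theorem pathLen_pos (d : Fin (2 * m)) : 0 < T.pathLen D' d := by
  have := T.partLen_pos h d 0
  have := T.partLen_pos h d 1
  have := T.partLen_pos h d 2
  unfold pathLen; linarith

theorem partLen_rev (d : Fin (2 * m)) (i : Fin 3) :
    T.partLen D' (G.rev d) (2 - i) = T.partLen D' d i := by
  rw [partLen, ← rev_pathDart, h.len_rev]; rfl

theorem pathLen_rev (d : Fin (2 * m)) : T.pathLen D' (G.rev d) = T.pathLen D' d := by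
  have h0 := T.partLen_rev h d 0
  have h1 := T.partLen_rev h d 1
  have h2 := T.partLen_rev h d 2
  rw [show (2 - 0 : Fin 3) = 2 from rfl] at h0
  rw [show (2 - 1 : Fin 3) = 1 from rfl] at h1
  rw [show (2 - 2 : Fin 3) = 0 from rfl] at h2
  unfold pathLen; linarith

theorem offset_rev (d : Fin (2 * m)) (i : Fin 3) :
    T.offset D' (G.rev d) (2 - i) = T.pathLen D' d - T.offset D' d i - T.partLen D' d i := by
  have h1 := T.partLen_rev h d 1
  have h2 := T.partLen_rev h d 2
  rw [show (2 - 1 : Fin 3) = 1 from rfl] at h1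
  rw [show (2 - 2 : Fin 3) = 0 from rfl] at h2
  fin_cases i
  · change T.partLen D' (G.rev d) 0 + T.partLen D' (G.rev d) 1 = T.pathLen D' d - 0 - T.partLen D' d 0
    unfold pathLen; linarith
  · change T.partLen D' (G.rev d) 0 = T.pathLen D' d - T.partLen D' d 0 - T.partLen D' d 1
    unfold pathLen; linarith
  · change 0 = T.pathLen D' d - (T.partLen D' d 0 + T.partLen D' d 1) - T.partLen D' d 2
    unfold pathLen; linarith

theorem pathPoint_first (d : Fin (2 * m)) (y : ℝ × ℝ) :
    P (D'.X (T.vtx (G.tail d, (0, 0))) + T.partLen D' d 0 • U (D'.dir (T.c d 0)) + y) =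
      P (D'.X (T.mid d) + y) := by
  have h1 := h.P_head (T.pathDart d 0) y
  rw [T.dir_pathDart h] at h1
  change P (D'.X (G'.tail (T.g _ _)) + _ + y) = P (D'.X (G'.head (T.g _ _)) + y) at h1
  rw [tail_g, head_g] at h1
  exact h1

theorem pathPoint_second (d : Fin (2 * m)) (y : ℝ × ℝ) :
    P (D'.X (T.vtx (G.tail d, (0, 0))) +
      (T.partLen D' d 0 + T.partLen D' d 1) • U (D'.dir (T.c d 0)) + y) =
      P (D'.X (T.mid (G.rev d)) + y) := by
  have h1 := h.P_head (T.c d 0) y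
  rw [tail_c, head_c, neg_zero] at h1
  change _ = P (D'.X (T.mid (G.rev d)) + y) at h1
  rw [← h1, add_smul, ← add_assoc, add_assoc (_ + _), T.pathPoint_first h, ← add_assoc]
  rfl

theorem pathPoint_last (d : Fin (2 * m)) (y : ℝ × ℝ) :
    P (D'.X (T.vtx (G.tail d, (0, 0))) + T.pathLen D' d • U (D'.dir (T.c d 0)) + y) =
      P (D'.X (T.vtx (G.head d, (0, 0))) + y) := by
  have h1 := h.P_head (T.pathDart d 2) y
  rw [T.dir_pathDart h] at h1
  change P (D'.X (G'.tail (T.g _ _)) + _ + y) = P (D'.X (G'.head (T.g _ _)) + y) at h1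
  rw [tail_g, head_g] at h1
  change _ = P (D'.X (T.vtx (G.head d, (0, 0))) + y) at h1
  rw [← h1, pathLen, add_smul, ← add_assoc, add_assoc (_ + _), T.pathPoint_second h, ← add_assoc]
  rfl

theorem pathPoint_eq_curve (d : Fin (2 * m)) (i : Fin 3) (t : ℝ) :
    T.pathPoint D' d (T.offset D' d i + t * T.partLen D' d i) =
      D'.curve G' (T.pathDart d i) t := by
  rw [h.curve_eq, T.dir_pathDart h, pathPoint, add_smul, ← add_assoc]
  fin_cases i
  · change P (_ + (0 : ℝ) • _ + _) = P (D'.X (G'.tail (T.g _ _)) + _)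
    rw [tail_g, zero_smul, add_zero]; rfl
  · change P (_ + T.partLen D' d 0 • _ + _) = P (D'.X (G'.tail (T.c _ _)) + _)
    rw [tail_c, T.pathPoint_first h]; rfl
  · change P (_ + (T.partLen D' d 0 + T.partLen D' d 1) • _ + _) = P (D'.X (G'.tail (T.g _ _)) + _)
    rw [tail_g, T.pathPoint_second h]; rfl

/-- The inner points of the path that replaces a dart. -/
theorem path_cases (d : Fin (2 * m)) {x : ℝ} (hx : x ∈ Set.Ioo 0 (T.pathLen D' d)) :
    (∃ i, ∃ t ∈ Set.Ioo (0 : ℝ) 1, x = T.offset D' d i + t * T.partLen D' d i ∧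
      T.pathPoint D' d x = D'.curve G' (T.pathDart d i) t) ∨
    (x = T.partLen D' d 0 ∧ T.pathPoint D' d x = D'.pos (T.mid d)) ∨
    (x = T.partLen D' d 0 + T.partLen D' d 1 ∧
      T.pathPoint D' d x = D'.pos (T.mid (G.rev d))) := by
  have key : ∀ i, T.offset D' d i < x → x < T.offset D' d i + T.partLen D' d i →
      (∃ i, ∃ t ∈ Set.Ioo (0 : ℝ) 1, x = T.offset D' d i + t * T.partLen D' d i ∧
      T.pathPoint D' d x = D'.curve G' (T.pathDart d i) t) := by
    intro i h1 h2
    have hl := T.partLen_pos h d i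
    have hxe : x = T.offset D' d i + (x - T.offset D' d i) / T.partLen D' d i * T.partLen D' d i := by
      rw [div_mul_cancel₀ _ hl.ne']; ring
    refine ⟨i, (x - T.offset D' d i) / T.partLen D' d i, ⟨div_pos (by linarith) hl,
      (div_lt_one hl).2 (by linarith)⟩, hxe, ?_⟩
    rw [← T.pathPoint_eq_curve h, ← hxe]
  have h0 : T.offset D' d 0 = 0 := rfl
  have h1 : T.offset D' d 1 = T.partLen D' d 0 := rfl
  have h2 : T.offset D' d 2 = T.partLen D' d 0 + T.partLen D' d 1 := rfl
  have hxL := hx.2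
  unfold pathLen at hxL
  rcases lt_trichotomy x (T.partLen D' d 0) with hlt | heq | hgt
  · exact .inl (key 0 (by rw [h0]; exact hx.1) (by linarith))
  · refine .inr (.inl ⟨heq, ?_⟩)
    have := T.pathPoint_first h d 0
    rw [add_zero, add_zero] at this
    rw [heq, pathPoint, this]; rfl
  · rcases lt_trichotomy x (T.partLen D' d 0 + T.partLen D' d 1) with hlt | heq | hgt'
    · exact .inl (key 1 (by linarith) (by linarith))
    · refine .inr (.inr ⟨heq, ?_⟩)
      have := T.pathPoint_second h d 0
      rw [add_zero, add_zero] at this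
      rw [heq, pathPoint, this]; rfl
    · exact .inl (key 2 (by linarith) (by linarith))

include hV in
/-- The paths that replace the darts are internally disjoint. -/
theorem path_disjoint {d e : Fin (2 * m)} {x y : ℝ} (hx : x ∈ Set.Ioo 0 (T.pathLen D' d))
    (hy : y ∈ Set.Ioo 0 (T.pathLen D' e)) (heq : T.pathPoint D' d x = T.pathPoint D' e y) :
    (e = d ∧ y = x) ∨ (e = G.rev d ∧ y = T.pathLen D' d - x) := by
  have hr0 : ∀ d, T.partLen D' (G.rev d) 0 = T.partLen D' d 2 := fun d => T.partLen_rev h d 2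
  have hr1 : ∀ d, T.partLen D' (G.rev d) 1 = T.partLen D' d 1 := fun d => T.partLen_rev h d 1
  have hrr : ∀ d, T.partLen D' (G.rev d) 2 = T.partLen D' d 0 := fun d => T.partLen_rev h d 0
  rcases T.path_cases h d hx with ⟨i, t, ht, hxe, hp⟩ | ⟨hxe, hp⟩ | ⟨hxe, hp⟩ <;>
  rcases T.path_cases h e hy with ⟨j, s, hs, hye, hq⟩ | ⟨hye, hq⟩ | ⟨hye, hq⟩ <;>
  rw [hp, hq] at heq
  · rcases h.curve_disjoint _ _ t ht s hs heq with ⟨h1, rfl⟩ | ⟨h1, rfl⟩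
    · obtain ⟨rfl, rfl⟩ := T.pathDart_inj hV h1
      exact .inl ⟨rfl, hye.trans hxe.symm⟩
    · rw [rev_pathDart] at h1
      obtain ⟨rfl, rfl⟩ := T.pathDart_inj hV h1
      refine .inr ⟨rfl, ?_⟩
      rw [hye, hxe, T.offset_rev h, T.partLen_rev h]; ring
  · exact absurd heq (h.curve_ne_pos _ t ht _)
  · exact absurd heq (h.curve_ne_pos _ t ht _)
  · exact absurd heq.symm (h.curve_ne_pos _ s hs _)
  · obtain rfl := T.mid_inj hV (h.pos_injective heq)
    exact .inl ⟨rfl, hye.trans hxe.symm⟩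
  · have h1 := T.mid_inj hV (h.pos_injective heq)
    subst h1
    refine .inr ⟨(G.rev_rev e).symm, ?_⟩
    rw [T.pathLen_rev h, hye, hxe, hr0, pathLen]; ring
  · exact absurd heq.symm (h.curve_ne_pos _ s hs _)
  · have h1 := T.mid_inj hV (h.pos_injective heq)
    subst h1
    refine .inr ⟨rfl, ?_⟩
    rw [hye, hxe, hr0, pathLen]; ring
  · have h1 := G.rev_injective (T.mid_inj hV (h.pos_injective heq))
    subst h1
    exact .inl ⟨rfl, hye.trans hxe.symm⟩

include hV in
/-- A path along a circle does not overlap itself. -/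
theorem pathLen_le (d : Fin (2 * m)) (hd : D'.dir (T.c d 0) = 1 ∨ D'.dir (T.c d 0) = 3) :
    T.pathLen D' d ≤ 2 * Real.pi := by
  by_contra! hlt
  have hpi := Real.two_pi_pos
  set x := (T.pathLen D' d - 2 * Real.pi) / 2 with hx
  have heq : T.pathPoint D' d x = T.pathPoint D' d (x + 2 * Real.pi) := by
    unfold pathPoint
    rcases hd with hd | hd
    · rw [hd, add_smul, ← add_assoc, U_one,
        show (2 * Real.pi) • ((0 : ℝ), (1 : ℝ)) = (0, 2 * Real.pi * (1 : ℤ)) by simp, P_add_period]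
    · rw [hd, add_smul, ← add_assoc, U_three,
        show (2 * Real.pi) • ((0 : ℝ), (-1 : ℝ)) = (0, 2 * Real.pi * (-1 : ℤ)) by simp,
        P_add_period]
  rcases T.path_disjoint hV h ⟨by linarith, by linarith⟩ ⟨by linarith, by linarith⟩ heq with h1 | h1
  · linarith [h1.2]
  · exact G.rev_ne d h1.1.symm

include hV in
/-- The drawing contained in a drawing of the thickening is plane: each of its edges is a segment
composed of three collinear edges. -/
theorem draws_restrict : (T.restrict D').Draws R ∧
    ∀ d, (T.restrict D').len G d = T.pathLen D' d := by
  apply Draws.of_segments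
  · exact fun v => h.radius_pos _
  · exact T.pathLen_pos h
  · exact T.pathLen_rev h
  · exact T.pathLen_le hV h
  · intro d
    have hr := h.radius_pos (T.vtx (G.tail d, (0, 0)))
    have hr' := h.radius_pos (T.vtx (G.head d, (0, 0)))
    have h1 := T.pathPoint_last h d 0
    rw [add_zero, add_zero] at h1
    refine (P_eq_iff ?_ hr').1 h1
    -- Only on an inward path may the radius decrease, and there it does so to the radius of the
    -- head.
    have hbr : ∀ k : ZMod 4, k ≠ 2 →
        0 < (D'.X (T.vtx (G.tail d, (0, 0))) + T.pathLen D' d • U k).1 := by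
      intro k hk
      have hL := T.pathLen_pos h d
      rcases dir_cases k with rfl | rfl | rfl | rfl
      · rw [U_zero]; change 0 < D'.radius _ + T.pathLen D' d * 1; linarith
      · rw [U_one]; change 0 < D'.radius _ + T.pathLen D' d * 0; linarith
      · exact absurd rfl hk
      · rw [U_three]; change 0 < D'.radius _ + T.pathLen D' d * 0; linarith
    by_cases hk : D'.dir (T.c d 0) = 2
    · have hlen : ∀ i, T.partLen D' d i = D'.radius (G'.tail (T.pathDart d i)) -
          D'.radius (G'.head (T.pathDart d i)) := by
        intro i
        have hi := T.dir_pathDart h d i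
        rw [hk] at hi
        have := h.inward _ hi
        rw [partLen, len, hi, if_neg (by decide), if_neg (by decide), abs_of_neg (by linarith)]
        ring
      have e0 : D'.radius (G'.tail (T.pathDart d 0)) = D'.radius (T.vtx (G.tail d, (0, 0))) := by
        change D'.radius (G'.tail (T.g _ _)) = _
        rw [tail_g]; rfl
      have e1 : D'.radius (G'.tail (T.pathDart d 1)) = D'.radius (G'.head (T.pathDart d 0)) := by
        change D'.radius (G'.tail (T.c _ _)) = D'.radius (G'.head (T.g _ _))
        rw [tail_c, head_g]; rfl
      have e2 : D'.radius (G'.tail (T.pathDart d 2)) = D'.radius (G'.head (T.pathDart d 1)) := by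
        change D'.radius (G'.tail (T.g _ _)) = D'.radius (G'.head (T.c _ _))
        rw [tail_g, head_c, neg_zero]; rfl
      change 0 < (D'.X (T.vtx (G.tail d, (0, 0))) + T.pathLen D' d • U (D'.dir (T.c d 0))).1
      rw [hk, U_two]
      change 0 < D'.radius _ + T.pathLen D' d * (-1)
      rw [pathLen, hlen, hlen, hlen, e0, e1, e2]
      linarith [h.radius_pos (G'.head (T.pathDart d 2))]
    · exact hbr _ hk
  · intro d
    exact T.dir_c_rev h d
  · intro v w hvw
    have := T.vtx.injective (h.pos_injective hvw)
    simpa using this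
  · intro d x hx v
    change T.pathPoint D' d x ≠ D'.pos (T.vtx (v, (0, 0)))
    rcases T.path_cases h d hx with ⟨i, t, ht, hxe, hp⟩ | ⟨hxe, hp⟩ | ⟨hxe, hp⟩ <;> rw [hp]
    · exact h.curve_ne_pos _ t ht _
    · intro heq
      exact gridSide_ne_zero _ _ (Prod.mk.inj (T.vtx.injective (h.pos_injective heq))).2
    · intro heq
      exact gridSide_ne_zero _ _ (Prod.mk.inj (T.vtx.injective (h.pos_injective heq))).2
  · exact fun d e x hx y hy heq => T.path_disjoint hV h hx hy heq
  · exact T.matches_restrict h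

end Path

end PreThickening

namespace PreThickening

open GridDart Drawing Filter Topology

variable {n m n' m' : ℕ} {G : EmbeddedGraph n m} {G' : EmbeddedGraph n' m'}
  {R : OrthoRep G} {R' : OrthoRep G'} (T : PreThickening R R') (hV : R.VertexCondition)

variable {D' : Drawing n' m'} (h : D'.Draws R')

include hV h

/-- The points of the drawing of `G` that is contained in a drawing of a thickening. -/
theorem mem_image_restrict {p : ℂ} (hp : p ∈ (T.restrict D').image G) :
    (∃ v, p = D'.pos (T.vtx (v, (0, 0)))) ∨ (∃ d, p = D'.pos (T.mid d)) ∨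
      ∃ d i, ∃ t ∈ Set.Ioo (0 : ℝ) 1, p = D'.curve G' (T.pathDart d i) t := by
  obtain ⟨hD, hlen⟩ := T.draws_restrict hV h
  rcases hp with ⟨v, rfl⟩ | hp
  · exact .inl ⟨v, rfl⟩
  · simp only [Set.mem_iUnion] at hp
    obtain ⟨d, t, ht, rfl⟩ := hp
    rcases eq_or_lt_of_le ht.1 with rfl | h0
    · exact .inl ⟨_, hD.curve_zero d⟩
    rcases eq_or_lt_of_le ht.2 with rfl | h1
    · exact .inl ⟨_, hD.curve_one d⟩
    have hx : t * T.pathLen D' d ∈ Set.Ioo 0 (T.pathLen D' d) :=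
      ⟨mul_pos h0 (T.pathLen_pos h d), mul_lt_of_lt_one_left (T.pathLen_pos h d) h1⟩
    have he : (T.restrict D').curve G d t = T.pathPoint D' d (t * T.pathLen D' d) := by
      rw [hD.curve_eq, hlen]; rfl
    rw [he]
    rcases T.path_cases h d hx with ⟨i, s, hs, -, hp⟩ | ⟨-, hp⟩ | ⟨-, hp⟩
    · exact .inr (.inr ⟨d, i, s, hs, hp⟩)
    · exact .inr (.inl ⟨_, hp⟩)
    · exact .inr (.inl ⟨_, hp⟩)

theorem image_restrict_subset : (T.restrict D').image G ⊆ D'.image G' := by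
  intro p hp
  rcases T.mem_image_restrict hV h hp with ⟨v, rfl⟩ | ⟨d, rfl⟩ | ⟨d, i, t, ht, rfl⟩
  · exact .inl ⟨_, rfl⟩
  · exact .inl ⟨_, rfl⟩
  · exact .inr (Set.mem_iUnion.2 ⟨_, t, ⟨ht.1.le, ht.2.le⟩, rfl⟩)

theorem curve_notMem {e : Fin (2 * m')} (he : ∀ d i, e ≠ T.pathDart d i) {t : ℝ}
    (ht : t ∈ Set.Ioo (0 : ℝ) 1) : D'.curve G' e t ∉ (T.restrict D').image G := by
  intro hp
  rcases T.mem_image_restrict hV h hp with ⟨v, hv⟩ | ⟨d, hd⟩ | ⟨d, i, s, hs, hd⟩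
  · exact h.curve_ne_pos e t ht _ hv
  · exact h.curve_ne_pos e t ht _ hd
  · rcases h.curve_disjoint _ _ s hs t ht hd.symm with ⟨h1, -⟩ | ⟨h1, -⟩
    · exact he d i h1
    · rw [rev_pathDart] at h1
      exact he _ _ h1

/-- The region on the left of the left copy of `d` is contained in the region on the left of `d`,
since the part of the drawing of `G'` along the left half of the side of `d` and the first half of
the left copy of `d` does not meet the drawing of `G` and leads from the left of `d` to the middle
of the left copy. -/
theorem region_restrict (d : Fin (2 * m)) : ∃ S : Set ℂ,
    (∀ᶠ ε in 𝓝[>] (0 : ℝ), (T.restrict D').region G ((T.restrict D').leftPoint G d ε) = S) ∧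
    ∀ᶠ ε in 𝓝[>] (0 : ℝ), D'.region G' (D'.leftPoint G' (T.c d 1) ε) ⊆ S := by
  obtain ⟨hD, hlen⟩ := T.draws_restrict hV h
  set D := T.restrict D' with hDdef
  set a := T.g (G.tail d) (ccwA (T.side d)) with ha
  have hsub := T.image_restrict_subset hV h
  have ha_ne : ∀ e i, a ≠ T.pathDart e i := by
    have h1 : ∀ σ τ, ccwA σ ≠ out τ := by decide
    have h2 : ∀ σ τ, ccwA σ ≠ inn τ := by decide
    intro e i
    fin_cases i
    · exact fun heq => h1 _ _ (T.g_inj.1 heq).2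
    · exact T.g_ne_c _ _ _ _
    · exact fun heq => h2 _ _ (T.g_inj.1 heq).2
  have hc_ne : ∀ e i, T.c d 1 ≠ T.pathDart e i := by
    intro e i
    fin_cases i
    · exact (T.g_ne_c _ _ _ _).symm
    · exact fun heq => absurd (T.c_inj.1 heq).2 (by decide)
    · exact (T.g_ne_c _ _ _ _).symm
  have hcorner : D'.pos (T.vtx (G.tail d, gridSide (T.side d) 1)) ∉ D.image G := by
    intro hp
    rcases T.mem_image_restrict hV h hp with ⟨v, hv⟩ | ⟨e, he⟩ | ⟨e, i, s, hs, he⟩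
    · exact gridSide_ne_zero _ _ (Prod.mk.inj (T.vtx.injective (h.pos_injective hv))).2
    · have := (gridSide_zero_eq_iff _ _ _).1
        (Prod.mk.inj (T.vtx.injective (h.pos_injective he))).2
      exact absurd this.2 (by decide)
    · exact h.curve_ne_pos _ s hs _ he.symm
  have ha1 : D'.curve G' a 1 = D'.pos (T.vtx (G.tail d, gridSide (T.side d) 1)) := by
    rw [h.curve_one, ha, head_g]; rfl
  have hc0 : D'.curve G' (T.c d 1) 0 = D'.pos (T.vtx (G.tail d, gridSide (T.side d) 1)) := by
    rw [h.curve_zero, tail_c]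
  -- The curve along the grid and the left copy, as a preconnected set.
  set A : Set ℂ := D'.curve G' a '' Set.Ioc 0 1 ∪ D'.curve G' (T.c d 1) '' Set.Icc 0 (1 / 2) with hA
  have hApre : IsPreconnected A := by
    refine IsPreconnected.union (D'.pos (T.vtx (G.tail d, gridSide (T.side d) 1)))
      ⟨1, by simp, ha1⟩ ⟨0, by simp, hc0⟩
      (isPreconnected_Ioc.image _ (h.continuous_curve a).continuousOn)
      (isPreconnected_Icc.image _ (h.continuous_curve _).continuousOn)
  have hAsub : A ⊆ (D.image G)ᶜ := by
    rintro p (⟨t, ht, rfl⟩ | ⟨t, ht, rfl⟩)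
    · rcases eq_or_lt_of_le ht.2 with rfl | h1
      · rw [ha1]; exact hcorner
      · exact T.curve_notMem hV h ha_ne ⟨ht.1, h1⟩
    · rcases eq_or_lt_of_le ht.1 with rfl | h1
      · rw [hc0]; exact hcorner
      · exact T.curve_notMem hV h hc_ne ⟨h1, ht.2.trans_lt (by norm_num)⟩
  refine ⟨D.region G (D'.curve G' (T.c d 1) (1 / 2)), ?_, ?_⟩
  · obtain ⟨η, hη, hleft⟩ := hD.region_leftPoint d (x := T.partLen D' d 0) ⟨T.partLen_pos h d 0, by
      rw [hlen]
      have := T.partLen_pos h d 1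
      have := T.partLen_pos h d 2
      unfold pathLen; linarith⟩
    have hla := h.len_pos a
    have hmin := lt_min hη hla
    have hβ1 := min_le_left η (D'.len G' a)
    have hβ2 := min_le_right η (D'.len G' a)
    filter_upwards [hleft (min η (D'.len G' a) / 2) ⟨by positivity, by linarith⟩] with ε hε
    rw [hε]
    refine Draws.region_eq hApre hAsub (.inl ?_) (.inr ⟨1 / 2, by norm_num, rfl⟩)
    refine ⟨min η (D'.len G' a) / 2 / D'.len G' a, ⟨by positivity, ?_⟩, ?_⟩
    · rw [div_le_one hla]; linarith
    · rw [← h.P_eq_curve, T.dir_ccwA' h]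
      change _ = P (D'.X (T.vtx (G.tail d, (0, 0))) + T.partLen D' d 0 • U (D'.dir (T.c d 0)) + _)
      rw [T.pathPoint_first h, ha, tail_g]
      rfl
  -- The left points of the left copy are connected to its midpoint by a short segment.
  · obtain ⟨ε₀, hε₀, hnot⟩ := (mem_nhdsGT_iff_exists_Ioo_subset).1 (h.leftPoint_notMem (T.c d 1))
    have hcont : Continuous fun ε : ℝ => D'.leftPoint G' (T.c d 1) ε := by
      unfold leftPoint; fun_prop
    have h0 : D'.leftPoint G' (T.c d 1) 0 = D'.curve G' (T.c d 1) (1 / 2) := by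
      simp [leftPoint]
    filter_upwards [Ioo_mem_nhdsGT hε₀] with ε hε
    rw [Draws.region_eq (D := D) (A := (fun ε : ℝ => D'.leftPoint G' (T.c d 1) ε) '' Set.Ico 0 ε₀)
      (p := D'.curve G' (T.c d 1) (1 / 2)) (q := D'.leftPoint G' (T.c d 1) ε)
      (isPreconnected_Ico.image _ hcont.continuousOn) ?_ ⟨0, ⟨le_rfl, hε₀⟩, h0⟩
      ⟨ε, ⟨hε.1.le, hε.2⟩, rfl⟩]
    · exact connectedComponentIn_mono _ (Set.compl_subset_compl.2 hsub)
    · rintro _ ⟨s, hs, rfl⟩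
      rcases eq_or_lt_of_le hs.1 with rfl | hs0
      · beta_reduce
        rw [h0]
        exact T.curve_notMem hV h hc_ne (by norm_num)
      · exact fun hmem => hnot ⟨hs0, hs.2⟩ (hsub hmem)

end PreThickening

/-- A drawing of the thickening yields a drawing of the representation. -/
theorem Thickening.realizes_restrict {n m n' m' : ℕ} {G : EmbeddedGraph n m}
    {G' : EmbeddedGraph n' m'} {R : OrthoRep G} {R' : OrthoRep G'} (T' : Thickening R R')
    (hV : R.VertexCondition) {D' : Drawing n' m'} (h : D'.Realizes R') :
    (T'.pre.restrict D').Realizes R := by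
  refine (T'.pre.draws_restrict hV h.draws).1.realizes (fun d hd => ?_) (fun d hd => ?_)
  · obtain ⟨S, h1, h2⟩ := T'.pre.region_restrict hV h.draws d
    obtain ⟨ε, h3, h4⟩ := ((h.central _ (T'.central d hd)).and h2).exists
    filter_upwards [h1] with ε' hε'
    rw [hε']
    exact h4 h3
  · obtain ⟨S, h1, h2⟩ := T'.pre.region_restrict hV h.draws d
    obtain ⟨ε, h3, h4⟩ := ((h.outer _ (T'.outer d hd)).and h2).exists
    filter_upwards [h1] with ε' hε' hb
    rw [hε'] at hb
    exact h3 (hb.subset h4)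

/-! ### Small perturbations of a drawing -/

namespace Drawing

open Filter Topology

/-- Coordinates with respect to two consecutive directions. -/
theorem exists_coord (z : ℝ × ℝ) (k : ZMod 4) :
    ∃ α β : ℝ, z = α • U k + β • U (k + 1) ∧ |α| ≤ ‖z‖ ∧ |β| ≤ ‖z‖ := by
  have key : ∃ α β : ℝ, z = α • U k + β • U (k + 1) := by
    rcases dir_cases k with rfl | rfl | rfl | rfl
    · exact ⟨z.1, z.2, by
        rw [show (0 + 1 : ZMod 4) = 1 from rfl, U_zero, U_one]; ext <;> simp⟩
    · exact ⟨z.2, -z.1, by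
        rw [show (1 + 1 : ZMod 4) = 2 from rfl, U_one, U_two]; ext <;> simp⟩
    · exact ⟨-z.1, -z.2, by
        rw [show (2 + 1 : ZMod 4) = 3 from rfl, U_two, U_three]; ext <;> simp⟩
    · exact ⟨-z.2, z.1, by
        rw [show (3 + 1 : ZMod 4) = 0 from rfl, U_three, U_zero]; ext <;> simp⟩
  obtain ⟨α, β, hz⟩ := key
  refine ⟨α, β, hz, ?_, ?_⟩
  · rw [hz, Draws.norm_smul_U_add]; exact le_max_left _ _
  · rw [hz, Draws.norm_smul_U_add]; exact le_max_right _ _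

variable {n m : ℕ} {G : EmbeddedGraph n m} {R : OrthoRep G}

/-- A distance that is small compared to the drawing: in particular the radii of two vertices, and
their angles modulo `2π`, are equal if they differ by at most `4 * δ`. -/
structure Small (G : EmbeddedGraph n m) (D : Drawing n m) (δ : ℝ) : Prop where
  pos : 0 < δ
  lt : δ < 1 / 8
  radius : ∀ v, 4 * δ < D.radius v
  len : ∀ d, 4 * δ < D.len G d
  gap : ∀ v w k (y z : ℝ) (j : ℤ),
    D.X v + (0, 2 * Real.pi * j) = D.X w + y • U k + z • U (k + 1) → |z| ≤ 4 * δ → z = 0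

/-- The nonzero numbers in a coset of `2πℤ` are bounded away from zero. -/
theorem exists_angle_gap (a : ℝ) : ∃ g > (0 : ℝ), ∀ j : ℤ,
    a + 2 * Real.pi * j = 0 ∨ g ≤ |a + 2 * Real.pi * j| := by
  have hpi := Real.two_pi_pos
  have hb := toIocMod_mem_Ioc Real.two_pi_pos 0 a
  have ha := toIocMod_add_toIocDiv_zsmul Real.two_pi_pos 0 a
  set b := toIocMod Real.two_pi_pos 0 a
  set i₀ := toIocDiv Real.two_pi_pos 0 a
  rw [zsmul_eq_mul] at ha
  rw [zero_add] at hb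
  rcases eq_or_lt_of_le hb.2 with h2 | h2
  · refine ⟨2 * Real.pi, hpi, fun j => ?_⟩
    have hj : a + 2 * Real.pi * j = 2 * Real.pi * ((i₀ + 1 + j : ℤ) : ℝ) := by
      rw [← ha, h2]; push_cast; ring
    rcases eq_or_ne (i₀ + 1 + j) 0 with h0 | h0
    · left; rw [hj, h0]; simp
    · right
      have h1 : (1 : ℝ) ≤ |((i₀ + 1 + j : ℤ) : ℝ)| := by exact_mod_cast Int.one_le_abs h0
      rw [hj, abs_mul, abs_of_pos hpi]
      nlinarith
  · refine ⟨min b (2 * Real.pi - b), lt_min hb.1 (by linarith), fun j => .inr ?_⟩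
    have hj : a + 2 * Real.pi * j = b + 2 * Real.pi * ((i₀ + j : ℤ) : ℝ) := by
      rw [← ha]; push_cast; ring
    rw [hj]
    rcases lt_or_ge (i₀ + j) 0 with h0 | h0
    · have h1 : ((i₀ + j : ℤ) : ℝ) ≤ -1 := by exact_mod_cast (by omega : i₀ + j ≤ -1)
      refine (min_le_right _ _).trans (le_trans ?_ (neg_le_abs _))
      nlinarith
    · have h1 : (0 : ℝ) ≤ ((i₀ + j : ℤ) : ℝ) := by exact_mod_cast h0
      refine (min_le_left _ _).trans (le_trans ?_ (le_abs_self _))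
      nlinarith

theorem Draws.eventually_small {D : Drawing n m} (h : D.Draws R) :
    ∀ᶠ δ in 𝓝[>] (0 : ℝ), D.Small G δ := by
  have hlt : ∀ {c : ℝ}, 0 < c → ∀ᶠ δ in 𝓝[>] (0 : ℝ), 4 * δ < c := by
    intro c hc
    filter_upwards [Ioo_mem_nhdsGT (show 0 < c / 4 by linarith)] with δ hδ
    linarith [hδ.2]
  have hang : ∀ v w, ∀ᶠ δ in 𝓝[>] (0 : ℝ), ∀ j : ℤ,
      D.angle v - D.angle w + 2 * Real.pi * j = 0 ∨
        4 * δ < |D.angle v - D.angle w + 2 * Real.pi * j| := by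
    intro v w
    obtain ⟨g, hg, hgap⟩ := exists_angle_gap (D.angle v - D.angle w)
    filter_upwards [hlt hg] with δ hδ j
    exact (hgap j).imp_right hδ.trans_le
  have hrad : ∀ v w, ∀ᶠ δ in 𝓝[>] (0 : ℝ),
      D.radius v - D.radius w = 0 ∨ 4 * δ < |D.radius v - D.radius w| := by
    intro v w
    by_cases h0 : D.radius v - D.radius w = 0
    · exact Eventually.of_forall fun _ => .inl h0
    · exact (hlt (abs_pos.2 h0)).mono fun _ hδ => .inr hδ
  filter_upwards [eventually_mem_nhdsWithin, Ioo_mem_nhdsGT (show (0 : ℝ) < 1 / 8 by norm_num),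
    eventually_all.2 fun v => hlt (h.radius_pos v), eventually_all.2 fun d => hlt (h.len_pos d),
    eventually_all.2 fun v => eventually_all.2 fun w => hang v w,
    eventually_all.2 fun v => eventually_all.2 fun w => hrad v w] with δ h1 h2 h3 h4 h5 h6
  refine ⟨h1, h2.2, h3, h4, fun v w k y z j heq hz => ?_⟩
  have e1 := congrArg Prod.fst heq
  have e2 := congrArg Prod.snd heq
  rcases dir_cases k with rfl | rfl | rfl | rfl
  · rw [show (0 + 1 : ZMod 4) = 1 from rfl, U_zero, U_one] at e2
    simp [X] at e2
    have e3 : D.angle v - D.angle w + 2 * Real.pi * j = z := by linarith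
    rcases h5 v w j with h7 | h7 <;> rw [e3] at h7
    · exact h7
    · linarith
  · rw [show (1 + 1 : ZMod 4) = 2 from rfl, U_one, U_two] at e1
    simp [X] at e1
    have e3 : D.radius v - D.radius w = -z := by linarith
    rcases h6 v w with h7 | h7 <;> rw [e3] at h7
    · linarith
    · rw [abs_neg] at h7; linarith
  · rw [show (2 + 1 : ZMod 4) = 3 from rfl, U_two, U_three] at e2
    simp [X] at e2
    have e3 : D.angle v - D.angle w + 2 * Real.pi * j = -z := by linarith
    rcases h5 v w j with h7 | h7 <;> rw [e3] at h7
    · linarith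
    · rw [abs_neg] at h7; linarith
  · rw [show (3 + 1 : ZMod 4) = 0 from rfl, U_three, U_zero] at e1
    simp [X] at e1
    have e3 : D.radius v - D.radius w = z := by linarith
    rcases h6 v w with h7 | h7 <;> rw [e3] at h7
    · exact h7
    · linarith

namespace Draws

variable {D : Drawing n m} (h : D.Draws R) {δ : ℝ} (hδ : D.Small G δ)
include h

theorem segment_ne_pos (d : Fin (2 * m)) {x : ℝ} (hx : x ∈ Set.Ioo 0 (D.len G d)) (v : Fin n) :
    P (D.X (G.tail d) + x • U (D.dir d)) ≠ P (D.X v) := by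
  rw [h.P_eq_curve]
  exact h.curve_ne_pos d _ (h.div_mem hx) v

/-- The planarity of a drawing in the coordinates of radius and angle. -/
theorem segment_disjoint {d e : Fin (2 * m)} {x y : ℝ} (hx : x ∈ Set.Ioo 0 (D.len G d))
    (hy : y ∈ Set.Ioo 0 (D.len G e))
    (heq : P (D.X (G.tail d) + x • U (D.dir d)) = P (D.X (G.tail e) + y • U (D.dir e))) :
    (e = d ∧ y = x) ∨ (e = G.rev d ∧ y = D.len G d - x) := by
  rw [h.P_eq_curve, h.P_eq_curve] at heq
  rcases h.curve_disjoint d e _ (h.div_mem hx) _ (h.div_mem hy) heq with ⟨rfl, h2⟩ | ⟨rfl, h2⟩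
  · exact .inl ⟨rfl, (div_left_inj' (h.len_pos _).ne').1 h2⟩
  · refine .inr ⟨rfl, ?_⟩
    have hl := (h.len_pos d).ne'
    rw [h.len_rev] at h2
    field_simp at h2
    exact h2

include hδ

omit h in
theorem box_radius_pos (v : Fin n) {z : ℝ × ℝ} (hz : ‖z‖ ≤ δ) : 0 < (D.X v + z).1 := by
  have h1 := hδ.radius v
  have h2 := hδ.pos
  have h3 := (abs_le.1 ((norm_fst_le z).trans hz)).1
  change 0 < D.radius v + z.1
  linarith

theorem strip_radius_pos (d : Fin (2 * m)) {x a : ℝ} (hx : x ∈ Set.Icc 0 (D.len G d))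
    (ha : |a| ≤ δ) : 0 < (D.X (G.tail d) + x • U (D.dir d) + a • U (D.dir d + 1)).1 := by
  have h1 := h.lt_curve_radius d hx (hδ.radius _) (hδ.radius _)
  have h2 := hδ.pos
  have h3 : ‖a • U (D.dir d + 1)‖ ≤ δ := by rwa [norm_smul, norm_U, mul_one]
  have h4 := (abs_le.1 ((norm_fst_le _).trans h3)).1
  rw [Prod.fst_add]
  linarith

/-- Small boxes around distinct vertices are disjoint. -/
theorem box_box {v w : Fin n} {z z' : ℝ × ℝ} (hz : ‖z‖ ≤ δ) (hz' : ‖z'‖ ≤ δ)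
    (heq : P (D.X v + z) = P (D.X w + z')) : v = w ∧ z = z' := by
  have hpi := Real.pi_gt_three
  have h0 := hδ.pos
  have h8 := hδ.lt
  obtain ⟨j, hj⟩ := (P_eq_iff (box_radius_pos hδ v hz) (box_radius_pos hδ w hz')).1 heq
  have hd : ‖z' - z‖ ≤ 2 * δ := (norm_sub_le _ _).trans (by linarith)
  obtain ⟨a, b, hab, ha, hb⟩ := exists_coord (z' - z) 0
  have e1 : D.X v + (0, 2 * Real.pi * ((-j : ℤ) : ℝ)) = D.X w + (z' - z) := by
    rw [eq_sub_of_add_eq hj, Int.cast_neg, mul_neg,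
      show ((0 : ℝ), -(2 * Real.pi * (j : ℝ))) = -(0, 2 * Real.pi * (j : ℝ)) by simp]
    abel
  -- The gap condition for the angles, and then for the radii.
  have hb0 := hδ.gap v w 0 a b (-j) (by rw [e1, hab, add_assoc]) (by linarith)
  have ha0 := hδ.gap v w 3 (-b) a (-j) (by
    rw [e1, hab, show (3 : ZMod 4) + 1 = 0 from rfl, zero_add, U_three, U_one, U_zero, add_assoc]
    congr 1
    ext <;> simp) (by linarith)
  rw [ha0, hb0, zero_smul, zero_smul, add_zero] at hab
  have hvw : v = w := by
    apply h.pos_injective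
    rw [pos_eq, pos_eq, ← P_add_period (D.X v) (-j), e1, hab, add_zero]
  exact ⟨hvw, (sub_eq_zero.1 hab).symm⟩

/-- A small box around a vertex does not meet narrow strips around the edges. -/
theorem box_strip {w : Fin n} {d : Fin (2 * m)} {z : ℝ × ℝ} {x a : ℝ} (hz : ‖z‖ ≤ δ)
    (hx : x ∈ Set.Ioo δ (D.len G d - δ)) (ha : |a| ≤ δ) :
    P (D.X w + z) ≠ P (D.X (G.tail d) + x • U (D.dir d) + a • U (D.dir d + 1)) := by
  intro heq
  have h0 := hδ.pos
  have hx' : x ∈ Set.Icc 0 (D.len G d) := ⟨by linarith [hx.1], by linarith [hx.2]⟩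
  obtain ⟨j, hj⟩ := (P_eq_iff (box_radius_pos hδ w hz) (h.strip_radius_pos hδ d hx' ha)).1 heq
  obtain ⟨α, β, hab, hα, hβ⟩ := exists_coord z (D.dir d)
  have e1 : D.X w + (0, 2 * Real.pi * ((-j : ℤ) : ℝ)) =
      D.X (G.tail d) + (x - α) • U (D.dir d) + (a - β) • U (D.dir d + 1) := by
    rw [eq_sub_of_add_eq hj, hab, Int.cast_neg, mul_neg,
      show ((0 : ℝ), -(2 * Real.pi * (j : ℝ))) = -(0, 2 * Real.pi * (j : ℝ)) by simp]
    module
  have e2 := hδ.gap _ _ _ _ _ _ e1 (by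
    have := abs_sub a β
    linarith)
  rw [e2, zero_smul, add_zero] at e1
  have h1 := abs_le.1 (hα.trans hz)
  refine h.segment_ne_pos d (x := x - α) ⟨by linarith [hx.1], by linarith [hx.2]⟩ w ?_
  rw [← e1, P_add_period]

/-- Narrow strips around distinct edges are disjoint. -/
theorem strip_strip {d e : Fin (2 * m)} {x y a b : ℝ} (hx : x ∈ Set.Ioo δ (D.len G d - δ))
    (hy : y ∈ Set.Ioo δ (D.len G e - δ)) (ha : |a| ≤ δ) (hb : |b| ≤ δ)
    (heq : P (D.X (G.tail d) + x • U (D.dir d) + a • U (D.dir d + 1)) =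
      P (D.X (G.tail e) + y • U (D.dir e) + b • U (D.dir e + 1))) :
    (e = d ∧ y = x ∧ b = a) ∨ (e = G.rev d ∧ y = D.len G d - x ∧ b = -a) := by
  have h0 := hδ.pos
  have hx' : x ∈ Set.Icc 0 (D.len G d) := ⟨by linarith [hx.1], by linarith [hx.2]⟩
  have hy' : y ∈ Set.Icc 0 (D.len G e) := ⟨by linarith [hy.1], by linarith [hy.2]⟩
  have ha' := abs_le.1 ha
  have hb' := abs_le.1 hb
  obtain ⟨j, hj⟩ := (P_eq_iff (h.strip_radius_pos hδ d hx' ha) (h.strip_radius_pos hδ e hy' hb)).1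
    heq
  have e1 : D.X (G.tail d) + (0, 2 * Real.pi * ((-j : ℤ) : ℝ)) =
      D.X (G.tail e) + y • U (D.dir e) + b • U (D.dir e + 1) -
        (x • U (D.dir d) + a • U (D.dir d + 1)) := by
    rw [add_assoc] at hj
    rw [eq_sub_of_add_eq hj, Int.cast_neg, mul_neg,
      show ((0 : ℝ), -(2 * Real.pi * (j : ℝ))) = -(0, 2 * Real.pi * (j : ℝ)) by simp]
    abel
  -- Parallel edges: the gap condition makes the offsets cancel. Perpendicular edges: shifting the
  -- parameters by at most `δ` yields a common point of the edges themselves.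
  have hk0 : ∀ k : ZMod 4, k ≠ k + 1 ∧ k ≠ k + 2 ∧ k ≠ k + 3 := by decide
  have hk1 : ∀ k : ZMod 4, k + 1 ≠ k + 2 ∧ k + 3 ≠ k + 2 := by decide
  obtain ⟨i, hi⟩ : ∃ i, D.dir e = D.dir d + i := ⟨D.dir e - D.dir d, by ring⟩
  rcases dir_cases i with rfl | rfl | rfl | rfl
  · rw [add_zero] at hi
    rw [hi] at e1
    have e2 := hδ.gap _ _ (D.dir d) (y - x) (b - a) _ (by rw [e1]; module) (by
      have := abs_sub b a
      linarith)
    have e3 : P (D.X (G.tail d) + x • U (D.dir d)) = P (D.X (G.tail e) + y • U (D.dir e)) := by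
      rw [← P_add_period _ (-j), add_right_comm, e1, hi, sub_eq_zero.1 e2]
      congr 1; module
    rcases h.segment_disjoint ⟨by linarith [hx.1], by linarith [hx.2]⟩
      ⟨by linarith [hy.1], by linarith [hy.2]⟩ e3 with h1 | ⟨rfl, h1⟩
    · exact .inl ⟨h1.1, h1.2, by linarith⟩
    · rw [h.dir_rev] at hi
      exact absurd hi.symm (hk0 _).2.1
  · rw [hi, show D.dir d + 1 + 1 = D.dir d + 2 by ring, U_add_two] at e1
    exfalso
    have e3 : P (D.X (G.tail d) + (x + b) • U (D.dir d)) =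
        P (D.X (G.tail e) + (y - a) • U (D.dir e)) := by
      rw [← P_add_period _ (-j), add_right_comm, e1, hi]
      congr 1; module
    rcases h.segment_disjoint ⟨by linarith [hx.1], by linarith [hx.2]⟩
      ⟨by linarith [hy.1], by linarith [hy.2]⟩ e3 with ⟨rfl, h1⟩ | ⟨rfl, h1⟩
    · exact (hk0 _).1 hi
    · rw [h.dir_rev] at hi
      exact (hk1 _).1 hi.symm
  · rw [hi, show D.dir d + 2 + 1 = D.dir d + 3 by ring, U_add_two, U_add_three] at e1
    have e2 := hδ.gap _ _ (D.dir d) (-y - x) (-b - a) _ (by rw [e1]; module) (by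
      have := abs_sub (-b) a
      rw [abs_neg] at this
      linarith)
    have e3 : P (D.X (G.tail d) + x • U (D.dir d)) = P (D.X (G.tail e) + y • U (D.dir e)) := by
      rw [← P_add_period _ (-j), add_right_comm, e1, hi, show b = -a by linarith, U_add_two]
      congr 1; module
    rcases h.segment_disjoint ⟨by linarith [hx.1], by linarith [hx.2]⟩
      ⟨by linarith [hy.1], by linarith [hy.2]⟩ e3 with ⟨rfl, h1⟩ | h1
    · exact absurd hi (hk0 _).2.1
    · exact .inr ⟨h1.1, h1.2, by linarith⟩
  · have hU : U (D.dir d + 3 + 1) = U (D.dir d) := by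
      congr 1; linear_combination PreThickening.four_eq_zero
    rw [hi, hU, U_add_three] at e1
    exfalso
    have e3 : P (D.X (G.tail d) + (x - b) • U (D.dir d)) =
        P (D.X (G.tail e) + (y + a) • U (D.dir e)) := by
      rw [← P_add_period _ (-j), add_right_comm, e1, hi, U_add_three]
      congr 1; module
    rcases h.segment_disjoint ⟨by linarith [hx.1], by linarith [hx.2]⟩
      ⟨by linarith [hy.1], by linarith [hy.2]⟩ e3 with ⟨rfl, h1⟩ | ⟨rfl, h1⟩
    · exact (hk0 _).2.2 hi
    · rw [h.dir_rev] at hi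
      exact (hk1 _).2 hi.symm

end Draws

/-! ### Planarity of the unit grid -/

theorem lattice_coord (a b : ℤ) (k : ZMod 4) : ∃ c e : ℤ,
    (a : ℝ) • U k + (b : ℝ) • U (k + 1) = ((c : ℝ), (e : ℝ)) := by
  rcases dir_cases k with rfl | rfl | rfl | rfl
  · exact ⟨a, b, by rw [show (0 + 1 : ZMod 4) = 1 from rfl, U_zero, U_one]; ext <;> simp⟩
  · exact ⟨-b, a, by rw [show (1 + 1 : ZMod 4) = 2 from rfl, U_one, U_two]; ext <;> simp⟩
  · exact ⟨-a, -b, by rw [show (2 + 1 : ZMod 4) = 3 from rfl, U_two, U_three]; ext <;> simp⟩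
  · exact ⟨b, -a, by rw [show (3 + 1 : ZMod 4) = 0 from rfl, U_three, U_zero]; ext <;> simp⟩

theorem not_int_of_mem_Ioo {t : ℝ} (ht : t ∈ Set.Ioo (0 : ℝ) 1) (i : ℤ) : t ≠ i := by
  rintro rfl
  have h1 : 0 < i := by exact_mod_cast ht.1
  have h2 : i < 1 := by exact_mod_cast ht.2
  omega

/-- Lattice points do not lie inside unit edges of the lattice. -/
theorem lattice_ne {a b a' b' : ℤ} {k : ZMod 4} {t : ℝ} (ht : t ∈ Set.Ioo (0 : ℝ) 1) :
    ((a : ℝ), (b : ℝ)) + t • U k ≠ ((a' : ℝ), (b' : ℝ)) := by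
  intro heq
  have e1 := congrArg Prod.fst heq
  have e2 := congrArg Prod.snd heq
  rcases dir_cases k with rfl | rfl | rfl | rfl
  · rw [U_zero] at e1
    simp at e1
    exact not_int_of_mem_Ioo ht (a' - a) (by push_cast; linarith)
  · rw [U_one] at e2
    simp at e2
    exact not_int_of_mem_Ioo ht (b' - b) (by push_cast; linarith)
  · rw [U_two] at e1
    simp at e1
    exact not_int_of_mem_Ioo ht (a - a') (by push_cast; linarith)
  · rw [U_three] at e2
    simp at e2
    exact not_int_of_mem_Ioo ht (b - b') (by push_cast; linarith)

/-- Unit edges of the lattice do not cross. -/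
theorem lattice_edges {p p' : ℝ × ℝ} (hp : ∃ a b : ℤ, p = ((a : ℝ), (b : ℝ)))
    (hp' : ∃ a b : ℤ, p' = ((a : ℝ), (b : ℝ))) {k k' : ZMod 4} {t s : ℝ}
    (ht : t ∈ Set.Ioo (0 : ℝ) 1) (hs : s ∈ Set.Ioo (0 : ℝ) 1) (heq : p + t • U k = p' + s • U k') :
    (k' = k ∧ p' = p ∧ s = t) ∨ (k' = k + 2 ∧ p' = p + U k ∧ s = 1 - t) := by
  obtain ⟨a, b, rfl⟩ := hp
  obtain ⟨a', b', rfl⟩ := hp'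
  obtain ⟨i, rfl⟩ : ∃ i, k' = k + i := ⟨k' - k, by ring⟩
  have hsame : ∀ c : ℤ, s - t = c → c = 0 := by
    intro c hc
    have h1 : ((-1 : ℤ) : ℝ) < c := by push_cast; linarith [hs.1, ht.2]
    have h2 : (c : ℝ) < ((1 : ℤ) : ℝ) := by push_cast; linarith [hs.2, ht.1]
    have h3 : -1 < c := by exact_mod_cast h1
    have h4 : c < 1 := by exact_mod_cast h2
    omega
  have hopp : ∀ c : ℤ, s + t = c → c = 1 := by
    intro c hc
    have h1 : ((0 : ℤ) : ℝ) < c := by push_cast; linarith [hs.1, ht.1]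
    have h2 : (c : ℝ) < ((2 : ℤ) : ℝ) := by push_cast; linarith [hs.2, ht.2]
    have h3 : 0 < c := by exact_mod_cast h1
    have h4 : c < 2 := by exact_mod_cast h2
    omega
  -- In the coordinates along `k` and across, the difference of the lattice points is integral.
  obtain ⟨x, y, hxy⟩ : ∃ x y : ℤ,
      (((a' : ℝ), (b' : ℝ)) - ((a : ℝ), (b : ℝ)) : ℝ × ℝ) = (x : ℝ) • U k + (y : ℝ) • U (k + 1) := by
    rcases dir_cases k with rfl | rfl | rfl | rfl
    · exact ⟨a' - a, b' - b, by
        rw [show (0 + 1 : ZMod 4) = 1 from rfl, U_zero, U_one]; ext <;> simp⟩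
    · exact ⟨b' - b, a - a', by
        rw [show (1 + 1 : ZMod 4) = 2 from rfl, U_one, U_two]; ext <;> simp⟩
    · exact ⟨a - a', b - b', by
        rw [show (2 + 1 : ZMod 4) = 3 from rfl, U_two, U_three]; ext <;> simp⟩
    · exact ⟨b - b', a' - a, by
        rw [show (3 + 1 : ZMod 4) = 0 from rfl, U_three, U_zero]; ext <;> simp⟩
  have h1 : (((a' : ℝ), (b' : ℝ)) - ((a : ℝ), (b : ℝ)) : ℝ × ℝ) = t • U k - s • U (k + i) := by
    rw [sub_eq_sub_iff_add_eq_add, ← heq]; abel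
  rw [h1] at hxy
  rcases dir_cases i with rfl | rfl | rfl | rfl
  · obtain ⟨h2, h3⟩ := U_indep (k := k) (c := x - (t - s)) (e := y) (by
      rw [sub_smul, sub_add_eq_add_sub, ← hxy, add_zero]; module)
    have h4 := hsame (-x) (by push_cast; linarith)
    have h5 : s = t := by
      have : (x : ℝ) = 0 := by exact_mod_cast (by omega : x = 0)
      linarith
    refine .inl ⟨add_zero k, ?_, h5⟩
    rw [add_zero, h5, sub_self] at h1
    exact sub_eq_zero.1 h1
  · obtain ⟨h2, h3⟩ := U_indep (k := k) (c := x - t) (e := y + s) (by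
      rw [sub_smul, add_smul, sub_add_eq_add_sub, ← add_assoc, ← hxy]; module)
    exact absurd (by linarith : t = x) (not_int_of_mem_Ioo ht x)
  · rw [U_add_two] at hxy h1
    obtain ⟨h2, h3⟩ := U_indep (k := k) (c := x - (t + s)) (e := y) (by
      rw [sub_smul, sub_add_eq_add_sub, ← hxy]; module)
    have h4 := hopp x (by linarith)
    have h5 : s = 1 - t := by
      have : (x : ℝ) = 1 := by exact_mod_cast h4
      linarith
    refine .inr ⟨rfl, ?_, h5⟩
    rw [h5] at h1
    rw [sub_eq_iff_eq_add.1 h1]; module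
  · rw [U_add_three] at hxy
    obtain ⟨h2, h3⟩ := U_indep (k := k) (c := x - t) (e := y - s) (by
      rw [sub_smul, sub_smul, sub_add_sub_comm, ← hxy]; module)
    exact absurd (by linarith : t = x) (not_int_of_mem_Ioo ht x)

end Drawing

/-! ### From a drawing to a drawing of the thickening -/

namespace PreThickening

open Filter Topology Drawing GridDart

/-- The position of a grid point relative to the centre of its grid, if the grid is rotated by `c`
quarter turns. -/
noncomputable def gridVec (c : ZMod 4) (p : GridPos) : ℝ × ℝ :=
  ((p.1 : ℤ) : ℝ) • U c + ((p.2 : ℤ) : ℝ) • U (c + 1)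

theorem gridVec_zero (c : ZMod 4) : gridVec c (0, 0) = 0 := by simp [gridVec]

theorem gridVec_gridSide (c σ : ZMod 4) (s : SignType) :
    gridVec c (gridSide σ s) = U (c + σ) + ((s : ℤ) : ℝ) • U (c + σ + 1) := by
  have hneg : (((-s : SignType) : ℤ) : ℝ) = -((s : ℤ) : ℝ) := by
    rw [SignType.coe_neg]; push_cast; rfl
  rcases dir_cases σ with rfl | rfl | rfl | rfl
  · simp [gridVec, gridSide]
  · rw [show gridSide 1 s = (-s, 1) from rfl, gridVec, hneg, show c + 1 + 1 = c + 2 by ring,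
      U_add_two]
    simp; module
  · rw [show gridSide 2 s = (-1, -s) from rfl, gridVec, hneg, show c + 2 + 1 = c + 3 by ring,
      U_add_two, U_add_three]
    simp
  · rw [show gridSide 3 s = (s, -1) from rfl, gridVec, U_add_three,
      show c + 3 + 1 = c by linear_combination four_eq_zero]
    simp; module

theorem gridVec_head (c : ZMod 4) (x : GridDart) :
    gridVec c x.1.2 = gridVec c x.1.1 + U (c + x.dir) := by
  have h3 : ∀ σ, U (c + (σ + 3)) = -U (c + σ + 1) := fun σ => by
    rw [← add_assoc, U_add_three]
  have h1 : ∀ σ, U (c + (σ + 1)) = U (c + σ + 1) := fun σ => by rw [← add_assoc]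
  obtain ⟨σ, rfl | rfl | rfl | rfl | rfl | rfl⟩ := GridDart.cases x
  · rw [dir_out]; simp [out, gridVec_gridSide, gridVec_zero]
  · rw [dir_inn, ← add_assoc, U_add_two]; simp [inn, gridVec_gridSide, gridVec_zero]
  · rw [dir_cwA, h3]; simp [cwA, gridVec_gridSide]
  · rw [dir_cwB, h3]; simp [cwB, gridVec_gridSide]
  · rw [dir_ccwA, h1]; simp [ccwA, gridVec_gridSide]
  · rw [dir_ccwB, h1]; simp [ccwB, gridVec_gridSide]

theorem abs_sign_le (s : SignType) : |((s : ℤ) : ℝ)| ≤ 1 := by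
  have : ∀ s : SignType, |(s : ℤ)| ≤ 1 := by decide
  exact_mod_cast this s

theorem norm_gridVec (c : ZMod 4) (p : GridPos) : ‖gridVec c p‖ ≤ 1 := by
  rw [gridVec, Draws.norm_smul_U_add]
  exact max_le (abs_sign_le _) (abs_sign_le _)

theorem norm_gridVec_add (c : ZMod 4) (x : GridDart) {t : ℝ} (ht : t ∈ Set.Icc (0 : ℝ) 1) :
    ‖gridVec c x.1.1 + t • U (c + x.dir)‖ ≤ 1 := by
  have h1 : gridVec c x.1.1 + t • U (c + x.dir) =
      (1 - t) • gridVec c x.1.1 + t • gridVec c x.1.2 := by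
    rw [gridVec_head]; module
  rw [h1]
  refine (norm_add_le _ _).trans ?_
  rw [norm_smul, norm_smul, Real.norm_of_nonneg ht.1, Real.norm_of_nonneg (sub_nonneg.2 ht.2)]
  nlinarith [norm_gridVec c x.1.1, norm_gridVec c x.1.2, ht.1, ht.2]

theorem abs_sign_mul_le {δ : ℝ} (hδ : 0 ≤ δ) (s : SignType) : |((s : ℤ) : ℝ) * δ| ≤ δ := by
  rw [abs_mul, abs_of_nonneg hδ]
  exact mul_le_of_le_one_left hδ (abs_sign_le s)

theorem norm_smul_gridVec {δ : ℝ} (hδ : 0 ≤ δ) (c : ZMod 4) (p : GridPos) :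
    ‖δ • gridVec c p‖ ≤ δ := by
  rw [norm_smul, Real.norm_of_nonneg hδ]
  exact mul_le_of_le_one_right hδ (norm_gridVec c p)

theorem norm_smul_gridVec_add {δ : ℝ} (hδ : 0 ≤ δ) (c : ZMod 4) (x : GridDart) {t : ℝ}
    (ht : t ∈ Set.Icc (0 : ℝ) 1) : ‖δ • (gridVec c x.1.1 + t • U (c + x.dir))‖ ≤ δ := by
  rw [norm_smul, Real.norm_of_nonneg hδ]
  exact mul_le_of_le_one_right hδ (norm_gridVec_add c x ht)

theorem gridVec_injective (c : ZMod 4) : Function.Injective (gridVec c) := by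
  intro p q hpq
  have h1 : (((p.1 : ℤ) : ℝ) - ((q.1 : ℤ) : ℝ)) • U c +
      (((p.2 : ℤ) : ℝ) - ((q.2 : ℤ) : ℝ)) • U (c + 1) = 0 := by
    simp only [gridVec] at hpq
    rw [sub_smul, sub_smul, sub_add_sub_comm, hpq, sub_self]
  obtain ⟨h2, h3⟩ := U_indep h1
  have key : ∀ s t : SignType, (s : ℤ) = t → s = t := by decide
  exact Prod.ext (key _ _ (by exact_mod_cast sub_eq_zero.1 h2))
    (key _ _ (by exact_mod_cast sub_eq_zero.1 h3))

theorem exists_gridVec_eq (c : ZMod 4) (p : GridPos) :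
    ∃ a b : ℤ, gridVec c p = ((a : ℝ), (b : ℝ)) := lattice_coord _ _ _

variable {n m n' m' : ℕ} {G : EmbeddedGraph n m} {G' : EmbeddedGraph n' m'}
  {R : OrthoRep G} {R' : OrthoRep G'} (T : PreThickening R R')

/-- The drawing of the thickening in which every vertex `v` of `D` is replaced by a grid of mesh
size `δ` that is rotated by `rot v` quarter turns. -/
noncomputable def blowUp (D : Drawing n m) (rot : Fin n → ZMod 4) (δ : ℝ) : Drawing n' m' where
  radius w := (D.X (T.vtx.symm w).1 + δ • gridVec (rot (T.vtx.symm w).1) (T.vtx.symm w).2).1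
  angle w := (D.X (T.vtx.symm w).1 + δ • gridVec (rot (T.vtx.symm w).1) (T.vtx.symm w).2).2
  dir e := T.bdir e + rot (T.vtx.symm (G'.tail e)).1

/-- The lengths of the edges of `blowUp`. -/
noncomputable def blowUpLen (G : EmbeddedGraph n m) {G' : EmbeddedGraph n' m'} {R : OrthoRep G}
    {R' : OrthoRep G'} (T : PreThickening R R') (D : Drawing n m) (δ : ℝ) (e : Fin (2 * m')) : ℝ :=
  Sum.elim (fun _ : Fin n × GridDart => δ)
    (fun y : Fin (2 * m) × SignType => D.len G y.1 - 2 * δ) (T.dart.symm e)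

variable (D : Drawing n m) (rot : Fin n → ZMod 4) (δ : ℝ)

theorem blowUpLen_g (v x) : blowUpLen G T D δ (T.g v x) = δ := by simp [blowUpLen, g]

theorem blowUpLen_c (d s) : blowUpLen G T D δ (T.c d s) = D.len G d - 2 * δ := by
  simp [blowUpLen, c]

theorem X_blowUp (v : Fin n) (p : GridPos) :
    (T.blowUp D rot δ).X (T.vtx (v, p)) = D.X v + δ • gridVec (rot v) p := by
  simp [blowUp, X]
  rfl

theorem dir_blowUp_g (v : Fin n) (x : GridDart) :
    (T.blowUp D rot δ).dir (T.g v x) = rot v + x.dir := by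
  simp [blowUp, bdir_g, tail_g, add_comm]

variable {D rot}

theorem dir_blowUp_c (hrot : ∀ d, D.dir d = T.side d + rot (G.tail d)) (d : Fin (2 * m))
    (s : SignType) : (T.blowUp D rot δ).dir (T.c d s) = D.dir d := by
  simp [blowUp, bdir_c, tail_c, hrot]

/-- The points on an edge of a grid. -/
theorem blowUp_grid_point (v : Fin n) (x : GridDart) (t : ℝ) :
    (T.blowUp D rot δ).X (G'.tail (T.g v x)) + (t * δ) • U ((T.blowUp D rot δ).dir (T.g v x)) =
      D.X v + δ • (gridVec (rot v) x.1.1 + t • U (rot v + x.dir)) := by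
  rw [tail_g, X_blowUp, dir_blowUp_g]; module

/-- The points on a copy of an edge. -/
theorem blowUp_copy_point (hrot : ∀ d, D.dir d = T.side d + rot (G.tail d)) (d : Fin (2 * m))
    (s : SignType) (y : ℝ) :
    (T.blowUp D rot δ).X (G'.tail (T.c d s)) + y • U ((T.blowUp D rot δ).dir (T.c d s)) =
      D.X (G.tail d) + (δ + y) • U (D.dir d) + (((s : ℤ) : ℝ) * δ) • U (D.dir d + 1) := by
  rw [tail_c, X_blowUp, T.dir_blowUp_c δ hrot, gridVec_gridSide, add_comm (rot _), ← hrot]; module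

/-- Any directions that match `R` are obtained by rotating the grids from their standard positions.
-/
theorem exists_rotation (hV : R.VertexCondition) {dir : Fin (2 * m) → ZMod 4}
    (h : R.Matches dir) : ∃ rot : Fin n → ZMod 4, ∀ d, dir d = T.side d + rot (G.tail d) := by
  choose f hf using hV.exists_dart
  refine ⟨fun v => dir (f v) - T.side (f v), fun d => ?_⟩
  have := h.sub_eq T.side_matches (hf (G.tail d))
  beta_reduce
  rw [this]; ring

section

variable {δ} (h : D.Draws R) (hrot : ∀ d, D.dir d = T.side d + rot (G.tail d))
  (hδ : D.Small G δ)
include h hrot hδ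

/-- For a small mesh size, replacing vertices by grids keeps the drawing plane. -/
theorem draws_blowUp : (T.blowUp D rot δ).Draws R' ∧
    ∀ e, (T.blowUp D rot δ).len G' e = blowUpLen G T D δ e := by
  have h0 := hδ.pos
  have hdiv : ∀ {x : ℝ}, x ∈ Set.Ioo 0 δ → x / δ ∈ Set.Ioo (0 : ℝ) 1 := fun hx =>
    ⟨div_pos hx.1 h0, (div_lt_one h0).2 hx.2⟩
  have hgrid : ∀ v x (y : ℝ), (T.blowUp D rot δ).X (G'.tail (T.g v x)) +
      y • U ((T.blowUp D rot δ).dir (T.g v x)) =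
      D.X v + δ • (gridVec (rot v) x.1.1 + (y / δ) • U (rot v + x.dir)) := fun v x y => by
    rw [← T.blowUp_grid_point, div_mul_cancel₀ _ h0.ne']
  have hsx : ∀ {d} {y : ℝ}, y ∈ Set.Ioo 0 (D.len G d - 2 * δ) →
      δ + y ∈ Set.Ioo δ (D.len G d - δ) := fun hy => ⟨by linarith [hy.1], by linarith [hy.2]⟩
  -- Grids are compared with grids by `box_box` and the planarity of the lattice, grids with copies
  -- of edges by `box_strip`, and copies with copies by `strip_strip`.
  refine Draws.of_segments _ _ (fun w => ?_) (fun e => ?_) (fun e => ?_) (fun e he => ?_)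
    (fun e => ?_) (fun e => ?_) (fun w w' hw => ?_) (fun e x hx w => ?_)
    (fun e f x hx y hy heq => ?_) ?_
  · obtain ⟨⟨v, p⟩, rfl⟩ := T.vtx.surjective w
    have := Draws.box_radius_pos hδ v (norm_smul_gridVec h0.le (rot v) p)
    rwa [← X_blowUp] at this
  · rcases T.dart_cases e with ⟨v, x, rfl⟩ | ⟨d, s, rfl⟩
    · rwa [blowUpLen_g]
    · rw [blowUpLen_c]; linarith [hδ.len d]
  · rcases T.dart_cases e with ⟨v, x, rfl⟩ | ⟨d, s, rfl⟩
    · rw [rev_g, blowUpLen_g, blowUpLen_g]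
    · rw [rev_c, blowUpLen_c, blowUpLen_c, h.len_rev]
  · rcases T.dart_cases e with ⟨v, x, rfl⟩ | ⟨d, s, rfl⟩
    · rw [blowUpLen_g]; linarith [hδ.lt, Real.pi_gt_three]
    · rw [T.dir_blowUp_c δ hrot] at he
      rw [blowUpLen_c]; linarith [Draws.len_le_of_odd (G := G) D he]
  · rcases T.dart_cases e with ⟨v, x, rfl⟩ | ⟨d, s, rfl⟩
    · refine ⟨0, ?_⟩
      rw [blowUpLen_g, hgrid, div_self h0.ne', one_smul, ← gridVec_head, EmbeddedGraph.head, rev_g,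
        tail_g, X_blowUp]
      simp [GridDart.swap]
    · obtain ⟨j, hj⟩ := h.X_head d
      refine ⟨j, ?_⟩
      rw [blowUpLen_c, T.blowUp_copy_point δ hrot, EmbeddedGraph.head, rev_c, tail_c, X_blowUp,
        gridVec_gridSide, add_comm (rot _), ← hrot, h.dir_rev,
        show D.dir d + 2 + 1 = D.dir d + 3 by ring, U_add_two, U_add_three]
      change _ = D.X (G.head d) + _ + _
      rw [add_right_comm (D.X (G.head d)), ← hj, SignType.coe_neg]
      push_cast
      module
  · rcases T.dart_cases e with ⟨v, x, rfl⟩ | ⟨d, s, rfl⟩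
    · rw [rev_g, dir_blowUp_g, dir_blowUp_g, dir_swap]; ring
    · rw [rev_c, T.dir_blowUp_c δ hrot, T.dir_blowUp_c δ hrot, h.dir_rev]
  · obtain ⟨⟨v, p⟩, rfl⟩ := T.vtx.surjective w
    obtain ⟨⟨v', p'⟩, rfl⟩ := T.vtx.surjective w'
    rw [X_blowUp, X_blowUp] at hw
    obtain ⟨rfl, h2⟩ := h.box_box hδ (norm_smul_gridVec h0.le _ _)
      (norm_smul_gridVec h0.le _ _) hw
    rw [gridVec_injective _ (smul_right_injective _ h0.ne' h2)]
  · obtain ⟨⟨w, p⟩, rfl⟩ := T.vtx.surjective w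
    rw [X_blowUp]
    rcases T.dart_cases e with ⟨v, y, rfl⟩ | ⟨d, s, rfl⟩
    · rw [blowUpLen_g] at hx
      rw [hgrid]
      intro heq
      obtain ⟨rfl, h2⟩ := h.box_box hδ
        (norm_smul_gridVec_add h0.le _ _ (Set.Ioo_subset_Icc_self (hdiv hx)))
        (norm_smul_gridVec h0.le _ _) heq
      have h3 := smul_right_injective _ h0.ne' h2
      obtain ⟨a, b, hab⟩ := exists_gridVec_eq (rot v) y.1.1
      obtain ⟨a', b', hab'⟩ := exists_gridVec_eq (rot v) p
      rw [hab, hab'] at h3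
      exact lattice_ne (hdiv hx) h3
    · rw [blowUpLen_c] at hx
      rw [T.blowUp_copy_point δ hrot]
      exact (h.box_strip hδ (norm_smul_gridVec h0.le _ _) (hsx hx)
        (abs_sign_mul_le h0.le s)).symm
  · rcases T.dart_cases e with ⟨v, z, rfl⟩ | ⟨d, s, rfl⟩ <;>
    rcases T.dart_cases f with ⟨v', z', rfl⟩ | ⟨d', s', rfl⟩
    · rw [blowUpLen_g] at hx hy
      rw [hgrid, hgrid] at heq
      obtain ⟨rfl, h2⟩ := h.box_box hδ
        (norm_smul_gridVec_add h0.le _ _ (Set.Ioo_subset_Icc_self (hdiv hx)))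
        (norm_smul_gridVec_add h0.le _ _ (Set.Ioo_subset_Icc_self (hdiv hy))) heq
      have h3 := smul_right_injective _ h0.ne' h2
      rw [rev_g, T.g_inj, T.g_inj, blowUpLen_g]
      rcases lattice_edges (exists_gridVec_eq _ _) (exists_gridVec_eq _ _) (hdiv hx) (hdiv hy) h3
        with ⟨h4, h5, h6⟩ | ⟨h4, h5, h6⟩
      · exact .inl ⟨⟨rfl, eq_of_dir_eq _ _ (gridVec_injective _ h5) (add_left_cancel h4)⟩,
          (div_left_inj' h0.ne').1 h6⟩
      · refine .inr ⟨⟨rfl, eq_of_dir_eq _ _ ?_ ?_⟩, ?_⟩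
        · rw [← gridVec_head] at h5
          exact gridVec_injective _ h5
        · rw [dir_swap]
          exact add_left_cancel (h4.trans (add_assoc _ _ _))
        · field_simp at h6
          linarith
    · rw [blowUpLen_g] at hx
      rw [blowUpLen_c] at hy
      rw [hgrid, T.blowUp_copy_point δ hrot] at heq
      exact absurd heq (h.box_strip hδ
        (norm_smul_gridVec_add h0.le _ _ (Set.Ioo_subset_Icc_self (hdiv hx))) (hsx hy)
        (abs_sign_mul_le h0.le _))
    · rw [blowUpLen_g] at hy
      rw [blowUpLen_c] at hx
      rw [hgrid, T.blowUp_copy_point δ hrot] at heq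
      exact absurd heq.symm (h.box_strip hδ
        (norm_smul_gridVec_add h0.le _ _ (Set.Ioo_subset_Icc_self (hdiv hy))) (hsx hx)
        (abs_sign_mul_le h0.le _))
    · rw [blowUpLen_c] at hx hy
      rw [T.blowUp_copy_point δ hrot, T.blowUp_copy_point δ hrot] at heq
      have key : ∀ s t : SignType, (s : ℤ) = t → s = t := by decide
      rw [rev_c, T.c_inj, T.c_inj, blowUpLen_c]
      rcases h.strip_strip hδ (hsx hx) (hsx hy) (abs_sign_mul_le h0.le _)
        (abs_sign_mul_le h0.le _) heq with ⟨h1, h2, h3⟩ | ⟨h1, h2, h3⟩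
      · exact .inl ⟨⟨h1, key _ _ (by exact_mod_cast mul_right_cancel₀ h0.ne' h3)⟩, by linarith⟩
      · refine .inr ⟨⟨h1, key _ _ ?_⟩, by linarith⟩
        rw [← neg_mul] at h3
        rw [SignType.coe_neg]
        exact_mod_cast mul_right_cancel₀ h0.ne' h3
  · exact T.matches_bdir.add_rotation fun w => rot (T.vtx.symm w).1

/-- Every point of the drawing of the thickening lies near a vertex of `D` or beside an edge. -/
theorem blowUp_image_cases {δ₁ : ℝ} (hδ₁ : δ ≤ δ₁) {p : ℂ}
    (hp : p ∈ (T.blowUp D rot δ).image G') :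
    (∃ w z, ‖z‖ ≤ δ₁ ∧ p = P (D.X w + z)) ∨
      ∃ d, ∃ x ∈ Set.Ioo δ₁ (D.len G d - δ₁), ∃ b, |b| ≤ δ ∧
        p = P (D.X (G.tail d) + x • U (D.dir d) + b • U (D.dir d + 1)) := by
  obtain ⟨hD, hlen⟩ := T.draws_blowUp h hrot hδ
  have h0 := hδ.pos
  rcases hp with ⟨w, rfl⟩ | hp
  · obtain ⟨⟨v, p⟩, rfl⟩ := T.vtx.surjective w
    exact .inl ⟨v, _, (norm_smul_gridVec h0.le (rot v) p).trans hδ₁, by rw [pos_eq, X_blowUp]⟩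
  obtain ⟨e, t, ht, rfl⟩ := Set.mem_iUnion.1 hp
  rw [hD.curve_eq, hlen]
  rcases T.dart_cases e with ⟨v, y, rfl⟩ | ⟨d, s, rfl⟩
  · rw [blowUpLen_g, T.blowUp_grid_point]
    exact .inl ⟨v, _, (norm_smul_gridVec_add h0.le _ _ ht).trans hδ₁, rfl⟩
  · rw [blowUpLen_c, T.blowUp_copy_point δ hrot]
    have hl : 0 < D.len G d - 2 * δ := by linarith [hδ.len d]
    have hs := abs_sign_mul_le h0.le s
    have hx0 : δ ≤ δ + t * (D.len G d - 2 * δ) := by nlinarith [ht.1]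
    have hx1 : δ + t * (D.len G d - 2 * δ) ≤ D.len G d - δ := by nlinarith [ht.2]
    set x := δ + t * (D.len G d - 2 * δ)
    set b := ((s : ℤ) : ℝ) * δ
    rcases le_or_gt x δ₁ with h1 | h1
    · refine .inl ⟨G.tail d, x • U (D.dir d) + b • U (D.dir d + 1), ?_, by rw [add_assoc]⟩
      rw [Draws.norm_smul_U_add, abs_of_pos (by linarith)]
      exact max_le h1 (hs.trans hδ₁)
    rcases le_or_gt (D.len G d - δ₁) x with h2 | h2
    · refine .inl ⟨G.head d, (x - D.len G d) • U (D.dir d) + b • U (D.dir d + 1), ?_, ?_⟩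
      · rw [Draws.norm_smul_U_add, abs_of_neg (by linarith)]
        exact max_le (by linarith) (hs.trans hδ₁)
      · rw [← h.P_head]; congr 1; module
    · exact .inr ⟨d, x, ⟨h1, h2⟩, b, hs, rfl⟩

end

section

variable {T} (h : D.Draws R) (hrot : ∀ d, D.dir d = T.side d + rot (G.tail d))
include h hrot

/-- The drawing of the thickening is close to `D` even in the plane of radius and angle. -/
theorem exists_blowUp_near : ∃ Y : Set (ℝ × ℝ), IsCompact Y ∧ P '' Y ⊆ D.image G ∧
    ∀ δ, D.Small G δ → ∀ p ∈ (T.blowUp D rot δ).image G', ∃ y ∈ Y, ∃ z, ‖z‖ ≤ δ ∧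
      p = P (y + z) := by
  refine ⟨Set.range D.X ∪ ⋃ d, (fun x : ℝ => D.X (G.tail d) + x • U (D.dir d)) ''
    Set.Icc 0 (D.len G d), ?_, ?_, fun δ hδ p hp => ?_⟩
  · exact (Set.finite_range _).isCompact.union (isCompact_iUnion fun d =>
      isCompact_Icc.image (by fun_prop))
  · rintro _ ⟨y, ⟨v, rfl⟩ | hy, rfl⟩
    · exact .inl ⟨v, rfl⟩
    · obtain ⟨d, x, hx, rfl⟩ := Set.mem_iUnion.1 hy
      refine .inr (Set.mem_iUnion.2 ⟨d, x / D.len G d,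
        ⟨div_nonneg hx.1 (h.len_pos d).le, (div_le_one (h.len_pos d)).2 hx.2⟩, ?_⟩)
      exact (h.P_eq_curve d x).symm
  · rcases T.blowUp_image_cases h hrot hδ le_rfl hp with ⟨w, z, hz, rfl⟩ | ⟨d, x, hx, b, hb, rfl⟩
    · exact ⟨_, .inl ⟨w, rfl⟩, z, hz, rfl⟩
    · refine ⟨_, .inr (Set.mem_iUnion.2 ⟨d, x, ⟨?_, ?_⟩, rfl⟩), _, ?_, rfl⟩
      · linarith [hx.1, hδ.pos]
      · linarith [hx.2, hδ.pos]
      · rwa [norm_smul, norm_U, mul_one]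

/-- A compact set that avoids `D` avoids the drawing of the thickening for small mesh sizes. -/
theorem eventually_disjoint_blowUp {K : Set ℂ} (hK : IsCompact K) (hKD : K ⊆ (D.image G)ᶜ) :
    ∀ᶠ δ in 𝓝[>] (0 : ℝ), K ⊆ ((T.blowUp D rot δ).image G')ᶜ := by
  obtain ⟨Y, hY, hYD, hnear⟩ := exists_blowUp_near (T := T) h hrot
  have hopen : IsOpen (P ⁻¹' Kᶜ) := hK.isClosed.isOpen_compl.preimage continuous_P
  have hsub : Y ⊆ P ⁻¹' Kᶜ := fun y hy hyK => hKD hyK (hYD ⟨y, hy, rfl⟩)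
  obtain ⟨η, hη, hth⟩ := hY.exists_cthickening_subset_open hopen hsub
  filter_upwards [h.eventually_small, Ioo_mem_nhdsGT hη] with δ hδ hδη p hpK hp
  obtain ⟨y, hy, z, hz, rfl⟩ := hnear δ hδ p hp
  refine hth (Metric.mem_cthickening_of_dist_le (y + z) y η Y hy ?_) hpK
  rw [dist_eq_norm, add_sub_cancel_left]
  exact hz.trans hδη.2.le

/-- The drawings of the thickening are uniformly bounded. -/
theorem exists_blowUp_bound : ∃ ρ : ℝ, ∀ᶠ δ in 𝓝[>] (0 : ℝ),
    ∀ p ∈ (T.blowUp D rot δ).image G', ‖p‖ ≤ ρ := by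
  obtain ⟨Y, hY, -, hnear⟩ := exists_blowUp_near (T := T) h hrot
  obtain ⟨ρ, hρ⟩ := hY.isBounded.exists_norm_le
  refine ⟨ρ + 1, ?_⟩
  filter_upwards [h.eventually_small] with δ hδ p hp
  obtain ⟨y, hy, z, hz, rfl⟩ := hnear δ hδ p hp
  have h1 : ‖P (y + z)‖ = |(y + z).1| := by
    rw [P, polar, norm_mul, Complex.norm_exp_ofReal_mul_I, mul_one, Complex.norm_real,
      Real.norm_eq_abs]
  rw [h1]
  have h2 := norm_fst_le (y + z)
  rw [Real.norm_eq_abs] at h2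
  linarith [norm_add_le y z, hρ y hy, hδ.lt]

/-- A connection inside a region of `D` survives the replacement of vertices by small grids. -/
theorem eventually_mem_region_blowUp {p q : ℂ} (hq : q ∈ D.region G p) :
    ∀ᶠ δ in 𝓝[>] (0 : ℝ), q ∈ (T.blowUp D rot δ).region G' p := by
  have hp : p ∈ (D.image G)ᶜ := by
    by_contra hp
    rw [region, connectedComponentIn_eq_empty hp] at hq
    exact hq
  have hopen : IsOpen (D.region G p) := h.isCompact_image.isClosed.isOpen_compl.connectedComponentIn
  have hconn : IsConnected (D.region G p) := isConnected_connectedComponentIn_iff.2 hp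
  obtain ⟨γ, hγ⟩ := (hopen.isConnected_iff_isPathConnected.1 hconn).joinedIn p
    (mem_connectedComponentIn hp) q hq
  have hK : Set.range γ ⊆ (D.image G)ᶜ := by
    rintro _ ⟨t, rfl⟩
    exact connectedComponentIn_subset _ _ (hγ t)
  filter_upwards [eventually_disjoint_blowUp h hrot (isCompact_range γ.continuous) hK] with δ hδ
  exact (isPreconnected_range γ.continuous).subset_connectedComponentIn ⟨0, γ.source⟩ hδ
    ⟨1, γ.target⟩

/-- The region on the left of a dart `d` of `D` corresponds to the region on the left of the
leftmost copy of `d`. -/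
theorem region_blowUp (d : Fin (2 * m)) : ∀ᶠ ε in 𝓝[>] (0 : ℝ), ∀ᶠ δ in 𝓝[>] (0 : ℝ),
    ∀ᶠ ε' in 𝓝[>] (0 : ℝ),
      (T.blowUp D rot δ).region G' ((T.blowUp D rot δ).leftPoint G' (T.c d 1) ε') =
        (T.blowUp D rot δ).region G' (D.leftPoint G d ε) := by
  obtain ⟨δ₁, hδ₁⟩ := h.eventually_small.exists
  have hl := hδ₁.len d
  have h1 := hδ₁.pos
  have hrad := h.curve_radius_pos d (x := D.len G d / 2) ⟨by linarith, by linarith⟩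
  filter_upwards [Draws.leftPoint_near D d hrad (h.curve_half d) h1] with ε ⟨α, β, hα, hβ, hε⟩
  filter_upwards [h.eventually_small, Ioo_mem_nhdsGT hβ.1] with δ hδ hδβ
  have hδlt : δ < δ₁ := hδβ.2.trans hβ.2
  obtain ⟨hD, hlen⟩ := T.draws_blowUp h hrot hδ
  have hmid := hD.curve_half (T.c d 1)
  have hradm := hD.curve_radius_pos (T.c d 1) (x := (T.blowUp D rot δ).len G' (T.c d 1) / 2)
    ⟨by linarith [hD.len_pos (T.c d 1)], by linarith [hD.len_pos (T.c d 1)]⟩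
  have hpt : (T.blowUp D rot δ).X (G'.tail (T.c d 1)) +
      ((T.blowUp D rot δ).len G' (T.c d 1) / 2) • U ((T.blowUp D rot δ).dir (T.c d 1)) =
      D.X (G.tail d) + (D.len G d / 2) • U (D.dir d) + δ • U (D.dir d + 1) := by
    rw [T.blowUp_copy_point δ hrot, hlen, blowUpLen_c]
    simp only [SignType.coe_one, Int.cast_one]
    module
  filter_upwards [Draws.leftPoint_near _ (T.c d 1) hradm hmid (sub_pos.2 hδlt)]
    with ε' ⟨α', β', hα', hβ', hε'⟩
  rw [hε, hε', hpt, T.dir_blowUp_c δ hrot]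
  -- A box beside the middle of `d`, to the left of all copies of `d`, contains both left points.
  set A := (fun z : ℝ × ℝ => P (D.X (G.tail d) + (D.len G d / 2 + z.1) • U (D.dir d) +
    z.2 • U (D.dir d + 1))) '' (Set.Ioo (-δ₁) δ₁ ×ˢ Set.Ioo δ δ₁) with hA
  have hAc : IsPreconnected A :=
    (isPreconnected_Ioo.prod isPreconnected_Ioo).image _
      (continuous_P.comp (by fun_prop)).continuousOn
  refine Draws.region_eq hAc ?_ ⟨(α', δ + β'), ⟨?_, ?_⟩, ?_⟩ ⟨(α, β), ⟨?_, ?_⟩, ?_⟩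
  · rintro _ ⟨⟨a, b⟩, ⟨ha, hb⟩, rfl⟩ hmem
    simp only at ha hb hmem
    have hx : D.len G d / 2 + a ∈ Set.Ioo δ₁ (D.len G d - δ₁) :=
      ⟨by linarith [ha.1], by linarith [ha.2]⟩
    have hb' : |b| ≤ δ₁ := by
      rw [abs_of_pos (by linarith [hb.1, hδ.pos])]; exact hb.2.le
    rcases T.blowUp_image_cases h hrot hδ hδlt.le hmem with
      ⟨w, z, hz, heq⟩ | ⟨e, x, hxe, b', hb'', heq⟩
    · exact h.box_strip hδ₁ hz hx hb' heq.symm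
    · have h2 := abs_le.1 hb''
      rcases h.strip_strip hδ₁ hx hxe hb' (hb''.trans hδlt.le) heq with h3 | h3 <;>
      linarith [h3.2.2, hb.1]
  · have := abs_lt.1 hα'
    exact ⟨by linarith [hδ.pos], by linarith [hδ.pos]⟩
  · exact ⟨by linarith [hβ'.1], by linarith [hβ'.2]⟩
  · beta_reduce
    congr 1; module
  · exact abs_lt.1 hα
  · exact ⟨hδβ.2, hβ.2⟩
  · beta_reduce
    congr 1; module

end

end PreThickening

open Filter Topology Drawing PreThickening in
/-- A drawing of the representation yields a drawing of the thickening. -/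
theorem Thickening.drawable_of_drawable {n m n' m' : ℕ} {G : EmbeddedGraph n m}
    {G' : EmbeddedGraph n' m'} {R : OrthoRep G} {R' : OrthoRep G'} (T' : Thickening R R')
    (hV : R.VertexCondition) (hR : R.Drawable) : R'.Drawable := by
  let T := T'.pre
  obtain ⟨D, hD⟩ := hR
  have h := hD.draws
  obtain ⟨rot, hrot⟩ := T.exists_rotation hV h.angles
  obtain ⟨dc, hdc⟩ := Quotient.exists_rep R.central
  obtain ⟨d_o, hdo⟩ := Quotient.exists_rep R.outer
  obtain ⟨ε₁, hε₁, hε₁'⟩ := ((hD.central dc hdc).and (region_blowUp h hrot dc)).exists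
  obtain ⟨ε₂, hε₂, hε₂'⟩ := ((hD.outer d_o hdo).and (region_blowUp h hrot d_o)).exists
  obtain ⟨ρ, hρ⟩ := exists_blowUp_bound (T := T) h hrot
  -- A point of the outer region outside a disc that contains all drawings of the thickening.
  obtain ⟨q, hq, hqρ⟩ : ∃ q ∈ D.region G (D.leftPoint G d_o ε₂), max ρ 0 < ‖q‖ := by
    by_contra! hcon
    exact hε₂ (isBounded_iff_forall_norm_le.2 ⟨_, hcon⟩)
  obtain ⟨δ, hδ, hc, hc', ho, ho', hb⟩ := (h.eventually_small.and
    ((eventually_mem_region_blowUp h hrot hε₁).and (hε₁'.and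
      ((eventually_mem_region_blowUp h hrot hq).and (hε₂'.and hρ))))).exists
  have hD' := (T.draws_blowUp h hrot hδ).1
  refine ⟨T.blowUp D rot δ, hD'.realizes (fun e he => ?_) (fun e he => ?_)⟩
  · refine hD'.region_face (fun S => (0 : ℂ) ∈ S) ((T'.central dc hdc).trans he.symm) ?_
    filter_upwards [hc'] with ε' hε'
    rw [show T'.dart (.inr (dc, 1)) = T.c dc 1 from rfl, hε']
    exact hc
  · refine hD'.region_face (fun S => ¬ Bornology.IsBounded S)
      ((T'.outer d_o hdo).trans he.symm) ?_
    filter_upwards [ho'] with ε' hε'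
    rw [show T'.dart (.inr (d_o, 1)) = T.c d_o 1 from rfl, hε']
    -- The ray from `q` to infinity does not meet the drawing.
    have hray : (fun t : ℝ => (t : ℂ) * q) '' Set.Ici 1 ⊆
        (T.blowUp D rot δ).region G' (D.leftPoint G d_o ε₂) := by
      rw [region, connectedComponentIn_eq ho]
      refine (isPreconnected_Ici.image _ (by fun_prop)).subset_connectedComponentIn
        ⟨1, Set.self_mem_Ici, by simp⟩ ?_
      rintro _ ⟨t, ht, rfl⟩ hmem
      have h1 := hb _ hmem
      have h2 : (1 : ℝ) ≤ t := ht
      rw [norm_mul, Complex.norm_real, Real.norm_of_nonneg (by linarith)] at h1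
      nlinarith [le_max_left ρ 0, norm_nonneg q]
    intro hbd
    obtain ⟨C, hC⟩ := isBounded_iff_forall_norm_le.1 hbd
    have hq0 : 0 < ‖q‖ := (le_max_right ρ 0).trans_lt hqρ
    have h3 := hC _ (hray ⟨max 1 ((C + 1) / ‖q‖), Set.mem_Ici.2 (le_max_left _ _), rfl⟩)
    rw [norm_mul, Complex.norm_real, Real.norm_of_nonneg (le_trans zero_le_one (le_max_left _ _))]
      at h3
    have h4 := mul_le_mul_of_nonneg_right (le_max_right 1 ((C + 1) / ‖q‖)) hq0.le
    rw [div_mul_cancel₀ _ hq0.ne'] at h4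
    linarith

/-! ### Existence of thickenings -/

open Classical in
/-- Directed objects at points, at most one for each of the four directions, have a circular order
around each point. -/
theorem exists_circularOrder {X V : Type*} [Finite X] (t : X → V) (dir : X → ZMod 4)
    (hinj : ∀ x y, t x = t y → dir x = dir y → x = y) :
    ∃ (next : Equiv.Perm X) (turn : X → ℕ), ∀ x, turn x ∈ Finset.Icc 1 4 ∧
      dir (next x) = dir x + (turn x : ZMod 4) ∧
      (∀ j : ℕ, 0 < j → j < turn x → ∀ y, t y = t x → dir y ≠ dir x + (j : ZMod 4)) ∧
      ∀ y, t x = t y ↔ next.SameCycle x y := by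
  have hex : ∀ x, ∃ j : ℕ, 0 < j ∧ ∃ y, t y = t x ∧ dir y = dir x + (j : ZMod 4) := fun x =>
    ⟨4, by norm_num, x, rfl, by
      rw [show ((4 : ℕ) : ZMod 4) = 0 from rfl, add_zero]⟩
  have hspec := fun x => Nat.find_spec (hex x)
  have hmin : ∀ x (j : ℕ), 0 < j → j < Nat.find (hex x) → ∀ y, t y = t x →
      dir y ≠ dir x + (j : ZMod 4) := fun x j h0 hj y hy hd =>
    Nat.find_min (hex x) hj ⟨h0, y, hy, hd⟩
  have hle : ∀ x, Nat.find (hex x) ≤ 4 := fun x => Nat.find_min' (hex x)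
    ⟨by norm_num, x, rfl, by rw [show ((4 : ℕ) : ZMod 4) = 0 from rfl, add_zero]⟩
  -- The successor of `x` is the first object in counter-clockwise direction, possibly `x` itself
  -- after a full turn.
  choose hpos f hf hdir using hspec
  have key : ∀ x y, f x = f y → Nat.find (hex x) ≤ Nat.find (hex y) → x = y := by
    intro x y hxy hle
    have h1 : t x = t y := by rw [← hf x, hxy, hf y]
    have h2 := hdir x
    rw [hxy, hdir y] at h2
    rcases hle.eq_or_lt with h3 | h3
    · rw [h3] at h2
      exact hinj x y h1 (add_right_cancel h2).symm
    · refine absurd ?_ (hmin y (Nat.find (hex y) - Nat.find (hex x)) (by omega)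
        (by have := hpos x; omega) x h1)
      rw [Nat.cast_sub hle]
      linear_combination -h2
  have hfinj : Function.Injective f := fun x y hxy =>
    (le_total _ _).elim (key x y hxy) fun h => (key y x hxy.symm h).symm
  let next : Equiv.Perm X := Equiv.ofBijective f (Finite.injective_iff_bijective.1 hfinj)
  refine ⟨next, fun x => Nat.find (hex x), fun x =>
    ⟨Finset.mem_Icc.2 ⟨hpos x, hle x⟩, hdir x, hmin x, fun y => ⟨fun hxy => ?_, ?_⟩⟩⟩
  · have main : ∀ (k : ℕ) (x : X), t x = t y → dir y = dir x + (k : ZMod 4) →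
        next.SameCycle x y := by
      intro k
      induction k using Nat.strong_induction_on with
      | _ k ih =>
        intro x hxy hd
        rcases Nat.eq_zero_or_pos k with rfl | hk
        · rw [Nat.cast_zero, add_zero] at hd
          rw [hinj x y hxy hd.symm]
        · have h1 : Nat.find (hex x) ≤ k := by
            by_contra hlt
            exact hmin x k hk (not_le.1 hlt) y hxy.symm hd
          have h2 := ih (k - Nat.find (hex x)) (by have := hpos x; omega) (f x)
            ((hf x).trans hxy) (by rw [hdir, hd, Nat.cast_sub h1]; ring)
          exact Equiv.Perm.sameCycle_apply_left.1 h2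
    exact main (dir y - dir x).val x hxy (by rw [ZMod.natCast_zmod_val]; ring)
  · rintro ⟨i, rfl⟩
    have h1 : ∀ x, t (next x) = t x := hf
    have h2 : ∀ x, t (next.symm x) = t x := fun x => by
      conv_rhs => rw [← next.apply_symm_apply x]
      exact (h1 _).symm
    induction i using Int.induction_on with
    | zero => rfl
    | succ i ih => rw [add_comm, zpow_add, zpow_one, Equiv.Perm.mul_apply, h1, ih]
    | pred i ih =>
      rw [show (-(i : ℤ) - 1) = -1 + -(i : ℤ) by ring, zpow_add, zpow_neg_one,
        Equiv.Perm.mul_apply]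
      exact ih.trans (h2 _).symm

/-- The directions obtained from a choice of one dart per vertex, by summing up the angles
between the chosen dart and a given one. -/
theorem OrthoRep.VertexCondition.exists_matches {n m : ℕ} {G : EmbeddedGraph n m}
    {R : OrthoRep G} (hV : R.VertexCondition) (root : Fin n → Fin (2 * m))
    (hroot : ∀ v, G.tail (root v) = v) :
    ∃ a : Fin (2 * m) → ℕ, R.Matches (fun d => (a d : ZMod 4)) ∧ ∀ d, a d < 4 ∧ ∃ k ≤ 3,
      (G.next ^ k) (root (G.tail d)) = d ∧
      a d = ∑ i ∈ Finset.range k, R.turn ((G.next ^ i) (root (G.tail d))) ∧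
      ∀ i < k, (G.next ^ i) (root (G.tail d)) ≠ d := by
  classical
  have hex := fun d => hV.exists_pow (hroot (G.tail d)).symm
  choose k hk3 hk hsum hmin using hex
  set r := fun d => root (G.tail d) with hr
  set a := fun d => ∑ i ∈ Finset.range (k d), R.turn ((G.next ^ i) (r d)) with ha
  replace hsum : ∀ d, a d + R.turn d ≤ 4 := hsum
  have hlt : ∀ d, a d < 4 := fun d => by
    have := hsum d; have := R.turn_pos d
    omega
  -- Along the circular order from the root on, the sums increase.
  have hmono : ∀ d e, G.tail d = G.tail e → k d < k e → a d + R.turn d ≤ a e := by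
    intro d e hde hlt
    have hrr : r d = r e := by simp only [hr, hde]
    have h1 : a d + R.turn d = ∑ i ∈ Finset.range (k d + 1), R.turn ((G.next ^ i) (r e)) := by
      rw [Finset.sum_range_succ, ← hrr, hk]
    rw [h1]
    exact Finset.sum_le_sum_of_subset (Finset.range_subset_range.2 hlt)
  refine ⟨a, fun d => ⟨?_, fun j h0 hj e he heq => ?_⟩, fun d => ⟨hlt d, k d, hk3 d, hk d, rfl,
    hmin d⟩⟩
  · beta_reduce
    have hrr : r (G.next d) = r d := by simp only [hr, G.tail_next]
    have h1 : (G.next ^ (k d + 1)) (r d) = G.next d := by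
      rw [pow_succ', Equiv.Perm.mul_apply, hk]
    have h2 : k (G.next d) ≤ k d + 1 := by
      by_contra hcon
      exact hmin (G.next d) _ (not_le.1 hcon) (by rw [show root _ = r d from hrr, h1])
    rcases h2.eq_or_lt with h3 | h3
    · have : a (G.next d) = a d + R.turn d := by
        simp only [ha, hrr, h3, Finset.sum_range_succ]
        rw [hk]
      rw [this]; push_cast; rfl
    -- Otherwise the successor of `d` is the root, and all darts at the vertex have been passed.
    · have h4 : k (G.next d) = 0 := by
        by_contra h5
        have h6 := hk (G.next d)
        obtain ⟨i, hi⟩ := Nat.exists_eq_succ_of_ne_zero h5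
        rw [show root _ = r d from hrr, hi, pow_succ', Equiv.Perm.mul_apply] at h6
        exact hmin d i (by omega) (G.next.injective h6)
      have h5 : a (G.next d) = 0 := by simp [ha, h4]
      have h6 : G.next d = r d := by
        have := hk (G.next d)
        rw [h4, pow_zero, Equiv.Perm.one_apply] at this
        exact this.symm.trans hrr
      have h7 : 4 ≤ a d + R.turn d := by
        rw [← hV (G.tail d)]
        have hle : ∀ e, G.tail e = G.tail d → k e ≤ k d := by
          intro e he
          by_contra hcon
          have hre : r e = r d := by simp only [hr, he]
          have h8 := hk e
          rw [show root _ = r d from hre,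
            show k e = (k e - (k d + 1)) + (k d + 1) by omega, pow_add,
            Equiv.Perm.mul_apply, h1, h6] at h8
          exact hmin e (k e - (k d + 1)) (by omega) (by rw [show root _ = r d from hre]; exact h8)
        calc ∑ e with G.tail e = G.tail d, R.turn e
            ≤ ∑ e ∈ (Finset.range (k d + 1)).image fun i => (G.next ^ i) (r d), R.turn e := by
              refine Finset.sum_le_sum_of_subset fun e he => ?_
              have he' := (Finset.mem_filter.1 he).2
              refine Finset.mem_image.2 ⟨k e, Finset.mem_range.2 (by have := hle e he'; omega), ?_⟩
              have := hk e
              rwa [he'] at this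
          _ ≤ ∑ i ∈ Finset.range (k d + 1), R.turn ((G.next ^ i) (r d)) :=
              Finset.sum_image_le_of_nonneg fun _ _ => Nat.zero_le _
          _ = a d + R.turn d := by rw [Finset.sum_range_succ, hk]
      have h8 : a d + R.turn d = 4 := le_antisymm (hsum d) h7
      rw [h5, ← Nat.cast_add, h8]; rfl
  · beta_reduce at heq
    have h1 : a d + j < 4 := by
      have := hsum d
      omega
    rw [← Nat.cast_add, ZMod.natCast_eq_natCast_iff'] at heq
    rw [Nat.mod_eq_of_lt (hlt e), Nat.mod_eq_of_lt h1] at heq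
    rcases lt_trichotomy (k d) (k e) with h | h | h
    · have := hmono d e he.symm h; omega
    · have : d = e := by
        rw [← hk d, ← hk e, h, he]
      rw [this] at heq; omega
    · have := hmono e d he h
      omega

/-- A numbering of the positions in a grid. -/
noncomputable def posEquiv : GridPos ≃ Fin 9 := Fintype.equivFinOfCardEq (by decide)

/-- A numbering of the darts of a grid. -/
noncomputable def gridDartEquiv : GridDart ≃ Fin 24 := Fintype.equivFinOfCardEq (by decide)

/-- A numbering of the three copies of a dart. -/
noncomputable def signEquiv : SignType ≃ Fin 3 := Fintype.equivFinOfCardEq (by decide)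

/-- A numbering of the vertices of a thickening. -/
noncomputable def vtxEquiv (n : ℕ) : Fin n × GridPos ≃ Fin (n * 9) :=
  ((Equiv.refl _).prodCongr posEquiv).trans finProdFinEquiv

/-- A numbering of the darts of a thickening. -/
noncomputable def dartEquiv (n m : ℕ) :
    (Fin n × GridDart) ⊕ (Fin (2 * m) × SignType) ≃ Fin (2 * (n * 12 + m * 3)) :=
  ((((Equiv.refl _).prodCongr gridDartEquiv).trans finProdFinEquiv).sumCongr
    (((Equiv.refl _).prodCongr signEquiv).trans finProdFinEquiv)).trans
    (finSumFinEquiv.trans (finCongr (by ring)))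

theorem vtxEquiv_val (n : ℕ) (v : Fin n) (p : GridPos) :
    (vtxEquiv n (v, p)).val = posEquiv p + 9 * v := rfl

theorem dartEquiv_inl (n m : ℕ) (v : Fin n) (x : GridDart) :
    (dartEquiv n m (.inl (v, x))).val = gridDartEquiv x + 24 * v := rfl

theorem dartEquiv_inr (n m : ℕ) (d : Fin (2 * m)) (s : SignType) :
    (dartEquiv n m (.inr (d, s))).val = n * 24 + (signEquiv s + 3 * d) := rfl

/-- A thickening exists for every assignment of sides, with the numberings chosen above. -/
theorem exists_thickening {n m : ℕ} {G : EmbeddedGraph n m} {R : OrthoRep G}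
    (hV : R.VertexCondition) {side : Fin (2 * m) → ZMod 4} (hside : R.Matches side) :
    ∃ (G' : EmbeddedGraph (n * 9) (n * 12 + m * 3)) (R' : OrthoRep G') (T : Thickening R R'),
      T.side = side ∧ T.vtx = vtxEquiv n ∧ T.dart = dartEquiv n m := by
  classical
  let tl : (Fin n × GridDart) ⊕ (Fin (2 * m) × SignType) → Fin n × GridPos :=
    Sum.elim (fun x => (x.1, x.2.1.1)) fun y => (G.tail y.1, gridSide (side y.1) y.2)
  let rv : (Fin n × GridDart) ⊕ (Fin (2 * m) × SignType) →
      (Fin n × GridDart) ⊕ (Fin (2 * m) × SignType) :=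
    Sum.map (fun x => (x.1, x.2.swap)) fun y => (G.rev y.1, -y.2)
  let dr : (Fin n × GridDart) ⊕ (Fin (2 * m) × SignType) → ZMod 4 :=
    Sum.elim (fun x => x.2.dir) fun y => side y.1
  have hrv : ∀ x, rv (rv x) = x := by
    rintro (⟨v, x⟩ | ⟨d, s⟩)
    · rfl
    · simp [rv, G.rev_rev]
  have hne : ∀ x, rv x ≠ x := by
    rintro (⟨v, x⟩ | ⟨d, s⟩) h
    · have h1 : x.swap = x := by simpa [rv] using h
      have h2 := GridDart.dir_swap x
      rw [h1] at h2
      have key : ∀ a : ZMod 4, a ≠ a + 2 := by decide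
      exact key _ h2
    · have h1 : G.rev d = d ∧ -s = s := by simpa [rv] using h
      exact G.rev_ne d h1.1
  let q := (dartEquiv n m).symm
  have hinj : ∀ e f, vtxEquiv n (tl (q e)) = vtxEquiv n (tl (q f)) → dr (q e) = dr (q f) →
      e = f := by
    intro e f h1 h2
    apply q.injective
    have h3 := (vtxEquiv n).injective h1
    clear h1
    revert h2 h3
    generalize q e = x
    generalize q f = y
    rcases x with ⟨v, x⟩ | ⟨d, s⟩ <;> rcases y with ⟨w, y⟩ | ⟨d', s'⟩ <;>
      simp only [tl, dr, Sum.elim_inl, Sum.elim_inr, Prod.mk.injEq] <;> rintro hd ⟨h3, h4⟩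
    · rw [h3, GridDart.eq_of_dir_eq x y h4 hd]
    · exact absurd hd (GridDart.dir_ne_of_gridSide x _ _ h4)
    · exact absurd hd.symm (GridDart.dir_ne_of_gridSide y _ _ h4.symm)
    · obtain rfl := hV.dir_injective hside h3 hd
      rw [gridSide_injective _ h4]
  obtain ⟨next, turn, hnext⟩ := exists_circularOrder _ _ hinj
  let G' : EmbeddedGraph (n * 9) (n * 12 + m * 3) :=
    { tail := fun e => vtxEquiv n (tl (q e))
      rev := fun e => q.symm (rv (q e))
      rev_rev := fun e => by simp [hrv]
      rev_ne := fun e h => hne (q e) (by rwa [Equiv.symm_apply_eq] at h)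
      next := next
      tail_eq_iff := fun d e => (hnext d).2.2.2 e }
  have hturn : ∀ e, next e = e ↔ turn e = 4 := by
    intro e
    obtain ⟨h1, h2, -, h4⟩ := hnext e
    constructor
    · intro h
      rw [h, left_eq_add, ZMod.natCast_eq_zero_iff] at h2
      have := Finset.mem_Icc.1 h1
      omega
    · intro h
      rw [h, show ((4 : ℕ) : ZMod 4) = 0 from rfl, add_zero] at h2
      exact hinj _ _ ((h4 _).2 (Equiv.Perm.SameCycle.refl _ _).apply_right).symm h2
  obtain ⟨dc, hdc⟩ := Quotient.exists_rep R.central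
  obtain ⟨d_o, hdo⟩ := Quotient.exists_rep R.outer
  let R' : OrthoRep G' :=
    { turn := turn
      turn_of_ne := fun e he => by
        have h1 := Finset.mem_Icc.1 (hnext e).1
        have h2 : turn e ≠ 4 := fun h => he ((hturn e).2 h)
        exact Finset.mem_Icc.2 ⟨h1.1, by omega⟩
      turn_of_eq := fun e he => (hturn e).1 he
      central := G'.face (dartEquiv n m (.inr (dc, 1)))
      outer := G'.face (dartEquiv n m (.inr (d_o, 1))) }
  let T : PreThickening R R' :=
    { side := side
      side_matches := hside
      vtx := vtxEquiv n
      dart := dartEquiv n m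
      tail_grid := fun v x => by simp [G', q, tl]
      rev_grid := fun v x => by simp [G', q, rv]
      tail_copy := fun d s => by simp [G', q, tl]
      rev_copy := fun d s => by simp [G', q, rv]
      matches' := fun e => ⟨(hnext e).2.1, (hnext e).2.2.1⟩ }
  exact ⟨G', R',
    { T with
      central := fun d hd => T.face_c_one hV (hd.trans hdc.symm)
      outer := fun d hd => T.face_c_one hV (hd.trans hdo.symm) }, rfl, rfl, rfl⟩

/-! ### Programs for the random access machine -/

namespace RamProg

/-- Programs without loops. -/
def LoopFree : RamProg → Prop
  | assign _ _ => True
  | store _ _ => True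
  | move _ _ => True
  | seq p q => p.LoopFree ∧ q.LoopFree
  | ite _ p q => p.LoopFree ∧ q.LoopFree
  | loop _ _ => False

/-- The final state of a program without loops. -/
noncomputable def exec : RamProg → RamState → RamState
  | assign x e, s => { s with reg := Function.update s.reg x (e.eval s) }
  | store a e, s => { s with mem := Function.update s.mem (a.eval s) (e.eval s) }
  | move a b, s => { s with real := Function.update s.real (a.eval s) (s.real (b.eval s)) }
  | seq p q, s => q.exec (p.exec s)
  | ite e p q, s => if e.eval s ≠ 0 then p.exec s else q.exec s
  | loop _ _, s => s

/-- A constant `c` such that the program halts within `c * n` steps if its loops are not nested and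
each of them makes at most `36 * n` iterations. -/
def timeConst : RamProg → ℕ
  | assign _ e => e.cost + 1
  | store a e => a.cost + e.cost + 1
  | move a b => a.cost + b.cost + 1
  | seq p q => p.timeConst + q.timeConst
  | ite e p q => e.cost + 1 + p.timeConst + q.timeConst
  | loop e p => 36 * (e.cost + 1 + p.timeConst) + (e.cost + 1)

theorem LoopFree.runs {p : RamProg} (hp : p.LoopFree) (s : RamState) :
    ∃ t ≤ p.timeConst, Runs p s t (p.exec s) := by
  induction p generalizing s with
  | assign x e => exact ⟨_, le_rfl, .assign s x e⟩
  | store a e => exact ⟨_, le_rfl, .store s a e⟩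
  | move a b => exact ⟨_, le_rfl, .move s a b⟩
  | seq p q ihp ihq =>
    obtain ⟨t₁, h1, h2⟩ := ihp hp.1 s
    obtain ⟨t₂, h3, h4⟩ := ihq hp.2 (p.exec s)
    exact ⟨_, Nat.add_le_add h1 h3, .seq h2 h4⟩
  | ite e p q ihp ihq =>
    by_cases he : e.eval s ≠ 0
    · obtain ⟨t, h1, h2⟩ := ihp hp.1 s
      refine ⟨_, ?_, by rw [exec, if_pos he]; exact .ite_true he h2⟩
      rw [timeConst]; omega
    · obtain ⟨t, h1, h2⟩ := ihq hp.2 s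
      refine ⟨_, ?_, by rw [exec, if_neg he]; exact .ite_false (not_not.1 he) h2⟩
      rw [timeConst]; omega
  | loop e p ih => exact hp.elim

/-- Started in state `s`, the program halts within the time allowed by `timeConst`, in a state with
property `Q`. -/
def Computes (n : ℕ) (p : RamProg) (s : RamState) (Q : RamState → Prop) : Prop :=
  ∃ t s', Runs p s t s' ∧ t ≤ p.timeConst * n ∧ Q s'

variable {n : ℕ} {p q : RamProg} {s : RamState} {Q Q' : RamState → Prop}

theorem LoopFree.computes (hp : p.LoopFree) (hn : 1 ≤ n) (h : Q (p.exec s)) :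
    Computes n p s Q := by
  obtain ⟨t, h1, h2⟩ := hp.runs s
  exact ⟨t, _, h2, h1.trans (Nat.le_mul_of_pos_right _ hn), h⟩

theorem Computes.seq (hp : Computes n p s Q) (hq : ∀ s', Q s' → Computes n q s' Q') :
    Computes n (seq p q) s Q' := by
  obtain ⟨t₁, s₁, h1, h2, h3⟩ := hp
  obtain ⟨t₂, s₂, h4, h5, h6⟩ := hq s₁ h3
  exact ⟨_, s₂, .seq h1 h4, by rw [timeConst, add_mul]; exact Nat.add_le_add h2 h5, h6⟩

theorem Computes.mono (hp : Computes n p s Q) (h : ∀ s', Q s' → Q' s') : Computes n p s Q' := by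
  obtain ⟨t, s', h1, h2, h3⟩ := hp
  exact ⟨t, s', h1, h2, h s' h3⟩

/-- `for` loops with counter in register `5`. -/
def forLoop (e : RamExpr) (p : RamProg) : RamProg :=
  seq (assign 5 (.const 0))
    (loop (.sub e (.reg 5)) (seq p (assign 5 (.add (.reg 5) (.const 1)))))

/-- Setting the loop counter. -/
def _root_.RamState.setCounter (s : RamState) (k : ℕ) : RamState :=
  { s with reg := Function.update s.reg 5 k }

/-- The rule for loops: an invariant that each iteration preserves holds in the end. The bound `36 *
n` on the number of iterations covers the darts of a thickening, whose number is `24 * n + 6 * m`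
with `m ≤ 2 * n`. -/
theorem LoopFree.forLoop {e : RamExpr} (hp : p.LoopFree) {N : ℕ} (hN : N ≤ 36 * n) (hn : 1 ≤ n)
    (Inv : ℕ → RamState → Prop) (h0 : Inv 0 (s.setCounter 0))
    (he : ∀ k ≤ N, ∀ s, Inv k s → e.eval s = N ∧ s.reg 5 = k)
    (hstep : ∀ k < N, ∀ s, Inv k s → (p.exec s).reg 5 = k ∧
      Inv (k + 1) ((p.exec s).setCounter (k + 1))) :
    Computes n (forLoop e p) s (Inv N) := by
  have main : ∀ i k, k + i = N → ∀ s, Inv k s → ∃ t s',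
      Runs (.loop (.sub e (.reg 5)) (.seq p (.assign 5 (.add (.reg 5) (.const 1))))) s t s' ∧
      t ≤ i * ((RamExpr.sub e (.reg 5)).cost + 1 +
        (RamProg.seq p (.assign 5 (.add (.reg 5) (.const 1)))).timeConst) +
        ((RamExpr.sub e (.reg 5)).cost + 1) ∧ Inv N s' := by
    intro i
    induction i with
    | zero =>
      intro k hk s hs
      obtain ⟨h1, h2⟩ := he k (by omega) s hs
      refine ⟨_, s, Runs.loop_stop ?_, by simp, by rwa [← hk, add_zero]⟩
      simp [RamExpr.eval, h1, h2]; omega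
    | succ i ih =>
      intro k hk s hs
      obtain ⟨h1, h2⟩ := he k (by omega) s hs
      obtain ⟨h3, h4⟩ := hstep k (by omega) s hs
      have h5 : (RamProg.seq p (.assign 5 (.add (.reg 5) (.const 1)))).LoopFree := ⟨hp, trivial⟩
      obtain ⟨t₁, h6, h7⟩ := h5.runs s
      have h8 : (RamProg.seq p (.assign 5 (.add (.reg 5) (.const 1)))).exec s =
          (p.exec s).setCounter (k + 1) := by
        simp [exec, RamExpr.eval, RamState.setCounter, h3]
      rw [h8] at h7
      obtain ⟨t₂, s₂, h9, h10, h11⟩ := ih (k + 1) (by omega) _ h4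
      refine ⟨_, s₂, .loop_step ?_ h7 h9, ?_, h11⟩
      · simp [RamExpr.eval, h1, h2]; omega
      · rw [add_mul i 1, one_mul]; omega
  refine Computes.seq (Q := fun s' => s' = s.setCounter 0) (LoopFree.computes trivial hn rfl) ?_
  rintro _ rfl
  obtain ⟨t, s', h1, h2, h3⟩ := main N 0 (by omega) _ h0
  refine ⟨t, s', h1, h2.trans ?_, h3⟩
  change _ ≤ (36 * (_ + (RamProg.seq p _).timeConst) + _) * n
  rw [add_mul (36 * _)]
  refine Nat.add_le_add ?_ (Nat.le_mul_of_pos_right _ hn)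
  rw [mul_assoc, mul_comm _ n, ← mul_assoc]
  exact Nat.mul_le_mul_right _ hN

/-- Stores to several memory cells. -/
def stores {ι : Type*} (A V : ι → RamExpr) : List ι → RamProg
  | [] => assign 5 (.reg 5)
  | i :: l => seq (store (A i) (V i)) (stores A V l)

theorem stores_loopFree {ι : Type*} (A V : ι → RamExpr) (l : List ι) : (stores A V l).LoopFree := by
  induction l with
  | nil => trivial
  | cons i l ih => exact ⟨trivial, ih⟩

/-- The states that agree with `s` outside the memory cells in `W`. -/
def _root_.RamState.AgreeOff (W : Set ℕ) (s s' : RamState) : Prop :=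
  s'.reg = s.reg ∧ s'.real = s.real ∧ ∀ c ∉ W, s'.mem c = s.mem c

/-- Stores to distinct cells in `W`, with addresses and values that do not depend on the contents of
the cells in `W`. -/
theorem exec_stores {ι : Type*} {A V : ι → RamExpr} {a v : ι → ℕ} {W : Set ℕ} {l : List ι}
    (hnd : l.Nodup) {s : RamState}
    (haW : ∀ i ∈ l, a i ∈ W) (hinj : ∀ i ∈ l, ∀ j ∈ l, a i = a j → i = j)
    (h : ∀ s', s.AgreeOff W s' → ∀ i ∈ l, (A i).eval s' = a i ∧ (V i).eval s' = v i) :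
    ((stores A V l).exec s).reg = s.reg ∧ ((stores A V l).exec s).real = s.real ∧
    (∀ i ∈ l, ((stores A V l).exec s).mem (a i) = v i) ∧
    ∀ c, (∀ i ∈ l, c ≠ a i) → ((stores A V l).exec s).mem c = s.mem c := by
  induction l generalizing s with
  | nil => simp [stores, exec, RamExpr.eval]
  | cons i l ih =>
    obtain ⟨hi, hnd⟩ := List.nodup_cons.1 hnd
    obtain ⟨h1, h2⟩ := h s ⟨rfl, rfl, fun _ _ => rfl⟩ i List.mem_cons_self
    have hs : (store (A i) (V i)).exec s = { s with mem := Function.update s.mem (a i) (v i) } := by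
      rw [exec, h1, h2]
    have ha0 := haW i List.mem_cons_self
    obtain ⟨h3, h4, h5, h6⟩ := ih hnd (s := (store (A i) (V i)).exec s)
      (fun j hj => haW j (List.mem_cons_of_mem _ hj))
      (fun j hj k hk => hinj j (List.mem_cons_of_mem _ hj) k (List.mem_cons_of_mem _ hk))
      (fun s' hs' j hj => by
        refine h s' ⟨?_, ?_, fun c hc => ?_⟩ j (List.mem_cons_of_mem _ hj)
        · rw [hs'.1, hs]
        · rw [hs'.2.1, hs]
        · rw [hs'.2.2 c hc, hs]
          exact Function.update_of_ne (fun hca => hc (by rw [hca]; exact ha0)) _ _)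
    rw [stores, exec]
    refine ⟨by rw [h3, hs], by rw [h4, hs], fun j hj => ?_, fun c hc => ?_⟩
    · rcases List.mem_cons.1 hj with rfl | hj
      · rw [h6 _ fun k hk heq => hi (by
          rwa [hinj j List.mem_cons_self k (List.mem_cons_of_mem _ hk) heq]), hs]
        exact Function.update_self _ _ _
      · exact h5 j hj
    · rw [h6 c fun j hj => hc j (List.mem_cons_of_mem _ hj), hs]
      exact Function.update_of_ne (hc i List.mem_cons_self) _ _

/-- A loop that fills memory cells `a k i` with values `v k i` that do not depend on these cells. -/
theorem computes_forLoop_stores {ι : Type*} {e : RamExpr} {A V : ι → RamExpr} {l : List ι}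
    (hnd : l.Nodup) {N : ℕ} (hN : N ≤ 36 * n) (hn : 1 ≤ n) (a v : ℕ → ι → ℕ) (W : Set ℕ)
    (haW : ∀ k < N, ∀ i ∈ l, a k i ∈ W)
    (hinj : ∀ k < N, ∀ i ∈ l, ∀ k' < N, ∀ i' ∈ l, a k i = a k' i' → k = k' ∧ i = i')
    (he : ∀ k s', (s.setCounter k).AgreeOff W s' → e.eval s' = N)
    (h : ∀ k < N, ∀ s', (s.setCounter k).AgreeOff W s' → ∀ i ∈ l,
      (A i).eval s' = a k i ∧ (V i).eval s' = v k i) :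
    Computes n (forLoop e (stores A V l)) s fun s' =>
      s'.reg = Function.update s.reg 5 N ∧ s'.real = s.real ∧
      (∀ k < N, ∀ i ∈ l, s'.mem (a k i) = v k i) ∧
      ∀ c, (∀ k < N, ∀ i ∈ l, c ≠ a k i) → s'.mem c = s.mem c := by
  refine ((stores_loopFree A V l).forLoop hN hn (fun k s' => k ≤ N →
      s'.reg = Function.update s.reg 5 k ∧ s'.real = s.real ∧
      (∀ j < k, ∀ i ∈ l, s'.mem (a j i) = v j i) ∧
      ∀ c, (∀ j < k, ∀ i ∈ l, c ≠ a j i) → s'.mem c = s.mem c) (fun _ => ?_) ?_ ?_).mono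
    fun s' h => h le_rfl
  · exact ⟨rfl, rfl, fun j hj => absurd hj (Nat.not_lt_zero _), fun _ _ => rfl⟩
  · intro k hk s' hs'
    obtain ⟨h1, h2, h3, h4⟩ := hs' hk
    refine ⟨he k s' ⟨h1, h2, fun c hc => h4 c fun j hj i hi heq => hc ?_⟩, by rw [h1]; simp⟩
    exact heq ▸ haW j (hj.trans_le hk) i hi
  · intro k hk s' hs'
    obtain ⟨h1, h2, h3, h4⟩ := hs' hk.le
    have hag : (s.setCounter k).AgreeOff W s' :=
      ⟨h1, h2, fun c hc => h4 c fun j hj i hi heq => hc (heq ▸ haW j (hj.trans hk) i hi)⟩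
    obtain ⟨g1, g2, g3, g4⟩ := exec_stores (A := A) (V := V) (a := a k) (v := v k) (W := W) hnd
      (s := s') (haW k hk) (fun i hi j hj hij => (hinj k hk i hi k hk j hj hij).2)
      (fun s'' hs'' => h k hk s'' ⟨hs''.1.trans hag.1, hs''.2.1.trans hag.2.1,
        fun c hc => (hs''.2.2 c hc).trans (hag.2.2 c hc)⟩)
    refine ⟨by rw [g1, h1]; simp, fun _ => ⟨?_, by rw [RamState.setCounter]; exact g2.trans h2, ?_, ?_⟩⟩
    · rw [RamState.setCounter, g1, h1, Function.update_idem]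
    · intro j hj i hi
      rw [RamState.setCounter]
      rcases Nat.lt_succ_iff_lt_or_eq.1 hj with hj' | rfl
      · rw [← h3 j hj' i hi]
        exact g4 _ fun i' hi' heq => by
          have := (hinj j (hj'.trans hk) i hi k hk i' hi' heq).1
          omega
      · exact g3 i hi
    · intro c hc
      rw [RamState.setCounter]
      exact (g4 c (hc k (Nat.lt_succ_self k))).trans
        (h4 c fun j hj i hi => hc j (hj.trans (Nat.lt_succ_self k)) i hi)

end RamProg

namespace RamExpr

/-- Multiplication by a constant. -/
def mul (e : RamExpr) : ℕ → RamExpr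
  | 0 => .const 0
  | k + 1 => .add (mul e k) e

theorem eval_mul (s : RamState) (e : RamExpr) (k : ℕ) : (e.mul k).eval s = k * e.eval s := by
  induction k with
  | zero => simp [mul, eval]
  | succ k ih => rw [mul, eval, ih]; ring

/-- The expression with value `f x` if `e` has the value `x < k`. -/
def table (f : ℕ → ℕ) (e : RamExpr) : ℕ → RamExpr
  | 0 => .const 0
  | k + 1 => .add (table f e k)
      (mul (.sub (.const 1) (.add (.sub e (.const k)) (.sub (.const k) e))) (f k))

theorem eval_table (s : RamState) (f : ℕ → ℕ) (e : RamExpr) (k : ℕ) :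
    (e.table f k).eval s = if e.eval s < k then f (e.eval s) else 0 := by
  induction k with
  | zero => simp [table, eval]
  | succ k ih =>
    rw [table, eval, ih, eval_mul]
    simp only [eval]
    rcases lt_trichotomy (e.eval s) k with h | h | h
    · rw [if_pos h, if_pos (by omega), show 1 - (e.eval s - k + (k - e.eval s)) = 0 by omega]
      simp
    · rw [if_neg (by omega), if_pos (by omega), h]
      simp
    · rw [if_neg (by omega), if_neg (by omega),
        show 1 - (e.eval s - k + (k - e.eval s)) = 0 by omega]
      simp

end RamExpr

/-! ### Computing a thickening -/

namespace RamProg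

open RamExpr

variable {n m : ℕ} {G : EmbeddedGraph n m} {R : OrthoRep G}

/-- The state `s` holds the representation `R` from address `0` on. -/
structure Reads (R : OrthoRep G) (s : RamState) : Prop where
  vertices : s.mem 0 = n
  edges : s.mem 1 = m
  central : ∃ d : Fin (2 * m), G.face d = R.central ∧ s.mem 2 = d
  outer : ∃ d : Fin (2 * m), G.face d = R.outer ∧ s.mem 3 = d
  tail : ∀ d : Fin (2 * m), s.mem (4 + 4 * d) = G.tail d
  rev : ∀ d : Fin (2 * m), s.mem (5 + 4 * d) = G.rev d
  next : ∀ d : Fin (2 * m), s.mem (6 + 4 * d) = G.next d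
  turn : ∀ d : Fin (2 * m), s.mem (7 + 4 * d) = R.turn d

theorem reads_of_holdsRep {s : RamState} (h : s.HoldsRep 0 R) : Reads R s := by
  obtain ⟨h1, h2, h3, h4, h5⟩ := h
  refine ⟨h1, h2, h3, h4, fun d => ?_, fun d => ?_, fun d => ?_, fun d => ?_⟩
  · rw [← (h5 d).1]
  · rw [← (h5 d).2.1]; congr 1; omega
  · rw [← (h5 d).2.2.1]; congr 1; omega
  · rw [← (h5 d).2.2.2]; congr 1; omega

theorem Reads.congr {s s' : RamState} (h : Reads R s)
    (hs : ∀ c < 4 + 8 * m, s'.mem c = s.mem c) : Reads R s' := by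
  obtain ⟨h1, h2, h3, h4, h5, h6, h7, h8⟩ := h
  refine ⟨?_, ?_, ?_, ?_, fun d => ?_, fun d => ?_, fun d => ?_, fun d => ?_⟩
  all_goals rw [hs _ (by omega)]
  exacts [h1, h2, h3, h4, h5 d, h6 d, h7 d, h8 d]

/-- Field `j` of the record of a dart in the input. -/
def field (e : RamExpr) (j : ℕ) : RamExpr := .load (.add (.const (4 + j)) (e.mul 4))

theorem eval_field (s : RamState) (e : RamExpr) (j : ℕ) :
    (field e j).eval s = s.mem (4 + j + 4 * e.eval s) := by
  simp [field, eval, eval_mul]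

/-- The number of vertices in the input. -/
def numVertices : RamExpr := .load (.const 0)

/-- The number of edges in the input. -/
def numEdges : RamExpr := .load (.const 1)

/-- The base registers: the memory is divided into the input, a table with one dart per vertex
(from the address in register `1` on), a table of the sides of the darts (register `2`), a table
of the darts of the thickening by tail and direction (register `3`), a table of the directions of
these darts (register `4`), and the output (register `0`). -/
def setup : RamProg :=
  seq (assign 1 (.add (.const 4) (numEdges.mul 8)))
    (seq (assign 2 (.add (.reg 1) numVertices))
      (seq (assign 3 (.add (.reg 2) (numEdges.mul 2)))
        (seq (assign 4 (.add (.reg 3) (numVertices.mul 36)))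
          (assign 0 (.add (.reg 4) (.add (numVertices.mul 24) (numEdges.mul 6)))))))

/-- The base registers are set and the input is still present. -/
structure Ready (R : OrthoRep G) (s : RamState) : Prop extends Reads R s where
  reg1 : s.reg 1 = 4 + 8 * m
  reg2 : s.reg 2 = 4 + 8 * m + n
  reg3 : s.reg 3 = 4 + 10 * m + n
  reg4 : s.reg 4 = 4 + 10 * m + 37 * n
  reg0 : s.reg 0 = 4 + 16 * m + 61 * n

theorem Ready.congr {s s' : RamState} (h : Ready R s)
    (hs : ∀ c < 4 + 8 * m, s'.mem c = s.mem c) (hr : ∀ x < 5, s'.reg x = s.reg x) :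
    Ready R s' :=
  ⟨h.toReads.congr hs, (hr 1 (by omega)).trans h.reg1, (hr 2 (by omega)).trans h.reg2,
    (hr 3 (by omega)).trans h.reg3, (hr 4 (by omega)).trans h.reg4, (hr 0 (by omega)).trans h.reg0⟩

theorem computes_setup (hn : 1 ≤ n) {s : RamState} (h : Reads R s) :
    Computes n setup s fun s' => Ready R s' ∧ s'.mem = s.mem := by
  refine LoopFree.computes ⟨trivial, trivial, trivial, trivial, trivial⟩ hn
    ⟨⟨h.congr fun _ _ => rfl, ?_, ?_, ?_, ?_, ?_⟩, rfl⟩ <;>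
  simp [setup, exec, eval, eval_mul, numVertices, numEdges, h.vertices, h.edges] <;> omega

/-- Storing the dart in the loop counter at its tail. -/
def rootBody : RamProg := store (.add (.reg 1) (field (.reg 5) 0)) (.reg 5)

/-- For every vertex the last dart with this tail. -/
def rootLoop : RamProg := forLoop (numEdges.mul 2) rootBody

theorem computes_rootLoop (hn : 1 ≤ n) (hm : m ≤ 2 * n) {s : RamState} (h : Ready R s)
    (root : Fin n → Fin (2 * m)) (hroot : ∀ v, G.tail (root v) = v)
    (hmax : ∀ d, d ≤ root (G.tail d)) :
    Computes n rootLoop s fun s' => Ready R s' ∧ (∀ v : Fin n, s'.mem (4 + 8 * m + v) = root v) ∧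
      ∀ c ≥ 4 + 8 * m + n, s'.mem c = s.mem c := by
  refine (LoopFree.forLoop (N := 2 * m) (p := rootBody) trivial (by omega) hn (fun k s' => k ≤ 2 * m →
      Ready R s' ∧ s'.reg 5 = k ∧ (∀ v : Fin n, ∀ d : Fin (2 * m), d.val < k → G.tail d = v →
        ∃ e : Fin (2 * m), d ≤ e ∧ G.tail e = v ∧ s'.mem (4 + 8 * m + v) = e) ∧
      ∀ c ≥ 4 + 8 * m + n, s'.mem c = s.mem c) (fun _ => ?_) ?_ ?_).mono ?_
  · refine ⟨h.congr (fun _ _ => rfl) fun x hx => ?_, by simp [RamState.setCounter],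
      fun v d hd => absurd hd (Nat.not_lt_zero _), fun _ _ => rfl⟩
    exact Function.update_of_ne (by omega) _ _
  · intro k hk s' hs'
    obtain ⟨h1, h2, -, -⟩ := hs' hk
    exact ⟨by simp [eval_mul, numEdges, eval, h1.edges], h2⟩
  · intro k hk s' hs'
    obtain ⟨h1, h2, h3, h4⟩ := hs' hk.le
    have hex : rootBody.exec s' = { s' with
        mem := Function.update s'.mem (4 + 8 * m + G.tail ⟨k, hk⟩) k } := by
      have := h1.tail ⟨k, hk⟩
      simp [rootBody, exec, eval, eval_field, h1.reg1, h2, this]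
    rw [hex]
    refine ⟨h2, fun _ => ⟨h1.congr (fun c hc => ?_) fun x hx => ?_, by simp [RamState.setCounter],
      fun v d hd hdv => ?_, fun c hc => ?_⟩⟩
    · exact Function.update_of_ne (by omega) _ _
    · exact Function.update_of_ne (by omega) _ _
    · simp only [RamState.setCounter]
      by_cases hv : G.tail ⟨k, hk⟩ = v
      · refine ⟨⟨k, hk⟩, Nat.lt_succ_iff.1 hd, hv, ?_⟩
        rw [hv, Function.update_self]
      · rcases Nat.lt_succ_iff_lt_or_eq.1 hd with hd' | hd'
        · obtain ⟨e, h5, h6, h7⟩ := h3 v d hd' hdv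
          refine ⟨e, h5, h6, ?_⟩
          rw [Function.update_of_ne (fun heq => hv (Fin.ext (by omega))), h7]
        · exact absurd (by rw [← hdv]; congr 1; exact Fin.ext hd'.symm) hv
    · rw [← h4 c hc]
      exact Function.update_of_ne (by have := (G.tail ⟨k, hk⟩).isLt; omega) _ _
  · intro s' hs'
    obtain ⟨h1, -, h3, h4⟩ := hs' le_rfl
    refine ⟨h1, fun v => ?_, h4⟩
    obtain ⟨e, h5, h6, h7⟩ := h3 v (root v) (root v).isLt (hroot v)
    rw [h7]
    have := hmax e
    rw [h6] at this
    rw [le_antisymm this h5]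

/-- One step around a vertex unless the dart in the loop counter has been reached: register `6`
holds the current dart, register `7` the sum of the angles so far. The condition is the absolute
difference of the two dart numbers. -/
def sideStep : RamProg :=
  ite (.add (.sub (.reg 6) (.reg 5)) (.sub (.reg 5) (.reg 6)))
    (seq (assign 7 (.add (.reg 7) (field (.reg 6) 3))) (assign 6 (field (.reg 6) 2)))
    (assign 7 (.reg 7))

/-- The side of the dart in the loop counter, computed with at most three steps around its tail from
the chosen dart on. -/
def sideBody : RamProg :=
  seq (assign 6 (.load (.add (.reg 1) (field (.reg 5) 0))))
    (seq (assign 7 (.const 0)) (seq sideStep (seq sideStep (seq sideStep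
      (store (.add (.reg 2) (.reg 5)) (.reg 7))))))

/-- The sides of the darts. -/
def sideLoop : RamProg := forLoop (numEdges.mul 2) sideBody

/-- The state after `i + 1` steps from the dart `r` towards the dart `d`. -/
theorem exec_sideStep {s : RamState} (h : Reads R s) {r d : Fin (2 * m)} {k : ℕ}
    (hk : (G.next ^ k) r = d) (hmin : ∀ i < k, (G.next ^ i) r ≠ d) (hs5 : s.reg 5 = d) {i : ℕ}
    (h6 : s.reg 6 = ((G.next ^ min i k) r : Fin (2 * m)))
    (h7 : s.reg 7 = ∑ j ∈ Finset.range (min i k), R.turn ((G.next ^ j) r)) :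
    (sideStep.exec s).mem = s.mem ∧ (∀ x, x ≠ 6 → x ≠ 7 → (sideStep.exec s).reg x = s.reg x) ∧
    (sideStep.exec s).reg 6 = ((G.next ^ min (i + 1) k) r : Fin (2 * m)) ∧
    (sideStep.exec s).reg 7 = ∑ j ∈ Finset.range (min (i + 1) k), R.turn ((G.next ^ j) r) := by
  rcases lt_or_ge i k with hik | hik
  · rw [min_eq_left hik.le] at h6 h7
    rw [min_eq_left (Nat.succ_le_of_lt hik)]
    have hne : (RamExpr.add (.sub (.reg 6) (.reg 5)) (.sub (.reg 5) (.reg 6))).eval s ≠ 0 := by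
      have h1 : s.reg 6 ≠ s.reg 5 := by
        rw [h6, hs5]; exact fun heq => hmin i hik (Fin.ext heq)
      simp only [eval]; omega
    rw [sideStep, exec, if_pos hne]
    have ht := h.turn ((G.next ^ i) r)
    have hn := h.next ((G.next ^ i) r)
    refine ⟨rfl, fun x hx hx' => ?_, ?_, ?_⟩
    · simp [exec, hx, hx']
    · simp [exec, eval_field, eval, h6, hn, pow_succ']
    · simp [exec, eval_field, eval, h6, h7, ht, Finset.sum_range_succ]
  · rw [min_eq_right hik] at h6 h7
    rw [min_eq_right (hik.trans (Nat.le_succ i))]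
    have hne : ¬ (RamExpr.add (.sub (.reg 6) (.reg 5)) (.sub (.reg 5) (.reg 6))).eval s ≠ 0 := by
      have h1 : s.reg 6 = s.reg 5 := by rw [h6, hs5, hk]
      simp only [eval]; omega
    rw [sideStep, exec, if_neg hne]
    exact ⟨rfl, fun x hx hx' => by simp [exec, hx'], by simp [exec, h6], by simp [exec, eval, h7]⟩

theorem computes_sideLoop (hn : 1 ≤ n) (hm : m ≤ 2 * n) {s : RamState} (h : Ready R s)
    {root : Fin n → Fin (2 * m)} (hs : ∀ v : Fin n, s.mem (4 + 8 * m + v) = root v)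
    {a : Fin (2 * m) → ℕ} (ha : ∀ d, ∃ k ≤ 3, (G.next ^ k) (root (G.tail d)) = d ∧
      a d = ∑ i ∈ Finset.range k, R.turn ((G.next ^ i) (root (G.tail d))) ∧
      ∀ i < k, (G.next ^ i) (root (G.tail d)) ≠ d) :
    Computes n sideLoop s fun s' => Ready R s' ∧
      (∀ d : Fin (2 * m), s'.mem (4 + 8 * m + n + d) = a d) ∧
      ∀ c ≥ 4 + 10 * m + n, s'.mem c = s.mem c := by
  refine (LoopFree.forLoop (N := 2 * m) (p := sideBody) ⟨trivial, trivial, ⟨⟨trivial, trivial⟩, trivial⟩,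
      ⟨⟨trivial, trivial⟩, trivial⟩, ⟨⟨trivial, trivial⟩, trivial⟩, trivial⟩ (by omega) hn
      (fun k s' => k ≤ 2 * m → Ready R s' ∧ s'.reg 5 = k ∧
        (∀ v : Fin n, s'.mem (4 + 8 * m + v) = root v) ∧
        (∀ d : Fin (2 * m), d.val < k → s'.mem (4 + 8 * m + n + d) = a d) ∧
        ∀ c ≥ 4 + 10 * m + n, s'.mem c = s.mem c) (fun _ => ?_) ?_ ?_).mono ?_
  · refine ⟨h.congr (fun _ _ => rfl) fun x hx => ?_, by simp [RamState.setCounter], hs,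
      fun d hd => absurd hd (Nat.not_lt_zero _), fun _ _ => rfl⟩
    exact Function.update_of_ne (by omega) _ _
  · intro k hk s' hs'
    obtain ⟨h1, h2, -⟩ := hs' hk
    exact ⟨by simp [eval_mul, numEdges, eval, h1.edges], h2⟩
  · intro k hk s' hs'
    obtain ⟨h1, h2, h3, h4, h5⟩ := hs' hk.le
    obtain ⟨i, hi3, hi, hai, hmin⟩ := ha ⟨k, hk⟩
    set s₀ : RamState := { s' with reg := Function.update (Function.update s'.reg 6
      ((RamExpr.load (.add (.reg 1) (field (.reg 5) 0))).eval s')) 7 0 } with hs₀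
    have hb : sideBody.exec s' = (store (.add (.reg 2) (.reg 5)) (.reg 7)).exec
      (sideStep.exec (sideStep.exec (sideStep.exec s₀))) := rfl
    rw [hb]
    have hr : Reads R s₀ := h1.toReads.congr fun _ _ => rfl
    have ht := h1.tail ⟨k, hk⟩
    obtain ⟨a1, a2, a3, a4⟩ := exec_sideStep (i := 0) hr hi hmin (by simpa [hs₀] using h2)
      (by simp [hs₀, eval, eval_field, h1.reg1, h2, ht, h3]) (by simp [hs₀])
    obtain ⟨b1, b2, b3, b4⟩ := exec_sideStep (i := 1) (hr.congr fun c _ => by rw [a1]) hi hmin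
      (by rw [a2 _ (by omega) (by omega)]; simpa [hs₀] using h2) a3 a4
    obtain ⟨c1, c2, c3, c4⟩ := exec_sideStep (i := 2) (hr.congr fun c _ => by rw [b1, a1]) hi hmin
      (by rw [b2 _ (by omega) (by omega), a2 _ (by omega) (by omega)]; simpa [hs₀] using h2) b3 b4
    set s₃ := sideStep.exec (sideStep.exec (sideStep.exec s₀)) with hs₃
    rw [min_eq_right hi3, ← hai] at c4
    have hreg : ∀ x, x ≠ 6 → x ≠ 7 → s₃.reg x = s'.reg x := fun x h6 h7 => by
      rw [c2 x h6 h7, b2 x h6 h7, a2 x h6 h7]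
      simp [hs₀, h6, h7]
    have hmem : s₃.mem = s'.mem := by rw [c1, b1, a1]
    have hex : (store (.add (.reg 2) (.reg 5)) (.reg 7)).exec s₃ = { s₃ with
        mem := Function.update s'.mem (4 + 8 * m + n + k) (a ⟨k, hk⟩) } := by
      simp [exec, eval, hreg 2, hreg 5, h1.reg2, h2, c4, hmem]
    rw [hex]
    refine ⟨(hreg 5 (by omega) (by omega)).trans h2, fun _ => ⟨h1.congr (fun c hc => ?_)
      fun x hx => ?_, by simp [RamState.setCounter], fun v => ?_, fun d hd => ?_, fun c hc => ?_⟩⟩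
    · exact Function.update_of_ne (by omega) _ _
    · simp only [RamState.setCounter]
      rw [Function.update_of_ne (by omega), hreg x (by omega) (by omega)]
    · rw [← h3 v]
      exact Function.update_of_ne (by omega) _ _
    · simp only [RamState.setCounter]
      rcases Nat.lt_succ_iff_lt_or_eq.1 hd with hd' | hd'
      · rw [Function.update_of_ne (by omega), h4 d hd']
      · subst hd'
        rw [Function.update_self]
    · rw [← h5 c hc]
      exact Function.update_of_ne (by omega) _ _
  · intro s' hs'
    obtain ⟨h1, -, -, h4, h5⟩ := hs' le_rfl
    exact ⟨h1, fun d => h4 d d.isLt, h5⟩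

end RamProg

/-! ### The tables of the thickening -/

namespace RamProg

open RamExpr

variable {n m : ℕ} {G : EmbeddedGraph n m} {R : OrthoRep G}
  {G' : EmbeddedGraph (n * 9) (n * 12 + m * 3)} {R' : OrthoRep G'}

/-- The memory cells that belong to a dart in the table of darts by tail and direction, in the table
of directions, and in the first half of the output record, which holds tail and reversal. -/
def cell (T : Thickening R R') (e : Fin (2 * (n * 12 + m * 3))) : Fin 4 → ℕ
  | 0 => 4 + 10 * m + n + 4 * G'.tail e + (T.pre.bdir e).val
  | 1 => 4 + 10 * m + 37 * n + e
  | 2 => 4 + 16 * m + 61 * n + 4 + 4 * e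
  | 3 => 4 + 16 * m + 61 * n + 5 + 4 * e

/-- The contents of these cells. The first table holds dart numbers plus one, so that the initial
value `0` marks the directions without darts. -/
def content (T : Thickening R R') (e : Fin (2 * (n * 12 + m * 3))) : Fin 4 → ℕ
  | 0 => e + 1
  | 1 => (T.pre.bdir e).val
  | 2 => G'.tail e
  | 3 => G'.rev e

variable {T : Thickening R R'}

theorem cell_inj (hV : R.VertexCondition) {e f : Fin (2 * (n * 12 + m * 3))} {i j : Fin 4}
    (h : cell T e i = cell T f j) : e = f ∧ i = j := by
  have h1 := (G'.tail e).isLt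
  have h2 := (G'.tail f).isLt
  have h3 := ZMod.val_lt (T.pre.bdir e)
  have h4 := ZMod.val_lt (T.pre.bdir f)
  have h5 := e.isLt
  have h6 := f.isLt
  fin_cases i <;> fin_cases j <;> simp only [cell] at h
  all_goals first
    | exact ⟨Fin.ext (by omega), rfl⟩
    | exact ⟨T.pre.bdir_injective hV _ _ (Fin.ext (by omega))
        (ZMod.val_injective 4 (by omega)), rfl⟩
    | omega

theorem le_cell (e : Fin (2 * (n * 12 + m * 3))) (i : Fin 4) : 4 + 10 * m + n ≤ cell T e i := by
  fin_cases i <;> simp only [cell] <;> omega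

/-- Filling the tables for a family of darts. -/
theorem computes_fill (hn : 1 ≤ n) (hV : R.VertexCondition) {s : RamState} (h : Ready R s)
    {κ : Type*} [DecidableEq κ] [Fintype κ] {e : RamExpr} {A V : κ × Fin 4 → RamExpr} {N : ℕ}
    (hN : N ≤ 36 * n) (E : Fin N → κ → Fin (2 * (n * 12 + m * 3)))
    (hE : ∀ k x k' x', E k x = E k' x' → k = k' ∧ x = x')
    (he : ∀ s', Ready R s' → e.eval s' = N)
    (heval : ∀ (k : Fin N) s', Ready R s' → s'.reg 5 = k →
      (∀ c < 4 + 10 * m + n, s'.mem c = s.mem c) → ∀ x i,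
        (A (x, i)).eval s' = cell T (E k x) i ∧ (V (x, i)).eval s' = content T (E k x) i) :
    Computes n (forLoop e (stores A V Finset.univ.toList)) s fun s' => Ready R s' ∧
      (∀ k x i, s'.mem (cell T (E k x) i) = content T (E k x) i) ∧
      ∀ c, (∀ k x i, c ≠ cell T (E k x) i) → s'.mem c = s.mem c := by
  have hready : ∀ k s', (s.setCounter k).AgreeOff {c | 4 + 10 * m + n ≤ c} s' →
      Ready R s' ∧ s'.reg 5 = k := by
    intro k s' hs'
    refine ⟨h.congr (fun c hc => hs'.2.2 c (by simp; omega)) fun x hx => ?_, ?_⟩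
    · rw [hs'.1]
      exact Function.update_of_ne (by omega) _ _
    · rw [hs'.1]
      exact Function.update_self 5 k s.reg
  refine (computes_forLoop_stores (A := A) (V := V) (Finset.nodup_toList Finset.univ) hN hn
    (fun k y => if hk : k < N then cell T (E ⟨k, hk⟩ y.1) y.2 else 0)
    (fun k y => if hk : k < N then content T (E ⟨k, hk⟩ y.1) y.2 else 0)
    {c | 4 + 10 * m + n ≤ c} ?_ ?_ ?_ ?_).mono ?_
  · intro k hk y _
    rw [dif_pos hk]
    exact le_cell _ _
  · intro k hk y _ k' hk' y' _ heq
    rw [dif_pos hk, dif_pos hk'] at heq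
    obtain ⟨h1, h2⟩ := cell_inj hV heq
    obtain ⟨h3, h4⟩ := hE _ _ _ _ h1
    exact ⟨congrArg Fin.val h3, Prod.ext h4 h2⟩
  · exact fun k s' hs' => he s' (hready k s' hs').1
  · intro k hk s' hs' y _
    rw [dif_pos hk, dif_pos hk]
    obtain ⟨h1, h2⟩ := hready k s' hs'
    exact heval ⟨k, hk⟩ s' h1 h2 (fun c hc => hs'.2.2 c (by simp; omega)) y.1 y.2
  · rintro s' ⟨h1, -, h3, h4⟩
    have h5 : ∀ c, (∀ k x i, c ≠ cell T (E k x) i) → s'.mem c = s.mem c := fun c hc =>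
      h4 c fun k hk y _ => by
        rw [dif_pos hk]
        exact hc _ _ _
    refine ⟨h.congr (fun c hc => h5 c fun k x i => ?_) fun x hx => ?_, fun k x i => ?_, h5⟩
    · have := le_cell (T := T) (E k x) i
      omega
    · rw [h1]
      exact Function.update_of_ne (by omega) _ _
    · have := h3 k k.isLt (x, i) (Finset.mem_toList.2 (Finset.mem_univ _))
      rwa [dif_pos k.isLt, dif_pos k.isLt] at this

/-- The number of a dart in the grid of the vertex in the loop counter. -/
noncomputable def gridNum (x : GridDart) : RamExpr :=
  .add (mul (.reg 5) 24) (.const (gridDartEquiv x))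

/-- Addresses of table entries for the darts of a grid. -/
noncomputable def gridAddr (y : GridDart × Fin 4) : RamExpr :=
  match y.2 with
  | 0 => .add (.reg 3) (.add (mul (.reg 5) 36) (.const (4 * posEquiv y.1.1.1 + y.1.dir.val)))
  | 1 => .add (.reg 4) (gridNum y.1)
  | 2 => .add (.reg 0) (.add (.const 4) ((gridNum y.1).mul 4))
  | 3 => .add (.reg 0) (.add (.const 5) ((gridNum y.1).mul 4))

/-- Table entries for the darts of a grid. -/
noncomputable def gridEntry (y : GridDart × Fin 4) : RamExpr :=
  match y.2 with
  | 0 => .add (gridNum y.1) (.const 1)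
  | 1 => .const y.1.dir.val
  | 2 => .add (mul (.reg 5) 9) (.const (posEquiv y.1.1.1))
  | 3 => gridNum y.1.swap

/-- The table entries for the darts of the grids. -/
noncomputable def gridLoop : RamProg :=
  forLoop numVertices (stores gridAddr gridEntry Finset.univ.toList)

theorem computes_gridLoop (hn : 1 ≤ n) (hV : R.VertexCondition) (hvtx : T.vtx = vtxEquiv n)
    (hdart : T.dart = dartEquiv n m) {s : RamState} (h : Ready R s) :
    Computes n gridLoop s fun s' => Ready R s' ∧
      (∀ v x i, s'.mem (cell T (T.pre.g v x) i) = content T (T.pre.g v x) i) ∧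
      ∀ c, (∀ v x i, c ≠ cell T (T.pre.g v x) i) → s'.mem c = s.mem c := by
  refine computes_fill hn hV h (by omega) T.pre.g (fun v x w y => T.pre.g_inj.1)
    (fun s' hs' => by simp [numVertices, eval, hs'.vertices]) ?_
  intro v s' hs' h5 _ x i
  have hnum : ∀ x, (T.pre.g v x).val = gridDartEquiv x + 24 * v := fun x => by
    rw [← dartEquiv_inl, ← hdart]; rfl
  have htail : (G'.tail (T.pre.g v x)).val = posEquiv x.1.1 + 9 * v := by
    rw [T.pre.tail_g, ← vtxEquiv_val, ← hvtx]; rfl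
  fin_cases i <;>
  simp only [gridAddr, gridEntry, gridNum, eval, eval_mul, cell, content, hs'.reg0, hs'.reg3,
    hs'.reg4, h5, htail, T.pre.bdir_g, T.pre.rev_g, hnum] <;>
  refine ⟨?_, ?_⟩ <;> first | trivial | omega

/-- The number of a copy of the dart with number `d`. -/
noncomputable def copyNum (d : RamExpr) (s : SignType) : RamExpr :=
  .add (numVertices.mul 24) (.add (d.mul 3) (.const (signEquiv s)))

/-- The side of the dart in the loop counter. -/
def sideExpr : RamExpr := .load (.add (.reg 2) (.reg 5))

/-- The number of a position on the side with number `k`. -/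
noncomputable def sidePos (s : SignType) (k : ℕ) : ℕ := posEquiv (gridSide (k : ZMod 4) s)

/-- Addresses of table entries for the copies of a dart. -/
noncomputable def copyAddr (y : SignType × Fin 4) : RamExpr :=
  match y.2 with
  | 0 => .add (.reg 3) (.add (mul (field (.reg 5) 0) 36)
      (sideExpr.table (fun k => 4 * sidePos y.1 k + k) 4))
  | 1 => .add (.reg 4) (copyNum (.reg 5) y.1)
  | 2 => .add (.reg 0) (.add (.const 4) ((copyNum (.reg 5) y.1).mul 4))
  | 3 => .add (.reg 0) (.add (.const 5) ((copyNum (.reg 5) y.1).mul 4))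

/-- Table entries for the copies of a dart. -/
noncomputable def copyEntry (y : SignType × Fin 4) : RamExpr :=
  match y.2 with
  | 0 => .add (copyNum (.reg 5) y.1) (.const 1)
  | 1 => sideExpr
  | 2 => .add (mul (field (.reg 5) 0) 9) (sideExpr.table (sidePos y.1) 4)
  | 3 => copyNum (field (.reg 5) 1) (-y.1)

/-- The table entries for the copies of the darts. -/
noncomputable def copyLoop : RamProg :=
  forLoop (numEdges.mul 2) (stores copyAddr copyEntry Finset.univ.toList)

theorem computes_copyLoop (hn : 1 ≤ n) (hm : m ≤ 2 * n) (hV : R.VertexCondition)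
    (hvtx : T.vtx = vtxEquiv n) (hdart : T.dart = dartEquiv n m) {s : RamState} (h : Ready R s)
    (hside : ∀ d : Fin (2 * m), s.mem (4 + 8 * m + n + d) = (T.side d).val) :
    Computes n copyLoop s fun s' => Ready R s' ∧
      (∀ d x i, s'.mem (cell T (T.pre.c d x) i) = content T (T.pre.c d x) i) ∧
      ∀ c, (∀ d x i, c ≠ cell T (T.pre.c d x) i) → s'.mem c = s.mem c := by
  refine computes_fill hn hV h (by omega) T.pre.c (fun v x w y => T.pre.c_inj.1)
    (fun s' hs' => by simp [numEdges, eval, eval_mul, hs'.edges]) ?_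
  intro d s' hs' h5 hmem x i
  have hnum : ∀ d x, (T.pre.c d x).val = n * 24 + (signEquiv x + 3 * d) := fun d x => by
    rw [← dartEquiv_inr, ← hdart]; rfl
  have htail : (G'.tail (T.pre.c d x)).val = posEquiv (gridSide (T.side d) x) + 9 * (G.tail d) := by
    rw [T.pre.tail_c, ← vtxEquiv_val, ← hvtx]; rfl
  have hs := hside d
  rw [← hmem _ (by omega)] at hs
  have ht := hs'.tail d
  have hr := hs'.rev d
  have hlt := ZMod.val_lt (T.side d)
  have hsp : sidePos x (T.side d).val = posEquiv (gridSide (T.side d) x) := by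
    rw [sidePos, ZMod.natCast_zmod_val]
  fin_cases i <;>
  simp only [copyAddr, copyEntry, copyNum, sideExpr, numVertices, eval, eval_mul, eval_table,
    eval_field, cell, content, hs'.reg0, hs'.reg2, hs'.reg3, hs'.reg4, hs'.vertices, h5, htail, hs,
    T.pre.bdir_c, show T.pre.side = T.side from rfl, T.pre.rev_c, hnum, Nat.add_zero,
    Nat.reduceAdd, ht, hr, if_pos hlt, hsp] <;>
  refine ⟨?_, ?_⟩ <;> first | trivial | omega

/-! ### The circular orders of the thickening -/

/-- The direction of the dart in the loop counter. -/
def dirExpr : RamExpr := .load (.add (.reg 4) (.reg 5))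

/-- One plus the number of the dart with the same tail in the direction with number `e` modulo `4`,
or zero if there is no such dart. -/
def atDir (e : RamExpr) : RamExpr :=
  .load (.add (.reg 3) (.add (mul (.load (.add (.reg 0) (.add (.const 4) (mul (.reg 5) 4)))) 4)
    (e.table (· % 4) 8)))

/-- The angle after the dart in the loop counter. An angle of at least `j + 1` quarter turns means
that the first `j` directions after the dart are vacant, which truncated subtraction turns into a
summand `1`. -/
def turnExpr : RamExpr :=
  let t (j : ℕ) : RamExpr := atDir (.add dirExpr (.const j))
  .add (.const 1) (.add (.sub (.const 1) (t 1))
    (.add (.sub (.const 1) (.add (t 1) (t 2))) (.sub (.const 1) (.add (t 1) (.add (t 2) (t 3))))))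

/-- The second half of the output record of a dart, which holds successor and angle. -/
noncomputable def orderLoop : RamProg :=
  forLoop (.add (numVertices.mul 24) (numEdges.mul 6))
    (stores (fun i : Fin 2 => .add (.reg 0) (.add (.const (6 + i)) (mul (.reg 5) 4)))
      (fun i => if i = 0 then .sub (atDir (.add dirExpr turnExpr)) (.const 1) else turnExpr)
      Finset.univ.toList)

theorem computes_orderLoop (hn : 1 ≤ n) (hm : m ≤ 2 * n) (hV : R.VertexCondition)
    {s : RamState} (h : Ready R s) (hcell : ∀ e i, s.mem (cell T e i) = content T e i)
    (hzero : ∀ c ≥ 4 + 10 * m + n, (∀ e i, c ≠ cell T e i) → s.mem c = 0) :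
    Computes n orderLoop s fun s' => Ready R s' ∧ ∀ e : Fin (2 * (n * 12 + m * 3)),
      s'.mem (4 + 16 * m + 61 * n + 4 + 4 * e) = G'.tail e ∧
      s'.mem (4 + 16 * m + 61 * n + 5 + 4 * e) = G'.rev e ∧
      s'.mem (4 + 16 * m + 61 * n + 6 + 4 * e) = G'.next e ∧
      s'.mem (4 + 16 * m + 61 * n + 7 + 4 * e) = R'.turn e := by
  have hM := T.pre.matches_bdir
  have hV' := T.pre.vertexCondition hV
  set W : Set ℕ := {c | ∃ k, c = 4 + 16 * m + 61 * n + 6 + 4 * k ∨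
    c = 4 + 16 * m + 61 * n + 7 + 4 * k} with hW
  -- The lookup in the table of darts by tail and direction.
  have htab : ∀ s' k, (s.setCounter k).AgreeOff W s' → ∀ (w : Fin (n * 9)) (j : ℕ), j < 4 →
      (∀ e, G'.tail e = w → T.pre.bdir e = (j : ZMod 4) →
        s'.mem (4 + 10 * m + n + 4 * w + j) = e + 1) ∧
      ((∀ e, G'.tail e = w → T.pre.bdir e ≠ (j : ZMod 4)) →
        s'.mem (4 + 10 * m + n + 4 * w + j) = 0) := by
    intro s' k hs' w j hj
    have hw := w.isLt
    have hnot : 4 + 10 * m + n + 4 * w + j ∉ W := by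
      rw [hW]
      rintro ⟨i, hi⟩
      omega
    have hval : ((j : ZMod 4)).val = j := by rw [ZMod.val_natCast, Nat.mod_eq_of_lt hj]
    rw [hs'.2.2 _ hnot]
    refine ⟨fun e h1 h2 => ?_, fun h1 => ?_⟩
    · have := hcell e 0
      simp only [cell, content, h1, h2, hval] at this
      exact this
    · refine hzero _ (by omega) fun e i heq => ?_
      have h3 := e.isLt
      have h4 := (G'.tail e).isLt
      have h5 := ZMod.val_lt (T.pre.bdir e)
      fin_cases i <;> simp only [cell] at heq
      · refine h1 e (Fin.ext (by omega)) (ZMod.val_injective 4 ?_)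
        rw [hval]; omega
      all_goals omega
  have hready : ∀ k s', (s.setCounter k).AgreeOff W s' → Ready R s' ∧ s'.reg 5 = k := by
    intro k s' hs'
    refine ⟨h.congr (fun c hc => hs'.2.2 c ?_) fun x hx => ?_, ?_⟩
    · rw [hW]
      rintro ⟨i, hi⟩
      omega
    · rw [hs'.1]
      exact Function.update_of_ne (by omega) _ _
    · rw [hs'.1]
      exact Function.update_self 5 k s.reg
  have heval : ∀ (e : Fin (2 * (n * 12 + m * 3))) s', (s.setCounter e).AgreeOff W s' →
      turnExpr.eval s' = R'.turn e ∧
      (atDir (.add dirExpr turnExpr)).eval s' = G'.next e + 1 := by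
    intro e s' hs'
    obtain ⟨hr, h5⟩ := hready _ s' hs'
    have he := e.isLt
    have h1 : s'.mem (4 + 10 * m + 37 * n + e) = (T.pre.bdir e).val := by
      rw [hs'.2.2 _ (by rw [hW]; rintro ⟨i, hi⟩; omega)]
      exact hcell e 1
    have h2 : s'.mem (4 + 16 * m + 61 * n + (4 + 4 * e)) = G'.tail e := by
      rw [hs'.2.2 _ (by rw [hW]; rintro ⟨i, hi⟩; omega), ← add_assoc]
      exact hcell e 2
    have hlt := ZMod.val_lt (T.pre.bdir e)
    have hat : ∀ (x : RamExpr) (j : ℕ), j ≤ 4 → x.eval s' = (T.pre.bdir e).val + j →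
        (atDir x).eval s' = s'.mem (4 + 10 * m + n + 4 * G'.tail e +
          ((T.pre.bdir e).val + j) % 4) := by
      intro x j hj hx
      simp only [atDir, eval, eval_mul, eval_table, hr.reg0, hr.reg3, h5, h2, hx]
      rw [if_pos (by omega)]
      congr 1; omega
    have hdir : dirExpr.eval s' = (T.pre.bdir e).val := by
      simp only [dirExpr, eval, hr.reg4, h5, h1]
    have hcast : ∀ j : ℕ, ((((T.pre.bdir e).val + j) % 4 : ℕ) : ZMod 4) = T.pre.bdir e + j := by
      intro j
      rw [ZMod.natCast_mod]; push_cast; rw [ZMod.natCast_zmod_val]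
    have hz : ∀ j : ℕ, 0 < j → j < R'.turn e →
        (atDir (.add dirExpr (.const j))).eval s' = 0 := by
      intro j h0 hj
      have h4 := R'.turn_le e
      rw [hat _ j (by omega) (by simp only [eval, hdir])]
      refine (htab s' _ hs' _ _ (Nat.mod_lt _ (by norm_num))).2 fun f hf => ?_
      rw [hcast]
      exact (hM e).2 j h0 hj f hf
    have hnz : ∀ x : RamExpr, x.eval s' = (T.pre.bdir e).val + R'.turn e →
        (atDir x).eval s' = G'.next e + 1 := by
      intro x hx
      have h4 := R'.turn_le e
      rw [hat _ _ h4 hx]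
      refine (htab s' _ hs' _ _ (Nat.mod_lt _ (by norm_num))).1 _ (G'.tail_next e) ?_
      rw [hcast]
      exact (hM e).1
    have hturn : turnExpr.eval s' = R'.turn e := by
      have h4 := R'.turn_le e
      have h0 := R'.turn_pos e
      have hnz' := hnz (.add dirExpr (.const (R'.turn e))) (by simp only [eval, hdir])
      simp only [turnExpr, eval]
      generalize R'.turn e = t at *
      obtain rfl | rfl | rfl | rfl : t = 1 ∨ t = 2 ∨ t = 3 ∨ t = 4 := by omega
      · omega
      · have := hz 1 (by omega) (by omega)
        omega
      · have := hz 1 (by omega) (by omega)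
        have := hz 2 (by omega) (by omega)
        omega
      · have := hz 1 (by omega) (by omega)
        have := hz 2 (by omega) (by omega)
        have := hz 3 (by omega) (by omega)
        omega
    exact ⟨hturn, hnz _ (by simp only [eval, hdir, hturn])⟩
  refine (computes_forLoop_stores (ι := Fin 2) (N := 2 * (n * 12 + m * 3))
    (Finset.nodup_toList Finset.univ) (by omega) hn
    (fun k (i : Fin 2) => 4 + 16 * m + 61 * n + 6 + i + 4 * k)
    (fun k i => if hk : k < 2 * (n * 12 + m * 3) then
      if i = 0 then (G'.next ⟨k, hk⟩ : ℕ) else R'.turn ⟨k, hk⟩ else 0) W ?_ ?_ ?_ ?_).mono ?_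
  · intro k hk i _
    fin_cases i
    · exact ⟨k, .inl rfl⟩
    · exact ⟨k, .inr rfl⟩
  · intro k hk i _ k' hk' i' _ heq
    have h1 := i.isLt
    have h2 := i'.isLt
    exact ⟨by omega, Fin.ext (by omega)⟩
  · intro k s' hs'
    obtain ⟨h1, -⟩ := hready k s' hs'
    simp only [numVertices, numEdges, eval, eval_mul, h1.vertices, h1.edges]
    omega
  · intro k hk s' hs' i _
    obtain ⟨h1, h2⟩ := hready k s' hs'
    obtain ⟨h3, h4⟩ := heval ⟨k, hk⟩ s' hs'
    rw [dif_pos hk]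
    refine ⟨by simp only [eval, eval_mul, h1.reg0, h2]; omega, ?_⟩
    split_ifs
    · rw [eval, h4]; simp [eval]
    · exact h3
  · rintro s' ⟨h1, -, h3, h4⟩
    have h5 : ∀ c ∉ W, s'.mem c = s.mem c := fun c hc => h4 c fun k hk i _ heq => hc (by
      rw [heq]
      fin_cases i
      · exact ⟨k, .inl rfl⟩
      · exact ⟨k, .inr rfl⟩)
    refine ⟨h.congr (fun c hc => h5 c ?_) fun x hx => ?_, fun e => ⟨?_, ?_, ?_, ?_⟩⟩
    · rintro ⟨i, hi⟩
      omega
    · rw [h1]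
      exact Function.update_of_ne (by omega) _ _
    · rw [h5 _ (by rintro ⟨i, hi⟩; omega)]
      exact hcell e 2
    · rw [h5 _ (by rintro ⟨i, hi⟩; omega)]
      exact hcell e 3
    · have := h3 e e.isLt 0 (by simp)
      rw [dif_pos e.isLt] at this
      simpa using this
    · have := h3 e e.isLt 1 (by simp)
      rw [dif_pos e.isLt] at this
      simpa using this

end RamProg

/-! ### The two programs -/

namespace RamProg

open RamExpr

variable {n m : ℕ} {G : EmbeddedGraph n m} {R : OrthoRep G}
  {G' : EmbeddedGraph (n * 9) (n * 12 + m * 3)} {R' : OrthoRep G'} {T : Thickening R R'}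

/-- The first four cells of the output: the numbers of vertices and edges, and the left copies of
the given darts of the central and the outer face. -/
noncomputable def header : RamProg :=
  stores (fun i : Fin 4 => .add (.reg 0) (.const i))
    (fun i => match i with
      | 0 => numVertices.mul 9
      | 1 => .add (numVertices.mul 12) (numEdges.mul 3)
      | 2 => copyNum (.load (.const 2)) 1
      | 3 => copyNum (.load (.const 3)) 1) Finset.univ.toList

/-- Computing a thickening. -/
noncomputable def buildProg : RamProg :=
  seq setup (seq rootLoop (seq sideLoop (seq gridLoop (seq copyLoop (seq orderLoop header)))))

theorem computes_header (hn : 1 ≤ n) (hdart : T.dart = dartEquiv n m) {s : RamState}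
    (h : Ready R s) (he : ∀ e : Fin (2 * (n * 12 + m * 3)),
      s.mem (4 + 16 * m + 61 * n + 4 + 4 * e) = G'.tail e ∧
      s.mem (4 + 16 * m + 61 * n + 5 + 4 * e) = G'.rev e ∧
      s.mem (4 + 16 * m + 61 * n + 6 + 4 * e) = G'.next e ∧
      s.mem (4 + 16 * m + 61 * n + 7 + 4 * e) = R'.turn e) :
    Computes n header s fun s' => s'.HoldsRep (s'.reg 0) R' := by
  obtain ⟨dc, hdc, hdc'⟩ := h.central
  obtain ⟨d_o, hdo, hdo'⟩ := h.outer
  have hnum : ∀ d x, (T.pre.c d x).val = n * 24 + (signEquiv x + 3 * d) := fun d x => by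
    rw [← dartEquiv_inr, ← hdart]; rfl
  refine LoopFree.computes (stores_loopFree _ _ _) hn ?_
  obtain ⟨h1, -, h3, h4⟩ := exec_stores (l := (Finset.univ : Finset (Fin 4)).toList)
    (A := fun i : Fin 4 => RamExpr.add (.reg 0) (.const i))
    (V := fun i => match i with
      | 0 => numVertices.mul 9
      | 1 => .add (numVertices.mul 12) (numEdges.mul 3)
      | 2 => copyNum (.load (.const 2)) 1
      | 3 => copyNum (.load (.const 3)) 1)
    (a := fun i => 4 + 16 * m + 61 * n + i)
    (v := fun i => match i with
      | 0 => n * 9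
      | 1 => n * 12 + m * 3
      | 2 => T.pre.c dc 1
      | 3 => T.pre.c d_o 1)
    (W := {c | 4 + 16 * m + 61 * n ≤ c}) (s := s) (Finset.nodup_toList _)
    (fun i _ => Nat.le_add_right _ _) (fun i _ j _ hij => Fin.ext (by omega)) (by
      intro s' hs' i _
      have h5 : Ready R s' := h.congr (fun c hc => hs'.2.2 c (by simp; omega))
        fun x _ => by rw [hs'.1]
      have h6 : s'.mem 2 = dc := by rw [hs'.2.2 2 (by simp; omega), hdc']
      have h7 : s'.mem 3 = d_o := by rw [hs'.2.2 3 (by simp; omega), hdo']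
      refine ⟨by simp only [eval, h5.reg0], ?_⟩
      fin_cases i <;>
      simp only [numVertices, numEdges, copyNum, eval, eval_mul, h5.vertices, h5.edges, h6, h7,
        hnum] <;> omega)
  have h5 := fun i => h3 i (Finset.mem_toList.2 (Finset.mem_univ i))
  have h6 : ∀ c ≥ 4 + 16 * m + 61 * n + 4, (header.exec s).mem c = s.mem c := fun c hc =>
    h4 c fun i _ => by have := i.isLt; omega
  rw [show (header.exec s).reg 0 = _ from (congrFun h1 0).trans h.reg0]
  refine ⟨h5 0, h5 1, ⟨T.pre.c dc 1, T.central dc hdc, h5 2⟩, ⟨T.pre.c d_o 1, T.outer d_o hdo, h5 3⟩,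
    fun e => ?_⟩
  obtain ⟨e1, e2, e3, e4⟩ := he e
  rw [h6 _ (by omega), h6 _ (by omega), h6 _ (by omega), h6 _ (by omega)]
  refine ⟨e1, ?_, ?_, ?_⟩
  · rw [← e2]; congr 1; omega
  · rw [← e3]; congr 1; omega
  · rw [← e4]; congr 1; omega

theorem computes_build (hn : 1 ≤ n) (hm : m ≤ 2 * n) (hV : R.VertexCondition)
    (root : Fin n → Fin (2 * m)) (hroot : ∀ v, G.tail (root v) = v)
    (hmax : ∀ d, d ≤ root (G.tail d)) (a : Fin (2 * m) → ℕ)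
    (ha : ∀ d, a d < 4 ∧ ∃ k ≤ 3, (G.next ^ k) (root (G.tail d)) = d ∧
      a d = ∑ i ∈ Finset.range k, R.turn ((G.next ^ i) (root (G.tail d))) ∧
      ∀ i < k, (G.next ^ i) (root (G.tail d)) ≠ d)
    (hside : T.side = fun d => (a d : ZMod 4)) (hvtx : T.vtx = vtxEquiv n)
    (hdart : T.dart = dartEquiv n m) {s : RamState} (hs : s.IsInitial (4 + 8 * m) 0)
    (h : s.HoldsRep 0 R) : Computes n buildProg s fun s' => s'.HoldsRep (s'.reg 0) R' := by
  refine (computes_setup hn (reads_of_holdsRep h)).seq ?_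
  rintro s₁ ⟨h1, z1⟩
  refine (computes_rootLoop hn hm h1 root hroot hmax).seq ?_
  rintro s₂ ⟨h2, r2, z2⟩
  refine (computes_sideLoop hn hm h2 r2 fun d => (ha d).2).seq ?_
  rintro s₃ ⟨h3, r3, z3⟩
  refine (computes_gridLoop (T := T) hn hV hvtx hdart h3).seq ?_
  rintro s₄ ⟨h4, r4, z4⟩
  refine (computes_copyLoop (T := T) hn hm hV hvtx hdart h4 fun d => ?_).seq ?_
  · rw [z4 _ fun v x i heq => ?_, r3, hside, ZMod.val_natCast, Nat.mod_eq_of_lt (ha d).1]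
    have := le_cell (T := T) (T.pre.g v x) i
    omega
  rintro s₅ ⟨h5, r5, z5⟩
  refine (computes_orderLoop (T := T) hn hm hV h5 (fun e i => ?_) fun c hc hne => ?_).seq ?_
  · rcases T.pre.dart_cases e with ⟨v, x, rfl⟩ | ⟨d, x, rfl⟩
    · rw [z5 _ fun d y j heq => T.pre.g_ne_c v x d y (cell_inj hV heq).1]
      exact r4 v x i
    · exact r5 d x i
  · rw [z5 _ fun d x i => hne _ i, z4 _ fun v x i => hne _ i, z3 _ hc, z2 _ (by omega), z1]
    exact hs.2.1 c (by omega)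
  rintro s₆ ⟨h6, r6⟩
  exact computes_header hn hdart h6 r6

/-- Copying the directions of the middle copies of the darts. -/
noncomputable def dirLoop : RamProg :=
  forLoop (numEdges.mul 2) (stores (fun _ : Unit => .add (.reg 0) (.reg 5))
    (fun _ => .load (.add (.add (.const 4) (numEdges.mul 8)) (copyNum (.reg 5) 0))) [()])

/-- Copying the polar coordinates of the centre of a grid. -/
noncomputable def posBody : RamProg :=
  seq (move (.add (.reg 1) (mul (.reg 5) 2))
      (.add (mul (.reg 5) 18) (.const (2 * posEquiv (0, 0)))))
    (move (.add (.add (.reg 1) (mul (.reg 5) 2)) (.const 1))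
      (.add (mul (.reg 5) 18) (.const (2 * posEquiv (0, 0) + 1))))

/-- Converting a drawing of the thickening. -/
noncomputable def convertProg : RamProg :=
  seq (seq (assign 0 (.add (.add (.const 4) (numEdges.mul 14)) (numVertices.mul 24)))
      (assign 1 (numVertices.mul 18)))
    (seq dirLoop (forLoop numVertices posBody))

theorem computes_convert (hn : 1 ≤ n) (hm : m ≤ 2 * n) (hvtx : T.vtx = vtxEquiv n)
    (hdart : T.dart = dartEquiv n m) {D' : Drawing (n * 9) (n * 12 + m * 3)} {s : RamState}
    (h : s.HoldsRep 0 R) (hD : s.HoldsDrawing (4 + 8 * m) 0 D') :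
    Computes n convertProg s fun s' =>
      s'.HoldsDrawing (s'.reg 0) (s'.reg 1) (T.pre.restrict D') := by
  have hr := reads_of_holdsRep h
  have hnum : ∀ d x, (T.pre.c d x).val = n * 24 + (signEquiv x + 3 * d) := fun d x => by
    rw [← dartEquiv_inr, ← hdart]; rfl
  have hpos : ∀ v, (T.vtx (v, (0, 0))).val = posEquiv (0, 0) + 9 * v := fun v => by
    rw [← vtxEquiv_val, ← hvtx]
  refine Computes.seq (Q := fun s' => s'.reg 0 = 4 + 14 * m + 24 * n ∧ s'.reg 1 = 18 * n ∧
    s'.mem = s.mem ∧ s'.real = s.real) (LoopFree.computes ⟨trivial, trivial⟩ hn ?_) ?_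
  · simp [exec, eval, eval_mul, numVertices, numEdges, hr.vertices, hr.edges]
  rintro s₁ ⟨r0, r1, hm1, hreal1⟩
  have hr1 : Reads R s₁ := hr.congr fun c _ => by rw [hm1]
  refine Computes.seq (Q := fun s' => s'.reg 0 = 4 + 14 * m + 24 * n ∧ s'.reg 1 = 18 * n ∧
    s'.mem 0 = n ∧ s'.real = s.real ∧ ∀ d : Fin (2 * m),
      s'.mem (4 + 14 * m + 24 * n + d) = (D'.dir (T.pre.c d 0)).val)
    ((computes_forLoop_stores (ι := Unit) (N := 2 * m) (List.nodup_singleton _) (by omega) hn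
      (fun k _ => 4 + 14 * m + 24 * n + k)
      (fun k _ => if hk : k < 2 * m then (D'.dir (T.pre.c ⟨k, hk⟩ 0)).val else 0)
      {c | 4 + 14 * m + 24 * n ≤ c} ?_ ?_ ?_ ?_).mono ?_) ?_
  · exact fun k _ _ _ => Nat.le_add_right _ _
  · exact fun k _ _ _ k' _ _ _ heq => ⟨Nat.add_left_cancel heq, rfl⟩
  · intro k s' hs'
    have h2 : s'.mem 1 = m := by rw [hs'.2.2 1 (Nat.not_le.2 (by omega))]; exact hr1.edges
    simp [eval_mul, eval, numEdges, h2]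
  · intro k hk s' hs' _ _
    have h1 : s'.mem 0 = n := by rw [hs'.2.2 0 (Nat.not_le.2 (by omega))]; exact hr1.vertices
    have h2 : s'.mem 1 = m := by rw [hs'.2.2 1 (Nat.not_le.2 (by omega))]; exact hr1.edges
    have h3 : s'.reg 5 = k := by rw [hs'.1]; exact Function.update_self 5 k s₁.reg
    have h4 : s'.reg 0 = 4 + 14 * m + 24 * n := by
      rw [hs'.1, ← r0]; exact Function.update_of_ne (show 0 ≠ 5 by omega) k s₁.reg
    have h5 := hD.1 (T.pre.c ⟨k, hk⟩ 0)
    have h6 := (signEquiv 0).isLt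
    rw [hnum] at h5
    rw [dif_pos hk, ← h5]
    refine ⟨by simp only [eval, h3, h4], ?_⟩
    simp only [eval, eval_mul, copyNum, numVertices, numEdges, h1, h2, h3]
    rw [hs'.2.2 _ (Nat.not_le.2 (by omega))]
    change s₁.mem _ = _
    rw [hm1]
    congr 1; omega
  · rintro s' ⟨h1, h2, h3, h4⟩
    refine ⟨?_, ?_, ?_, h2.trans hreal1, fun d => ?_⟩
    · rw [h1, ← r0]; exact Function.update_of_ne (show 0 ≠ 5 by omega) _ s₁.reg
    · rw [h1, ← r1]; exact Function.update_of_ne (show 1 ≠ 5 by omega) _ s₁.reg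
    · rw [h4 0 fun k _ _ _ => by omega]; exact hr1.vertices
    · have := h3 d d.isLt () List.mem_cons_self
      rwa [dif_pos d.isLt] at this
  rintro s₂ ⟨q0, q1, q2, q3, q4⟩
  refine (LoopFree.forLoop (N := n) (p := posBody) ⟨trivial, trivial⟩ (by omega) hn
    (fun k s' => k ≤ n → s'.reg 0 = 4 + 14 * m + 24 * n ∧ s'.reg 1 = 18 * n ∧ s'.mem = s₂.mem ∧
      s'.reg 5 = k ∧ (∀ c < 18 * n, s'.real c = s.real c) ∧ ∀ v : Fin n, v.val < k →
        s'.real (18 * n + 2 * v) = D'.radius (T.vtx (v, (0, 0))) ∧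
        s'.real (18 * n + 2 * v + 1) = D'.angle (T.vtx (v, (0, 0))))
    (fun _ => ?_) ?_ ?_).mono ?_
  · refine ⟨?_, ?_, rfl, Function.update_self 5 0 s₂.reg, fun c _ => by rw [← q3]; rfl,
      fun v hv => absurd hv (Nat.not_lt_zero _)⟩
    · rw [← q0]; exact Function.update_of_ne (show 0 ≠ 5 by omega) 0 s₂.reg
    · rw [← q1]; exact Function.update_of_ne (show 1 ≠ 5 by omega) 0 s₂.reg
  · intro k hk s' hs'
    obtain ⟨-, -, h3, h4, -⟩ := hs' hk
    exact ⟨by simp [numVertices, eval, h3, q2], h4⟩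
  · intro k hk s' hs'
    obtain ⟨h1, h2, h3, h4, h5, h6⟩ := hs' hk.le
    have hp := (posEquiv (0, 0)).isLt
    have hex : posBody.exec s' = RamState.mk s'.reg s'.mem (Function.update
        (Function.update s'.real (18 * n + 2 * k) (s.real (18 * k + 2 * posEquiv (0, 0))))
        (18 * n + 2 * k + 1) (s.real (18 * k + (2 * posEquiv (0, 0) + 1)))) := by
      simp only [posBody, exec, eval, eval_mul, h2, h4]
      rw [Function.update_of_ne (by omega), h5 _ (by omega), h5 _ (by omega)]
    have hv := hD.2 (T.vtx (⟨k, hk⟩, (0, 0)))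
    rw [hpos, zero_add, show 2 * ((posEquiv (0, 0)).val + 9 * k) = 18 * k + 2 * posEquiv (0, 0) by
      ring, add_assoc] at hv
    rw [hex]
    refine ⟨h4, fun _ => ⟨?_, ?_, h3, by simp [RamState.setCounter],
      fun c hc => ?_, fun v hvk => ?_⟩⟩
    · rw [← h1]; exact Function.update_of_ne (show 0 ≠ 5 by omega) (k + 1) s'.reg
    · rw [← h2]; exact Function.update_of_ne (show 1 ≠ 5 by omega) (k + 1) s'.reg
    · rw [← h5 c hc]
      simp only [RamState.setCounter]
      rw [Function.update_of_ne (by omega), Function.update_of_ne (by omega)]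
    · simp only [RamState.setCounter]
      rcases Nat.lt_succ_iff_lt_or_eq.1 hvk with hlt | heq
      · rw [Function.update_of_ne (by omega), Function.update_of_ne (by omega),
          Function.update_of_ne (by omega), Function.update_of_ne (by omega)]
        exact h6 v hlt
      · obtain rfl : v = ⟨k, hk⟩ := Fin.ext heq
        rw [Function.update_of_ne (by simp), Function.update_self, Function.update_self]
        exact hv
  · intro s' hs'
    obtain ⟨h1, h2, h3, -, -, h6⟩ := hs' le_rfl
    rw [h1, h2]
    exact ⟨fun d => by rw [h3]; exact q4 d, fun v => h6 v v.isLt⟩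

end RamProg

/-! ### Properties and computation of thickenings -/

theorem mainTheorem5 :
    ∃ (build convert : RamProg) (c : ℕ),
      ∀ (n m : ℕ) (G : EmbeddedGraph n m) (R : OrthoRep G),
        G.IsPlane → R.VertexCondition → R.FaceCondition →
        -- every thickening has the required properties
        (∀ (n' m' : ℕ) (G' : EmbeddedGraph n' m') (R' : OrthoRep G'),
          Nonempty (Thickening R R') →
            G'.IsPlane ∧ G'.IsSimple ∧ G'.IsBiconnected ∧
            R'.VertexCondition ∧ R'.FaceCondition ∧
            (R.Drawable ↔ R'.Drawable)) ∧
        -- a thickening is computed in linear time, and so is the conversion of its drawings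
        ∃ (n' m' : ℕ) (G' : EmbeddedGraph n' m') (R' : OrthoRep G'),
          Nonempty (Thickening R R') ∧
          (∀ s : RamState, s.IsInitial (4 + 8 * m) 0 → s.HoldsRep 0 R →
            ∃ (t : ℕ) (s' : RamState), Runs build s t s' ∧ t ≤ c * n ∧
              s'.HoldsRep (s'.reg 0) R') ∧
          (∀ D' : Drawing n' m', D'.Realizes R' →
            ∀ s : RamState, s.IsInitial (4 + 8 * m + 2 * m') (2 * n') → s.HoldsRep 0 R →
              s.HoldsDrawing (4 + 8 * m) 0 D' →
              ∃ (t : ℕ) (s' : RamState) (D : Drawing n m), Runs convert s t s' ∧ t ≤ c * n ∧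
                D.Realizes R ∧ s'.HoldsDrawing (s'.reg 0) (s'.reg 1) D) := by
  refine ⟨RamProg.buildProg, RamProg.convertProg,
    max RamProg.buildProg.timeConst RamProg.convertProg.timeConst,
    fun n m G R hP hV hF => ⟨?_, ?_⟩⟩
  · rintro n' m' G' R' ⟨T⟩
    exact ⟨T.pre.isPlane hV hF hP, T.pre.isSimple hV hF,
      T.pre.isBiconnected hP.1 (T.pre.tail_ne_head hV hF), T.pre.vertexCondition hV,
      T.faceCondition hV hF, T.drawable_of_drawable hV,
      fun ⟨D', hD'⟩ => ⟨_, T.realizes_restrict hV hD'⟩⟩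
  · have hn : 1 ≤ n := by
      obtain ⟨v⟩ := hP.1.nonempty
      exact Nat.one_le_of_lt v.isLt
    -- The program that computes a thickening starts at the last dart of every vertex.
    have hroot : ∀ v, ∃ r, G.tail r = v ∧ ∀ d, G.tail d = v → d ≤ r := by
      intro v
      obtain ⟨d, hd⟩ := hV.exists_dart v
      obtain ⟨r, hr, hmax⟩ := Set.exists_max_image {d | G.tail d = v} id (Set.toFinite _) ⟨d, hd⟩
      exact ⟨r, hr, hmax⟩
    choose root hroot hmax using hroot
    obtain ⟨a, hM, ha⟩ := hV.exists_matches root hroot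
    obtain ⟨G', R', T, hside, hvtx, hdart⟩ := exists_thickening hV hM
    refine ⟨_, _, G', R', ⟨T⟩, fun s hs h => ?_, fun D' hD' s _ h hD => ?_⟩
    · obtain ⟨t, s', h1, h2, h3⟩ := RamProg.computes_build hn hV.edges_le hV root hroot
        (fun d => hmax _ d rfl) a ha hside hvtx hdart hs h
      exact ⟨t, s', h1, h2.trans (Nat.mul_le_mul_right _ (le_max_left _ _)), h3⟩
    · obtain ⟨t, s', h1, h2, h3⟩ := RamProg.computes_convert (T := T) hn hV.edges_le hvtx hdart h hD
      exact ⟨t, s', _, h1, h2.trans (Nat.mul_le_mul_right _ (le_max_right _ _)),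
        T.realizes_restrict hV hD', h3⟩
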